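/- Let $H\in(\frac14,1)$, $\lambda,\sigma>0$ and $x_0\in\mathbb R$. Let $(B_t)_{t\ge0}$ be a real fractional Brownian motion of Hurst parameter $H$, i.e. a centered Gaussian process with almost surely continuous paths and $\mathbb E[B_sB_t]=\frac12(t^{2H}+s^{2H}-|t-s|^{2H})$. Let $X$ be the continuous solution of $dX_t=-\lambda X_t\,dt+\sigma\,dB_t$, $X_0=x_0$, i.e. almost surely $X_t=x_0-\lambda\int_0^tX_s\,ds+\sigma(B_t-B_0)$ for all $t\ge0$. Set $$\overline\sigma^2=\frac{\sigma^2\lambda}{2}\int_0^\infty e^{-\lambda s}s^{2H}\,ds .$$ Below, $A\lesssim D$ means $A\le C\,D$ with a constant $C>0$ depending only on $H$. All random variables whose expectations appear are integrable. The following holds. (i) For all $t\ge0$, $$\mathbb E[X_t^2]=e^{-2\lambda t}|x_0|^2+\sigma^2H\left(\int_0^te^{-\lambda z}|z|^{2H-1}\,dz+e^{-\lambda t}\int_0^te^{-\lambda(t-z)}|z|^{2H-1}\,dz\right).$$ (ii) For all $t\ge0$, $$\left|\mathbb E[X_t^2]-\overline\sigma^2\right|\lesssim e^{-2\lambda t}|x_0|^2+\sigma^2\frac1{\lambda^{2H}}e^{-\frac\lambda2t}.$$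 (iii) For all $T\ge0$, with $I=\int_0^{\sigma/\lambda^H}\log^{\frac12}(1+\epsilon^{-\frac1H})\,d\epsilon$, $$\mathbb E\Big[\sup_{t\in[0,T]}X_t^2\Big]\lesssim x_0^2+\frac{\sigma^2}{\lambda^{2H}}\log\left(e+T\sigma^{\frac1H}\big(\lambda^{\frac{1-H}H}\vee1\big)\right)+I^2+\frac{\sigma}{\lambda^H}(I+1).$$ (iv) If $H\in(\frac14,\frac12]$, then for all $t>0$, $$\begin{aligned}\mathbb E\left[\Big|\frac1t\int_0^tX_s^2\,ds-\overline\sigma^2\Big|^2\right]\lesssim{}&\frac{\overline\sigma^2}{\lambda t}\Big(\frac{\sigma^2}{\lambda^{2H}}+|x_0|^2\Big)+\frac{|x_0|^4}{\lambda^2t^2}+\frac1{\lambda t^2}\Big(\overline\sigma^2t+\sigma^2+\frac{\sigma^2}{\lambda^{2H+1}}\Big)\\&+\frac1{\lambda^2t^2}\Big(\sigma^2+\frac{\sigma^2}{\lambda^{2H}}\Big)^2+\frac{\overline\sigma^2}{\lambda t}\Big(\sigma^2+\frac{\sigma^2}{\lambda^{2H}}\Big)+\frac{\sigma^4}{\lambda^{4H+1}t}+\mathcal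 R_H(t),\end{aligned}$$ where $\mathcal R_H(t)$ is a function of $H,\lambda,\sigma,t$ only. For $H=\frac12$ it vanishes identically. For $H\in(\frac14,\frac12)$ it is nonnegative and, for each $\theta\in(0,1)$, there is a constant $C_\theta>0$ depending only on $H$ and $\theta$ such that for all $\lambda,\sigma,t>0$ $$\begin{aligned}\frac{\mathcal R_H(t)}{\sigma^4}\le C_\theta\Big(&\frac1{\lambda^{4H+2}t^2}+\frac1{\lambda^3t^{3-4H}}+\frac1{\lambda^{4H+1}t}+\frac1{\lambda^{4H}t}+\frac1{\lambda^4t^{1-\theta}}\\&+\frac1{\lambda^{1+4H-\theta}t^{1-\theta}}+\frac1{\lambda^4t^{4-4H}}+\frac1{\lambda^{4H-\theta}t^{2-\theta}}\Big).\end{aligned}$$ -/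

import Mathlib

open MeasureTheory ProbabilityTheory
open scoped NNReal ENNReal

namespace FracOU

/-- `B` is a real fractional Brownian motion with Hurst parameter `H` under `P`: a centered Gaussian
process with covariance `(t ^ 2H + s ^ 2H - |t - s| ^ 2H) / 2` and almost surely continuous
paths. -/
structure IsFractionalBrownian {Ω : Type*} [MeasurableSpace Ω] (H : ℝ) (B : ℝ≥0 → Ω → ℝ)
    (P : Measure Ω) : Prop where
  gaussian : IsGaussianProcess B P
  centered : ∀ t, P[B t] = 0
  covariance : ∀ s t : ℝ≥0, cov[B s, B t; P] =
    ((t : ℝ) ^ (2 * H) + (s : ℝ) ^ (2 * H) - |(t : ℝ) - (s : ℝ)| ^ (2 * H)) / 2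
  cont : ∀ᵐ ω ∂P, Continuous fun t ↦ B t ω

/-- `X` is a continuous pathwise solution of `dX = -lam X dt + sig dB`, `X 0 = x₀`. Since the noise
is additive, the Young integral of the constant `sig` against `B` over `[0, t]` is
`sig * (B t - B 0)`. -/
structure IsOUSolution {Ω : Type*} [MeasurableSpace Ω] (lam sig x₀ : ℝ) (B X : ℝ≥0 → Ω → ℝ)
    (P : Measure Ω) : Prop where
  cont : ∀ᵐ ω ∂P, Continuous fun t ↦ X t ω
  eqn : ∀ᵐ ω ∂P, ∀ t : ℝ≥0, X t ω =
    x₀ - lam * (∫ s in (0 : ℝ)..t, X s.toNNReal ω) + sig * (B t ω - B 0 ω)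

/-- The limit variance, written `σ̄²` in the mathematics. -/
noncomputable def limitVar (H lam sig : ℝ) : ℝ :=
  sig ^ 2 * lam / 2 * ∫ s in Set.Ioi (0 : ℝ), Real.exp (-lam * s) * s ^ (2 * H)

/-- The time average `(1 / t) ∫₀ᵗ X_s² ds`. -/
noncomputable def timeAvgSq {Ω : Type*} (X : ℝ≥0 → Ω → ℝ) (t : ℝ) (ω : Ω) : ℝ :=
  1 / t * ∫ s in (0 : ℝ)..t, X s.toNNReal ω ^ 2

/-- The entropy integral `∫₀ᵃ log^{1/2} (1 + ε ^ (-1/H)) dε`. -/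
noncomputable def entropyInt (H a : ℝ) : ℝ :=
  ∫ ε in (0 : ℝ)..a, Real.log (1 + ε ^ (-(1 / H))) ^ (1 / 2 : ℝ)

/-- The bound for `E sup_{[0,T]} X²`, up to a multiplicative constant. -/
noncomputable def supBound (H lam sig x₀ T : ℝ) : ℝ :=
  x₀ ^ 2
    + sig ^ 2 / lam ^ (2 * H)
        * Real.log (Real.exp 1 + T * sig ^ (1 / H) * max (lam ^ ((1 - H) / H)) 1)
    + entropyInt H (sig / lam ^ H) ^ 2
    + sig / lam ^ H * (entropyInt H (sig / lam ^ H) + 1)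

/-- The part of the ergodic rate that precedes the remainder, up to a multiplicative constant. -/
noncomputable def ergodicBound (H lam sig x₀ t : ℝ) : ℝ :=
  limitVar H lam sig / (lam * t) * (sig ^ 2 / lam ^ (2 * H) + x₀ ^ 2)
    + 1 / (lam ^ 2 * t ^ 2) * x₀ ^ 4
    + 1 / (lam * t ^ 2)
        * (limitVar H lam sig * t + sig ^ 2 + sig ^ 2 / lam ^ (2 * H + 1))
    + 1 / (lam ^ 2 * t ^ 2) * (sig ^ 2 + sig ^ 2 / lam ^ (2 * H)) ^ 2
    + limitVar H lam sig / (lam * t) * (sig ^ 2 + sig ^ 2 / lam ^ (2 * H))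
    + sig ^ 4 / (lam ^ (4 * H + 1) * t)

/-- The bound for the remainder divided by `sig ^ 4`, up to a multiplicative constant. -/
noncomputable def remainderBound (H θ lam t : ℝ) : ℝ :=
  1 / (lam ^ (4 * H + 2) * t ^ 2)
    + 1 / (lam ^ 3 * t ^ (3 - 4 * H))
    + 1 / (lam ^ (4 * H + 1) * t)
    + 1 / (lam ^ (4 * H) * t)
    + 1 / (lam ^ 4 * t ^ (1 - θ))
    + 1 / (lam ^ (1 + 4 * H - θ) * t ^ (1 - θ))
    + 1 / (lam ^ 4 * t ^ (4 - 4 * H))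
    + 1 / (lam ^ (4 * H - θ) * t ^ (2 - θ))

end FracOU

/-!
The proof rests on an explicit description of the solution. By self-similarity of fractional
Brownian motion, `b u = λ^H B (u / λ)` is again one, and variation of constants gives
`X t = e^{-λt} x₀ + σ λ^{-H} Y (λt)` with the normalised process
`Y t = b t - ∫₀ᵗ e^{-(t-s)} b s ds` (`ouProc`, the image of `b` under `ouMap`); this is
`IsOUSolution.exists_eq_ouProc`. No integral against `b` is ever needed: covariances of `Y` arise
from that of `b` by applying `ouMap` in each variable (`mixedCov`, `ouCov`).

*Second moment.* The variance `ouCov H u u` has an explicit form in incomplete Gamma integrals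
(`ouCov_self`), which gives both the integral formula (`ouCov_self_eq_integral`) and convergence to
`Γ(2H + 1) / 2` at rate `e^{-u/2}` (`exists_abs_ouCov_self_sub_le`).

*Supremum.* Since `ouMap` forgets the past exponentially fast, `|Y|` on `[0, N]` is bounded by the
oscillation of `b` on unit intervals (`abs_ouMap_le`), so that only a factor `log N` is lost.
The oscillation is bounded by dyadic chaining, where the maximum over the `M = N 2ⁿ` increments of
level `n` is estimated through `x ≤ log M + e^x / M` and the Gaussian exponential moment
`E exp (Z² / 4 Var Z) = √2` (`dyadicIncr_sq_le`, `lintegral_chainEnvelope_le`).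

*Time averages.* Linear combinations of `Y` are Gaussian as limits of Riemann sums
(`map_ouProc_combination`), whence Wick's formula: `Y_u²` and `Y_v²` have covariance
`2 (ouCov H u v)²` (`integral_centered_sq_mul`). For fixed `u`, the function `f = ouCov H u` solves
`f' = -f + g` for `v > u`, where `g` is the derivative of `mixedCov H u` and satisfies
`|g v| ≤ min (d^{2H-1}) (d^{2H-2})` with `d = v - u`. The square of this bound is integrable over
`d > 0` exactly because `1/4 < H`, and the energy estimate for the equation
(`integral_sq_le_of_hasDerivAt`) bounds `∫ f²` uniformly in `u`. Hence the mean square of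
`∫₀ᵀ (Y_u² - E Y_u²) du` is `O(T)` throughout `1/4 < H ≤ 1/2`. In the original variables this is a
contribution of order `σ⁴ / (λ^{4H+1} t)`, and together with those of the initial value and of the
bias of the variance it is dominated by `ergodicBound` (`integral_sq_timeAvg_le`,
`le_ergodicBound`). The remainder of the theorem is therefore taken to be zero, which is the
strongest form of the last estimate.
-/

/-! ### The Ornstein-Uhlenbeck map and the covariances -/

namespace FracOU
open Real Set

/-- The solution map of the normalised Langevin equation `f t = φ t - ∫₀ᵗ f`: it sends a driving
path `φ` to `φ t - ∫₀ᵗ e^{-(t-s)} φ s ds`. -/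
noncomputable def ouMap (φ : ℝ → ℝ) (t : ℝ) : ℝ :=
  φ t - ∫ s in (0 : ℝ)..t, exp (-(t - s)) * φ s

lemma integral_exp_neg_sub_mul (φ : ℝ → ℝ) (t : ℝ) :
    ∫ s in (0 : ℝ)..t, exp (-(t - s)) * φ s = exp (-t) * ∫ s in (0 : ℝ)..t, exp s * φ s := by
  rw [← intervalIntegral.integral_const_mul]
  congr 1; ext s
  rw [← mul_assoc, ← exp_add]; ring_nf

lemma integral_exp_neg_sub (t : ℝ) : ∫ s in (0 : ℝ)..t, exp (-(t - s)) = 1 - exp (-t) := by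
  have := integral_exp_neg_sub_mul (fun _ ↦ 1) t
  simp only [mul_one, integral_exp, exp_zero] at this
  rw [this, mul_sub, ← exp_add]; simp

lemma ouMap_const (c t : ℝ) : ouMap (fun _ ↦ c) t = exp (-t) * c := by
  rw [ouMap, intervalIntegral.integral_mul_const, integral_exp_neg_sub]; ring

lemma ouMap_add {φ ψ : ℝ → ℝ} (hφ : Continuous φ) (hψ : Continuous ψ) (t : ℝ) :
    ouMap (fun s ↦ φ s + ψ s) t = ouMap φ t + ouMap ψ t := by
  simp only [ouMap, mul_add]
  rw [intervalIntegral.integral_add] <;> [ring; skip; skip] <;>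
    exact Continuous.intervalIntegrable (by fun_prop) _ _

/-- Variation of constants. -/
lemma eq_ouMap_of_integral_eq {f φ : ℝ → ℝ} (hf : Continuous f) (hφ : Continuous φ)
    (h : ∀ t, 0 ≤ t → f t = φ t - ∫ s in (0 : ℝ)..t, f s) {t : ℝ} (ht : 0 ≤ t) :
    f t = ouMap φ t := by
  have hd (s : ℝ) : HasDerivAt (fun s ↦ ∫ x in (0 : ℝ)..s, f x) (f s) s :=
    (hf.integral_hasStrictDerivAt 0 _).hasDerivAt
  have key : ∫ s in (0 : ℝ)..t, exp s * φ s = exp t * ∫ s in (0 : ℝ)..t, f s := by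
    rw [intervalIntegral.integral_eq_sub_of_hasDerivAt
      (f := fun s ↦ exp s * ∫ x in (0 : ℝ)..s, f x)]
    · simp
    · intro s hs
      rw [uIcc_of_le ht] at hs
      refine ((Real.hasDerivAt_exp s).mul (hd s)).congr_deriv ?_
      rw [h s hs.1]; ring
    · exact Continuous.intervalIntegrable (by fun_prop) _ _
  rw [ouMap, integral_exp_neg_sub_mul, key, h t ht, ← mul_assoc, ← exp_add]
  simp

lemma hasDerivAt_ouMap {φ : ℝ → ℝ} (hφ : Continuous φ) {t φ' : ℝ} (h : HasDerivAt φ φ' t) :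
    HasDerivAt (ouMap φ) (φ' - ouMap φ t) t := by
  have hc : Continuous fun s ↦ exp s * φ s := by fun_prop
  have h1 : HasDerivAt (fun t ↦ ∫ s in (0 : ℝ)..t, exp s * φ s) (exp t * φ t) t :=
    (hc.integral_hasStrictDerivAt 0 _).hasDerivAt
  have h2 : HasDerivAt (fun t ↦ exp (-t)) (-exp (-t)) t := by
    simpa using (hasDerivAt_neg t).exp
  have h3 := h.sub (h2.mul h1)
  have e : ouMap φ = fun t ↦ φ t - exp (-t) * ∫ s in (0 : ℝ)..t, exp s * φ s := by
    ext t; rw [ouMap, integral_exp_neg_sub_mul]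
  rw [e]
  refine h3.congr_deriv ?_
  have : exp (-t) * exp t = 1 := by rw [← exp_add]; simp
  linear_combination (-φ t) * this

lemma continuous_ouMap_param {X : Type*} [TopologicalSpace X] {φ : X → ℝ → ℝ} {s : X → ℝ}
    (hφ : Continuous (Function.uncurry φ)) (hs : Continuous s) :
    Continuous fun x ↦ ouMap (φ x) (s x) := by
  unfold ouMap
  refine Continuous.sub (hφ.comp (continuous_id.prodMk hs)) ?_
  refine intervalIntegral.continuous_parametric_intervalIntegral_of_continuous
    (f := fun x y ↦ exp (-(s x - y)) * φ x y) ?_ hs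
  refine Continuous.mul ?_ hφ
  fun_prop

/-- The covariance of fractional Brownian motion, extended to real times in a continuous way. -/
noncomputable def fbmCov (H s t : ℝ) : ℝ :=
  (|t| ^ (2 * H) + |s| ^ (2 * H) - |t - s| ^ (2 * H)) / 2

lemma continuous_abs_rpow {a : ℝ} (ha : 0 ≤ a) : Continuous fun x : ℝ ↦ |x| ^ a :=
  continuous_abs.rpow_const fun _ ↦ Or.inr ha

lemma continuous_fbmCov {H : ℝ} (hH : 0 < H) :
    Continuous fun p : ℝ × ℝ ↦ fbmCov H p.1 p.2 := by
  have h := continuous_abs_rpow (a := 2 * H) (by positivity)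
  unfold fbmCov
  exact (((h.comp continuous_snd).add (h.comp continuous_fst)).sub
    (h.comp (continuous_snd.sub continuous_fst))).div_const _

/-- The covariance `E[Y_u B_v]` of the normalised fractional Ornstein-Uhlenbeck process with its
driving noise. -/
noncomputable def mixedCov (H u v : ℝ) : ℝ := ouMap (fun s ↦ fbmCov H s v) u

/-- The covariance `E[Y_u Y_v]` of the normalised fractional Ornstein-Uhlenbeck process. -/
noncomputable def ouCov (H u v : ℝ) : ℝ := ouMap (mixedCov H u) v

lemma continuous_mixedCov {H : ℝ} (hH : 0 < H) :
    Continuous fun p : ℝ × ℝ ↦ mixedCov H p.1 p.2 := by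
  refine continuous_ouMap_param (φ := fun (p : ℝ × ℝ) s ↦ fbmCov H s p.2) ?_ continuous_fst
  exact (continuous_fbmCov hH).comp (continuous_snd.prodMk (continuous_snd.comp continuous_fst))

lemma continuous_ouCov {H : ℝ} (hH : 0 < H) :
    Continuous fun p : ℝ × ℝ ↦ ouCov H p.1 p.2 := by
  refine continuous_ouMap_param (φ := fun (p : ℝ × ℝ) s ↦ mixedCov H p.1 s) ?_ continuous_snd
  exact (continuous_mixedCov hH).comp ((continuous_fst.comp continuous_fst).prodMk continuous_snd)

lemma continuous_mixedCov_right {H : ℝ} (hH : 0 < H) (u : ℝ) : Continuous (mixedCov H u) :=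
  (continuous_mixedCov hH).comp (f := fun v ↦ (u, v)) (by fun_prop)

lemma continuous_ouCov_right {H : ℝ} (hH : 0 < H) (u : ℝ) : Continuous (ouCov H u) :=
  continuous_ouMap_param (φ := fun _ ↦ mixedCov H u)
    ((continuous_mixedCov_right hH u).comp continuous_snd) continuous_id

/-- An incomplete Gamma integral, `∫₀ˣ e^{-w} |w|ᵃ dw`. -/
noncomputable def lowerGamma (a x : ℝ) : ℝ := ∫ w in (0 : ℝ)..x, exp (-w) * |w| ^ a

/-- The companion integral `∫₀ˣ eʷ |w|ᵃ dw` with a growing exponential. -/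
noncomputable def growingGamma (a x : ℝ) : ℝ := ∫ w in (0 : ℝ)..x, exp w * |w| ^ a

lemma hasDerivAt_lowerGamma {a : ℝ} (ha : 0 ≤ a) (x : ℝ) :
    HasDerivAt (lowerGamma a) (exp (-x) * |x| ^ a) x := by
  have hc : Continuous fun w : ℝ ↦ exp (-w) * |w| ^ a := by
    have := continuous_abs_rpow ha; fun_prop
  exact (hc.integral_hasStrictDerivAt 0 _).hasDerivAt

lemma hasDerivAt_growingGamma {a : ℝ} (ha : 0 ≤ a) (x : ℝ) :
    HasDerivAt (growingGamma a) (exp x * |x| ^ a) x := by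
  have hc : Continuous fun w : ℝ ↦ exp w * |w| ^ a := by
    have := continuous_abs_rpow ha; fun_prop
  exact (hc.integral_hasStrictDerivAt 0 _).hasDerivAt

lemma lowerGamma_zero (a : ℝ) : lowerGamma a 0 = 0 := by simp [lowerGamma]

lemma growingGamma_zero (a : ℝ) : growingGamma a 0 = 0 := by simp [growingGamma]

lemma lowerGamma_neg (a x : ℝ) : lowerGamma a (-x) = -growingGamma a x := by
  have := intervalIntegral.integral_comp_neg (a := 0) (b := x) (fun w ↦ exp (-w) * |w| ^ a)
  simp only [neg_neg, abs_neg, neg_zero] at this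
  rw [growingGamma, this, lowerGamma, intervalIntegral.integral_symm]

/-- The three terms of `fbmCov` under the map `ouMap`; the last one becomes an incomplete Gamma
integral, on which the dependence on `v` can be read off. -/
lemma mixedCov_eq {H : ℝ} (hH : 0 < H) (u v : ℝ) :
    mixedCov H u v = (ouMap (fun s ↦ |s| ^ (2 * H)) u + exp (-u) * |v| ^ (2 * H)
      - |v - u| ^ (2 * H)
      + exp (v - u) * (lowerGamma (2 * H) v - lowerGamma (2 * H) (v - u))) / 2 := by
  have hp := continuous_abs_rpow (a := 2 * H) (by positivity)
  have hp' : Continuous fun s : ℝ ↦ |v - s| ^ (2 * H) := hp.comp (by fun_prop)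
  have h1 : ∫ s in (0 : ℝ)..u, exp (-(u - s)) * |v - s| ^ (2 * H)
      = exp (v - u) * (lowerGamma (2 * H) v - lowerGamma (2 * H) (v - u)) := by
    have := intervalIntegral.integral_comp_sub_left (a := 0) (b := u)
      (fun w ↦ exp (v - u) * (exp (-w) * |w| ^ (2 * H))) v
    rw [sub_zero, intervalIntegral.integral_const_mul (exp (v - u))
      fun w ↦ exp (-w) * |w| ^ (2 * H)] at this
    rw [lowerGamma, lowerGamma, intervalIntegral.integral_interval_sub_left, ← this]
    · congr 1; ext s; rw [← mul_assoc, ← exp_add]; ring_nf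
    all_goals exact Continuous.intervalIntegrable (by fun_prop) _ _
  have h2 : ∫ s in (0 : ℝ)..u, exp (-(u - s)) * fbmCov H s v
      = ((∫ s in (0 : ℝ)..u, exp (-(u - s)) * |s| ^ (2 * H)) + (1 - exp (-u)) * |v| ^ (2 * H)
        - ∫ s in (0 : ℝ)..u, exp (-(u - s)) * |v - s| ^ (2 * H)) / 2 := by
    rw [← integral_exp_neg_sub, ← intervalIntegral.integral_mul_const,
      ← intervalIntegral.integral_add, ← intervalIntegral.integral_sub,
      ← intervalIntegral.integral_div]
    · congr 1; ext s; simp only [fbmCov]; ring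
    all_goals exact Continuous.intervalIntegrable (by fun_prop) _ _
  rw [mixedCov, ouMap, h2, h1, fbmCov, ouMap]
  ring

end FracOU

/-! ### Square integrability of the covariance in the time lag -/

namespace FracOU
open Real Set

/-- The upper incomplete Gamma integral on `[d, v]`, rescaled by `e^d`. -/
noncomputable def tailGamma (a d v : ℝ) : ℝ := exp d * ∫ w in d..v, exp (-w) * w ^ a

lemma continuousOn_exp_neg_mul_rpow {d v : ℝ} (hd : 0 < d) (hv : d ≤ v) (a : ℝ) :
    ContinuousOn (fun w : ℝ ↦ exp (-w) * w ^ a) (uIcc d v) := by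
  rw [uIcc_of_le hv]
  refine ContinuousOn.mul (by fun_prop) ?_
  exact continuousOn_id.rpow_const fun x hx ↦ Or.inl (hd.trans_le hx.1).ne'

/-- Integration by parts. -/
lemma tailGamma_eq {d v : ℝ} (hd : 0 < d) (hv : d ≤ v) (a : ℝ) :
    tailGamma a d v = d ^ a - exp (d - v) * v ^ a + a * tailGamma (a - 1) d v := by
  have i1 := (continuousOn_exp_neg_mul_rpow hd hv a).intervalIntegrable (μ := volume)
  have i2 := (continuousOn_exp_neg_mul_rpow hd hv (a - 1)).intervalIntegrable (μ := volume)
  have h := intervalIntegral.integral_eq_sub_of_hasDerivAt (a := d) (b := v)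
    (f := fun w : ℝ ↦ -(exp (-w) * w ^ a))
    (f' := fun w ↦ exp (-w) * w ^ a - a * (exp (-w) * w ^ (a - 1))) ?_ (i1.sub (i2.const_mul a))
  · rw [intervalIntegral.integral_sub i1 (i2.const_mul a),
      intervalIntegral.integral_const_mul] at h
    have e1 : exp d * exp (-d) = 1 := by rw [← exp_add]; simp
    have e2 : exp (d - v) = exp d * exp (-v) := by rw [← exp_add]; ring_nf
    rw [tailGamma, tailGamma, e2]
    linear_combination exp d * h + d ^ a * e1
  · intro w hw
    rw [uIcc_of_le hv] at hw
    have h1 := (hasDerivAt_neg w).exp.mul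
      (Real.hasDerivAt_rpow_const (p := a) (Or.inl (hd.trans_le hw.1).ne'))
    refine h1.neg.congr_deriv ?_
    ring

lemma tailGamma_nonneg {d v : ℝ} (hd : 0 < d) (hv : d ≤ v) (a : ℝ) : 0 ≤ tailGamma a d v := by
  refine mul_nonneg (exp_pos _).le (intervalIntegral.integral_nonneg hv fun w hw ↦ ?_)
  have := hd.trans_le hw.1
  positivity

lemma tailGamma_le {a d v : ℝ} (ha : a ≤ 0) (hd : 0 < d) (hv : d ≤ v) :
    tailGamma a d v ≤ d ^ a := by
  have h1 : ∫ w in d..v, exp (-w) * w ^ a ≤ ∫ w in d..v, exp (-w) * d ^ a := by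
    refine intervalIntegral.integral_mono_on hv
      (continuousOn_exp_neg_mul_rpow hd hv a).intervalIntegrable
      (Continuous.intervalIntegrable (by fun_prop) _ _) fun w hw ↦ ?_
    exact mul_le_mul_of_nonneg_left (Real.rpow_le_rpow_of_nonpos hd hw.1 ha) (exp_pos _).le
  have h2 : ∫ w in d..v, exp (-w) * d ^ a = (exp (-d) - exp (-v)) * d ^ a := by
    rw [intervalIntegral.integral_mul_const]
    congr 1
    have := intervalIntegral.integral_comp_neg (a := d) (b := v) exp
    rw [this, integral_exp]
  have h3 : exp d * exp (-d) = 1 := by rw [← exp_add]; simp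
  have h4 : 0 < exp d * exp (-v) * d ^ a := by positivity
  calc tailGamma a d v ≤ exp d * ((exp (-d) - exp (-v)) * d ^ a) := by
        rw [tailGamma, ← h2]; gcongr
    _ ≤ d ^ a := by
        have : exp d * ((exp (-d) - exp (-v)) * d ^ a)
          = exp d * exp (-d) * d ^ a - exp d * exp (-v) * d ^ a := by ring
        rw [this, h3]; linarith

/-- The derivative of `v ↦ E[Y_u B_v]` after time `u`. -/
lemma hasDerivAt_mixedCov {H u v : ℝ} (hH : 0 < H) (hu : 0 ≤ u) (huv : u < v) :
    HasDerivAt (mixedCov H u)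
      (H * (2 * H - 1) * tailGamma (2 * H - 2) (v - u) v) v := by
  have hv : 0 < v := hu.trans_lt huv
  have hd : 0 < v - u := sub_pos.2 huv
  have hsub : HasDerivAt (fun v ↦ v - u) 1 v := (hasDerivAt_id v).sub_const u
  have habs {x : ℝ} (hx : 0 < x) :
      HasDerivAt (fun y : ℝ ↦ |y| ^ (2 * H)) (2 * H * x ^ (2 * H - 1)) x := by
    refine (Real.hasDerivAt_rpow_const (p := 2 * H) (Or.inl hx.ne')).congr_of_eventuallyEq ?_
    filter_upwards [eventually_gt_nhds hx] with y hy
    rw [abs_of_pos hy]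
  have h1 := (habs hv).const_mul (exp (-u))
  have h2 : HasDerivAt (fun y ↦ |y - u| ^ (2 * H)) (2 * H * (v - u) ^ (2 * H - 1)) v := by
    exact (habs hd).comp_sub_const v u
  have h3 := hasDerivAt_lowerGamma (a := 2 * H) (by positivity) v
  have h4 : HasDerivAt (fun y ↦ lowerGamma (2 * H) (y - u))
      (exp (-(v - u)) * |v - u| ^ (2 * H)) v := by
    exact (hasDerivAt_lowerGamma (a := 2 * H) (by positivity) (v - u)).comp_sub_const v u
  have h5 := ((((h1.const_add (ouMap (fun s ↦ |s| ^ (2 * H)) u)).sub h2).add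
    (hsub.exp.mul (h3.sub h4)))).div_const 2
  have e : mixedCov H u = fun v ↦ _ := funext fun v ↦ mixedCov_eq hH u v
  rw [e]
  refine h5.congr_deriv ?_
  have hle : v - u ≤ v := by linarith
  have t1 := tailGamma_eq hd hle (2 * H)
  have t2 := tailGamma_eq hd hle (2 * H - 1)
  have t0 : tailGamma (2 * H) (v - u) v
      = exp (v - u) * (lowerGamma (2 * H) v - lowerGamma (2 * H) (v - u)) := by
    have hc : Continuous fun w : ℝ ↦ exp (-w) * |w| ^ (2 * H) := by
      have := continuous_abs_rpow (a := 2 * H) (by positivity); fun_prop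
    rw [tailGamma, lowerGamma, lowerGamma, intervalIntegral.integral_interval_sub_left
      (hc.intervalIntegrable _ _) (hc.intervalIntegrable _ _)]
    congr 1
    refine intervalIntegral.integral_congr fun w hw ↦ ?_
    rw [uIcc_of_le hle] at hw
    simp only [abs_of_pos (hd.trans_le hw.1)]
  have e1 : exp (v - u) * exp (-(v - u)) = 1 := by rw [← exp_add]; simp
  have e2 : exp (v - u) * exp (-v) = exp (-u) := by rw [← exp_add]; ring_nf
  have e3 : v - u - v = -u := by ring
  rw [e3] at t1 t2
  rw [show 2 * H - 1 - 1 = 2 * H - 2 by ring] at t2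
  simp only [Pi.sub_apply, abs_of_pos hv, abs_of_pos hd, mul_one]
  rw [← t0]
  linear_combination (1 / 2) * t1 + H * t2 + v ^ (2 * H) / 2 * e2 - (v - u) ^ (2 * H) / 2 * e1

/-- The derivative of `v ↦ E[Y_u B_v]` decays like the second derivative of `d ↦ d ^ (2H)` in the
time lag `d = v - u`, and has only the singularity of the first derivative at `d = 0`. -/
lemma abs_deriv_mixedCov_le {H u v : ℝ} (hH : H ∈ Ioc (1 / 4 : ℝ) (1 / 2)) (hu : 0 ≤ u)
    (huv : u < v) :
    |H * (2 * H - 1) * tailGamma (2 * H - 2) (v - u) v| ≤ (v - u) ^ (2 * H - 1) ∧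
    |H * (2 * H - 1) * tailGamma (2 * H - 2) (v - u) v| ≤ (v - u) ^ (2 * H - 2) := by
  obtain ⟨h1, h2⟩ := hH
  have hd : 0 < v - u := sub_pos.2 huv
  have hle : v - u ≤ v := by linarith
  have hJ := tailGamma_nonneg hd hle (2 * H - 2)
  have habs : |H * (2 * H - 1) * tailGamma (2 * H - 2) (v - u) v|
      = H * (1 - 2 * H) * tailGamma (2 * H - 2) (v - u) v := by
    rw [abs_mul, abs_mul, abs_of_pos (by linarith : 0 < H), abs_of_nonpos (by linarith),
      abs_of_nonneg hJ]; ring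
  rw [habs]
  constructor
  · have t2 := tailGamma_eq hd hle (2 * H - 1)
    rw [show 2 * H - 1 - 1 = 2 * H - 2 by ring] at t2
    have hJ' := tailGamma_nonneg hd hle (2 * H - 1)
    have hp : 0 ≤ exp (v - u - v) * v ^ (2 * H - 1) := by
      have := hu.trans_lt huv; positivity
    have h3 : (1 - 2 * H) * tailGamma (2 * H - 2) (v - u) v ≤ (v - u) ^ (2 * H - 1) := by linarith
    have h4 : 0 ≤ (v - u) ^ (2 * H - 1) := by positivity
    nlinarith
  · have h3 := tailGamma_le (a := 2 * H - 2) (by linarith) hd hle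
    have h4 : H * (1 - 2 * H) ≤ 1 := by nlinarith
    have h5 : 0 ≤ (v - u) ^ (2 * H - 2) := by positivity
    have h6 : 0 ≤ H * (1 - 2 * H) := mul_nonneg (by linarith) (by linarith)
    nlinarith

/-- A bounded function of the time lag whose derivative dominates the square of
`d ↦ min (d ^ (2H - 1)) (d ^ (2H - 2))`. It exists only for `1 / 4 < H`. -/
noncomputable def lagPotential (H d : ℝ) : ℝ :=
  4 / (4 * H - 1) * (d / (1 + d)) ^ (4 * H - 1)

lemma lagPotential_mem_Icc {H d : ℝ} (hH : 1 / 4 < H) (hd : 0 ≤ d) :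
    lagPotential H d ∈ Icc 0 (4 / (4 * H - 1)) := by
  have h0 : 0 < 4 * H - 1 := by linarith
  refine ⟨by unfold lagPotential; positivity, ?_⟩
  refine mul_le_of_le_one_right (by positivity) (Real.rpow_le_one (by positivity) ?_ h0.le)
  rw [div_le_one (by positivity)]; linarith

lemma exists_hasDerivAt_lagPotential {H d : ℝ} (hH : H ∈ Ioc (1 / 4 : ℝ) (1 / 2)) (hd : 0 < d) :
    ∃ D, HasDerivAt (lagPotential H) D d ∧
      ∀ x, |x| ≤ d ^ (2 * H - 1) → |x| ≤ d ^ (2 * H - 2) → x ^ 2 ≤ D := by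
  obtain ⟨h1, h2⟩ := hH
  have h0 : 4 * H - 1 ≠ 0 := by linarith
  have hq : HasDerivAt (fun d : ℝ ↦ d / (1 + d)) (1 / (1 + d) ^ 2) d := by
    have := (hasDerivAt_id d).div ((hasDerivAt_id d).const_add 1) (by simp; positivity)
    refine this.congr_deriv ?_
    simp
  have hdq : 0 < d / (1 + d) := by positivity
  have hq1 : d / (1 + d) ≤ 1 := by rw [div_le_one (by positivity)]; linarith
  refine ⟨4 * (d / (1 + d)) ^ (4 * H - 2) * (1 / (1 + d) ^ 2), ?_, fun x hx1 hx2 ↦ ?_⟩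
  · refine ((hq.rpow_const (p := 4 * H - 1) (Or.inl hdq.ne')).const_mul
      (4 / (4 * H - 1))).congr_deriv ?_
    rw [show 4 * H - 1 - 1 = 4 * H - 2 by ring]
    field_simp
  · rcases le_total d 1 with h | h
    · have e1 : x ^ 2 ≤ d ^ (4 * H - 2) := by
        rw [← sq_abs, show 4 * H - 2 = (2 * H - 1) * 2 by ring, Real.rpow_mul hd.le, rpow_two]
        gcongr
      have e2 : d ^ (4 * H - 2) ≤ (d / (1 + d)) ^ (4 * H - 2) := by
        refine Real.rpow_le_rpow_of_nonpos hdq ?_ (by linarith)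
        rw [div_le_iff₀ (by positivity)]; nlinarith
      have e3 : (1 : ℝ) / 4 ≤ 1 / (1 + d) ^ 2 := by
        apply one_div_le_one_div_of_le (by positivity); nlinarith
      have e4 : 0 ≤ (d / (1 + d)) ^ (4 * H - 2) := by positivity
      nlinarith
    · have e1 : x ^ 2 ≤ d ^ (4 * H - 4) := by
        rw [← sq_abs, show 4 * H - 4 = (2 * H - 2) * 2 by ring, Real.rpow_mul hd.le, rpow_two]
        gcongr
      have e2 : d ^ (4 * H - 4) ≤ d ^ (-2 : ℝ) :=
        Real.rpow_le_rpow_of_exponent_le h (by linarith)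
      have e3 : 1 ≤ (d / (1 + d)) ^ (4 * H - 2) :=
        Real.one_le_rpow_of_pos_of_le_one_of_nonpos hdq hq1 (by linarith)
      have e4 : d ^ (-2 : ℝ) ≤ 4 * (1 / (1 + d) ^ 2) := by
        rw [Real.rpow_neg hd.le, rpow_two, mul_one_div, inv_eq_one_div,
          div_le_div_iff₀ (by positivity) (by positivity)]
        nlinarith
      have e5 : 0 < 1 / (1 + d) ^ 2 := by positivity
      nlinarith

lemma continuous_lagPotential_on {H : ℝ} (hH : 1 / 4 < H) :
    ContinuousOn (lagPotential H) (Ici 0) := by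
  refine continuousOn_const.mul (ContinuousOn.rpow_const ?_ fun v _ ↦ Or.inr (by linarith))
  refine ContinuousOn.div (by fun_prop) (by fun_prop) fun v hv ↦ ?_
  have : (0 : ℝ) ≤ v := hv
  positivity

/-- The energy estimate for the equation `f' = -f + g`, which gives `(f ²)' ≤ -f ² + g ²`;
here `Γ` is a potential for a majorant of `g ²`. -/
lemma integral_sq_le_of_hasDerivAt {f g Γ : ℝ → ℝ} {u T : ℝ} (hT : u ≤ T) (hf : Continuous f)
    (hode : ∀ v, u < v → HasDerivAt f (g v - f v) v) (hΓ : ContinuousOn Γ (Icc u T))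
    (hΓ' : ∀ v, u < v → ∃ D, HasDerivAt Γ D v ∧ g v ^ 2 ≤ D) :
    ∫ v in u..T, f v ^ 2 ≤ f u ^ 2 + (Γ T - Γ u) := by
  have hci (v : ℝ) : HasDerivAt (fun v ↦ ∫ x in u..v, f x ^ 2) (f v ^ 2) v :=
    ((hf.pow 2).integral_hasStrictDerivAt u v).hasDerivAt
  have hder (v : ℝ) (hv : u < v) : ∃ D : ℝ, D ≤ 0 ∧ HasDerivAt
      (fun v ↦ f v ^ 2 + (∫ x in u..v, f x ^ 2) - Γ v) D v := by
    obtain ⟨D, hD, hg⟩ := hΓ' v hv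
    refine ⟨_, ?_, (((hode v hv).fun_pow 2).add (hci v)).sub hD⟩
    simp only [Nat.cast_ofNat, Nat.add_one_sub_one, pow_one]
    nlinarith [sq_nonneg (f v - g v)]
  have hanti : AntitoneOn
      (fun v ↦ f v ^ 2 + (∫ x in u..v, f x ^ 2) - Γ v) (Icc u T) := by
    refine antitoneOn_of_deriv_nonpos (convex_Icc _ _) ?_ ?_ ?_
    · refine ContinuousOn.sub (Continuous.continuousOn ?_) hΓ
      exact (hf.pow 2).add (continuous_iff_continuousAt.2 fun v ↦ (hci v).continuousAt)
    · intro v hv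
      rw [interior_Icc] at hv
      obtain ⟨D, -, hD⟩ := hder v hv.1
      exact hD.differentiableAt.differentiableWithinAt
    · intro v hv
      rw [interior_Icc] at hv
      obtain ⟨D, hD0, hD⟩ := hder v hv.1
      rwa [hD.deriv]
  have hfin := hanti (left_mem_Icc.2 hT) (right_mem_Icc.2 hT) hT
  simp only [intervalIntegral.integral_same] at hfin
  linarith [sq_nonneg (f T)]

lemma integral_sq_ouCov_le {H u T : ℝ} (hH : H ∈ Ioc (1 / 4 : ℝ) (1 / 2)) (hu : 0 ≤ u)
    (hT : u ≤ T) :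
    ∫ v in u..T, ouCov H u v ^ 2 ≤ ouCov H u u ^ 2 + 4 / (4 * H - 1) := by
  have hH0 : 0 < H := by linarith [hH.1]
  have h := integral_sq_le_of_hasDerivAt (f := ouCov H u)
    (Γ := fun v ↦ lagPotential H (v - u)) hT (continuous_ouCov_right hH0 u)
    (fun v hv ↦ hasDerivAt_ouMap (continuous_mixedCov_right hH0 u) (hasDerivAt_mixedCov hH0 hu hv))
    ((continuous_lagPotential_on hH.1).comp (by fun_prop) fun v hv ↦ sub_nonneg.2 hv.1)
    (fun v hv ↦ by
      obtain ⟨D, hD, hDle⟩ := exists_hasDerivAt_lagPotential hH (sub_pos.2 hv)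
      obtain ⟨g1, g2⟩ := abs_deriv_mixedCov_le hH hu hv
      exact ⟨D, hD.comp_sub_const v u, hDle _ g1 g2⟩)
  have hb := (lagPotential_mem_Icc hH.1 (sub_nonneg.2 hT)).2
  have hb0 := (lagPotential_mem_Icc hH.1 (sub_nonneg.2 (le_refl u))).1
  linarith

end FracOU

/-! ### The variance, and the double integral of the squared covariance -/

namespace FracOU
open Real Set

/-- The variance of the normalised process, in closed form. -/
lemma ouCov_self {H u : ℝ} (hH : 0 < H) :
    ouCov H u u = exp (-u) * |u| ^ (2 * H)
      + (lowerGamma (2 * H) u - exp (-(2 * u)) * growingGamma (2 * H) u) / 2 := by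
  have hα : 0 ≤ 2 * H := by positivity
  set A := ouMap (fun s ↦ |s| ^ (2 * H)) u with hA
  have hA' : A = |u| ^ (2 * H) - exp (-u) * growingGamma (2 * H) u := by
    rw [hA, ouMap, integral_exp_neg_sub_mul, growingGamma]
  have e2 (v : ℝ) : HasDerivAt (fun v ↦ exp (-(2 * (u - v)))) (2 * exp (-(2 * (u - v)))) v := by
    have h := ((((hasDerivAt_id v).const_sub u).const_mul 2).fun_neg).exp
    refine h.congr_deriv ?_
    simp; ring
  have e1 (v : ℝ) : HasDerivAt (fun v ↦ exp (-(u - v))) (exp (-(u - v))) v := by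
    have h := ((hasDerivAt_id v).const_sub u).fun_neg.exp
    refine h.congr_deriv ?_
    simp
  have key : ∫ v in (0 : ℝ)..u, exp (-(u - v)) * mixedCov H u v =
      (A * (1 - exp (-u)) + exp (-(2 * u)) * growingGamma (2 * H) u - lowerGamma (2 * H) u
        + (lowerGamma (2 * H) u - exp (-(2 * u)) * growingGamma (2 * H) u)) / 2 := by
    -- Each of the terms of `mixedCov_eq` has an explicit primitive in `v`.
    rw [intervalIntegral.integral_eq_sub_of_hasDerivAt
      (f := fun v ↦ (exp (-(u - v)) * A + exp (-(2 * u)) * growingGamma (2 * H) v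
        + lowerGamma (2 * H) (u - v)
        + (exp (-(2 * (u - v))) * lowerGamma (2 * H) v
            - exp (-(2 * u)) * growingGamma (2 * H) v) / 2
        + (exp (-(2 * (u - v))) * growingGamma (2 * H) (u - v)
            - lowerGamma (2 * H) (u - v)) / 2) / 2)]
    · simp only [sub_self, mul_zero, neg_zero, exp_zero, sub_zero, lowerGamma_zero,
        growingGamma_zero]
      ring
    · intro v _
      have g1 := hasDerivAt_growingGamma hα v
      have l1 := hasDerivAt_lowerGamma hα v
      have g2 := (hasDerivAt_growingGamma hα (u - v)).comp v ((hasDerivAt_id v).const_sub u)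
      have l2 := (hasDerivAt_lowerGamma hα (u - v)).comp v ((hasDerivAt_id v).const_sub u)
      have h := (((((e1 v).mul_const A).add (g1.const_mul (exp (-(2 * u))))).add l2).add
        ((((e2 v).mul l1).sub (g1.const_mul (exp (-(2 * u))))).div_const 2)).add
        ((((e2 v).mul g2).sub l2).div_const 2)
      have h' := h.div_const 2
      refine h'.congr_deriv ?_
      rw [mixedCov_eq hH, ← hA, show v - u = -(u - v) by ring, lowerGamma_neg, abs_neg]
      have x1 : exp (-(2 * (u - v))) = exp (-(u - v)) * exp (-(u - v)) := by
        rw [← exp_add]; ring_nf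
      have x2 : exp (-(u - v)) = exp (-u) * exp v := by rw [← exp_add]; ring_nf
      have x3 : exp (-(2 * u)) = exp (-u) * exp (-u) := by rw [← exp_add]; ring_nf
      have x4 : exp v * exp (-v) = 1 := by rw [← exp_add]; simp
      have x5 : exp (-(u - v)) * exp (u - v) = 1 := by rw [← exp_add]; simp
      simp only [Function.comp]
      rw [x1, x3]
      generalize exp (u - v) = a at *
      rw [x2] at x5 ⊢
      linear_combination (exp (-u) * exp (-u) * exp v * |v| ^ (2 * H) / 4) * x4
        - (exp (-u) * exp v * |u - v| ^ (2 * H) / 4) * x5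
    · exact Continuous.intervalIntegrable
        (by have := continuous_mixedCov_right hH u; fun_prop) _ _
  rw [ouCov, ouMap, key, mixedCov_eq hH, ← hA, sub_self, abs_zero, zero_rpow (by positivity),
    lowerGamma_zero, exp_zero, hA']
  have : exp (-u) * exp (-u) = exp (-(2 * u)) := by rw [← exp_add]; ring_nf
  linear_combination (-growingGamma (2 * H) u / 2) * this

lemma integral_exp_mul_rpow_by_parts {a : ℝ} (ha : 0 < a) (k : ℝ) {u : ℝ} (hu : 0 ≤ u) :
    a * ∫ z in (0 : ℝ)..u, exp (k * z) * |z| ^ (a - 1)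
      = exp (k * u) * |u| ^ a - k * ∫ z in (0 : ℝ)..u, exp (k * z) * |z| ^ a := by
  have hc : Continuous fun z : ℝ ↦ exp (k * z) * |z| ^ a := by
    have := continuous_abs_rpow ha.le; fun_prop
  have hi : IntervalIntegrable (fun z : ℝ ↦ exp (k * z) * |z| ^ (a - 1)) volume 0 u := by
    refine IntervalIntegrable.continuousOn_mul ?_ (by fun_prop)
    refine (intervalIntegral.intervalIntegrable_rpow' (r := a - 1) (by linarith)).congr_ae ?_
    refine (ae_restrict_iff' measurableSet_uIoc).2 (ae_of_all _ fun z hz ↦ ?_)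
    rw [uIoc_of_le hu] at hz
    simp only [abs_of_pos hz.1]
  have h := intervalIntegral.integral_eq_sub_of_hasDerivAt_of_le hu
    (f := fun z : ℝ ↦ exp (k * z) * |z| ^ a)
    (f' := fun z ↦ k * (exp (k * z) * |z| ^ a) + a * (exp (k * z) * |z| ^ (a - 1)))
    hc.continuousOn ?_ (((hc.intervalIntegrable _ _).const_mul k).add (hi.const_mul a))
  · rw [intervalIntegral.integral_add ((hc.intervalIntegrable _ _).const_mul k) (hi.const_mul a),
      intervalIntegral.integral_const_mul, intervalIntegral.integral_const_mul] at h
    simp only [abs_zero, zero_rpow ha.ne', mul_zero, sub_zero] at h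
    linarith
  · intro z hz
    have h1 : HasDerivAt (fun y : ℝ ↦ |y| ^ a) (a * z ^ (a - 1)) z := by
      refine (Real.hasDerivAt_rpow_const (p := a) (Or.inl hz.1.ne')).congr_of_eventuallyEq ?_
      filter_upwards [eventually_gt_nhds hz.1] with y hy
      rw [abs_of_pos hy]
    refine (((hasDerivAt_id z).const_mul k).exp.mul h1).congr_deriv ?_
    simp only [id, abs_of_pos hz.1]
    ring

/-- The variance of the normalised process in integral form. -/
lemma ouCov_self_eq_integral {H u : ℝ} (hH : 0 < H) (hu : 0 ≤ u) :
    ouCov H u u = H * ((∫ z in (0 : ℝ)..u, exp (-z) * |z| ^ (2 * H - 1))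
      + exp (-u) * ∫ z in (0 : ℝ)..u, exp (-(u - z)) * |z| ^ (2 * H - 1)) := by
  have h1 := integral_exp_mul_rpow_by_parts (a := 2 * H) (by positivity) (-1) hu
  have h2 := integral_exp_mul_rpow_by_parts (a := 2 * H) (by positivity) 1 hu
  simp only [neg_mul, one_mul] at h1 h2
  rw [ouCov_self hH, integral_exp_neg_sub_mul, lowerGamma, growingGamma]
  have e1 : exp (-u) * exp (-u) = exp (-(2 * u)) := by rw [← exp_add]; ring_nf
  have e2 : exp (-(2 * u)) * exp u = exp (-u) := by rw [← exp_add]; ring_nf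
  rw [← mul_assoc, e1]
  linear_combination (-1 / 2) * h1 - exp (-(2 * u)) / 2 * h2 - |u| ^ (2 * H) / 2 * e2

lemma rpow_le_one_add_pow {x a : ℝ} (hx : 0 ≤ x) {n : ℕ} (ha0 : 0 ≤ a) (ha : a ≤ n) :
    x ^ a ≤ 1 + x ^ n := by
  rcases le_total x 1 with h | h
  · have := Real.rpow_le_one hx h ha0
    have : 0 ≤ x ^ n := by positivity
    linarith
  · have := Real.rpow_le_rpow_of_exponent_le h ha
    rw [rpow_natCast] at this
    linarith

/-- Exponential convergence of the variance of the normalised process. -/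
lemma exists_abs_ouCov_self_sub_le {H : ℝ} (hH : H ∈ Ioo (0 : ℝ) 1) :
    ∃ C, 0 < C ∧ ∀ u, 0 ≤ u →
      |ouCov H u u - Gamma (2 * H + 1) / 2| ≤ C * exp (-(u / 2)) := by
  obtain ⟨h0, h1⟩ := hH
  have hG := Real.GammaIntegral_convergent (s := 2 * H + 1) (by positivity)
  have hhalf : IntegrableOn (fun x : ℝ ↦ exp (-(1 / 2) * x) * x ^ (2 * H)) (Ioi 0) := by
    have := integrableOn_rpow_mul_exp_neg_mul_rpow (s := 2 * H) (p := 1) (b := 1 / 2)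
      (by linarith) one_pos (by norm_num)
    refine this.congr_fun (fun x hx ↦ ?_) measurableSet_Ioi
    simp [mul_comm]
  set c := ∫ x in Ioi (0 : ℝ), exp (-(1 / 2) * x) * x ^ (2 * H) with hc
  have hc0 : 0 ≤ c := setIntegral_nonneg measurableSet_Ioi fun x hx ↦ by
    have : (0 : ℝ) < x := hx
    positivity
  refine ⟨c + 100, by positivity, fun u hu ↦ ?_⟩
  have ex : exp (-u) = exp (-(u / 2)) * exp (-(u / 2)) := by rw [← exp_add]; ring_nf
  have einv : exp (-(u / 2)) * exp (u / 2) = 1 := by rw [← exp_add]; simp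
  have hep := exp_pos (-(u / 2))
  -- The tail of the Gamma integral, with half of its exponential factor split off.
  have hF : |lowerGamma (2 * H) u - Gamma (2 * H + 1)| ≤ c * exp (-(u / 2)) := by
    have e1 : lowerGamma (2 * H) u = ∫ x in Ioc 0 u, exp (-x) * x ^ (2 * H + 1 - 1) := by
      rw [lowerGamma, intervalIntegral.integral_of_le hu]
      refine setIntegral_congr_fun measurableSet_Ioc fun x hx ↦ ?_
      simp only [abs_of_pos hx.1, add_sub_cancel_right]
    have e2 : Gamma (2 * H + 1) = lowerGamma (2 * H) u
        + ∫ x in Ioi u, exp (-x) * x ^ (2 * H + 1 - 1) := by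
      rw [Real.Gamma_eq_integral (by positivity), e1, ← Ioc_union_Ioi_eq_Ioi hu,
        setIntegral_union (Ioc_disjoint_Ioi le_rfl) measurableSet_Ioi
          (hG.mono_set Ioc_subset_Ioi_self) (hG.mono_set (Ioi_subset_Ioi hu))]
    have e3 : 0 ≤ ∫ x in Ioi u, exp (-x) * x ^ (2 * H + 1 - 1) :=
      setIntegral_nonneg measurableSet_Ioi fun x hx ↦ by
        have : 0 < x := hu.trans_lt hx
        positivity
    rw [e2, sub_add_cancel_left, abs_neg, abs_of_nonneg e3, mul_comm c, hc, ← integral_const_mul]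
    calc _ ≤ ∫ x in Ioi u, exp (-(u / 2)) * (exp (-(1 / 2) * x) * x ^ (2 * H)) := by
          refine setIntegral_mono_on (hG.mono_set (Ioi_subset_Ioi hu))
            ((hhalf.mono_set (Ioi_subset_Ioi hu)).const_mul _) measurableSet_Ioi fun x hx ↦ ?_
          have hx' : u < x := hx
          rw [← mul_assoc, ← exp_add, add_sub_cancel_right]
          gcongr
          · exact Real.rpow_nonneg (hu.trans hx'.le) _
          · linarith
      _ ≤ _ := by
          refine setIntegral_mono_set (hhalf.const_mul _) ?_
            (Ioi_subset_Ioi hu).eventuallyLE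
          refine (ae_restrict_iff' measurableSet_Ioi).2 (ae_of_all _ fun x hx ↦ ?_)
          have : (0 : ℝ) < x := hx
          simp only [Pi.zero_apply]
          positivity
  -- Polynomials are absorbed by `e^{u/2}`, through the Taylor terms of degree two and three.
  have hu2 : u ^ (2 * H) ≤ 9 * exp (u / 2) := by
    have a1 := rpow_le_one_add_pow hu (n := 2) (a := 2 * H) (by positivity) (by norm_num; linarith)
    have a2 := Real.pow_div_factorial_le_exp (x := u / 2) (by positivity) 2
    have a3 := Real.one_le_exp (x := u / 2) (by positivity)
    norm_num [Nat.factorial] at a2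
    nlinarith
  have hu3 : u ^ (2 * H) * u ≤ 49 * exp (u / 2) := by
    have a1 := rpow_le_one_add_pow hu (n := 3) (a := 2 * H + 1) (by positivity)
      (by norm_num; linarith)
    have a2 := Real.pow_div_factorial_le_exp (x := u / 2) (by positivity) 3
    have a3 := Real.one_le_exp (x := u / 2) (by positivity)
    norm_num [Nat.factorial] at a2
    rw [Real.rpow_add_one' hu (by positivity)] at a1
    nlinarith
  have hG0 : 0 ≤ growingGamma (2 * H) u :=
    intervalIntegral.integral_nonneg hu fun x _ ↦ by positivity
  have hG1 : growingGamma (2 * H) u ≤ exp u * u ^ (2 * H) * u := by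
    have : growingGamma (2 * H) u ≤ ∫ x in (0 : ℝ)..u, exp u * u ^ (2 * H) := by
      refine intervalIntegral.integral_mono_on hu ?_ (by simp) fun x hx ↦ ?_
      · have := continuous_abs_rpow (a := 2 * H) (by positivity)
        exact Continuous.intervalIntegrable (by fun_prop) _ _
      · rw [abs_of_nonneg hx.1]
        have := hx.1
        have := hx.2
        gcongr
    rw [intervalIntegral.integral_const, smul_eq_mul, sub_zero] at this
    linarith
  have b1 : exp (-u) * |u| ^ (2 * H) ≤ 9 * exp (-(u / 2)) := by
    rw [abs_of_nonneg hu, ex]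
    calc _ ≤ exp (-(u / 2)) * exp (-(u / 2)) * (9 * exp (u / 2)) := by gcongr
      _ = _ := by linear_combination 9 * exp (-(u / 2)) * einv
  have b2 : exp (-(2 * u)) * growingGamma (2 * H) u ≤ 49 * exp (-(u / 2)) := by
    have e4 : exp (-(2 * u)) * exp u = exp (-u) := by rw [← exp_add]; ring_nf
    calc _ ≤ exp (-(2 * u)) * (exp u * u ^ (2 * H) * u) := by gcongr
      _ = exp (-(u / 2)) * exp (-(u / 2)) * (u ^ (2 * H) * u) := by
          rw [← ex, ← e4]; ring
      _ ≤ exp (-(u / 2)) * exp (-(u / 2)) * (49 * exp (u / 2)) := by gcongr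
      _ = _ := by linear_combination 49 * exp (-(u / 2)) * einv
  have b0 : 0 ≤ exp (-u) * |u| ^ (2 * H) := by positivity
  have b3 : 0 ≤ exp (-(2 * u)) * growingGamma (2 * H) u := by positivity
  rw [ouCov_self h0]
  rw [abs_le] at hF ⊢
  constructor <;> nlinarith [hF.1, hF.2, mul_nonneg hc0 hep.le]

lemma exists_ouCov_self_le {H : ℝ} (hH : H ∈ Ioo (0 : ℝ) 1) :
    ∃ M, 0 < M ∧ ∀ u, 0 ≤ u → ouCov H u u ≤ M := by
  obtain ⟨C, hC, h⟩ := exists_abs_ouCov_self_sub_le hH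
  have hG : 0 < Gamma (2 * H + 1) := Real.Gamma_pos_of_pos (by linarith [hH.1])
  refine ⟨C + Gamma (2 * H + 1) / 2, by positivity, fun u hu ↦ ?_⟩
  have h1 := (abs_le.1 (h u hu)).2
  have h2 : exp (-(u / 2)) ≤ 1 := Real.exp_le_one_iff.2 (by linarith)
  nlinarith

/-- The integral of a symmetric function over a square is twice that over a triangle. -/
lemma integral_square_eq_two_mul_triangle {F : ℝ → ℝ → ℝ} (hF : Continuous (Function.uncurry F))
    {T : ℝ} (hT : 0 ≤ T) (hs : ∀ u v, 0 ≤ u → 0 ≤ v → F u v = F v u) :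
    ∫ u in (0 : ℝ)..T, ∫ v in (0 : ℝ)..T, F u v
      = 2 * ∫ u in (0 : ℝ)..T, ∫ v in u..T, F u v := by
  have hc (u : ℝ) : Continuous (F u) := hF.comp (Continuous.prodMk_right u)
  have hcl : Continuous fun u ↦ ∫ v in (0 : ℝ)..u, F u v :=
    intervalIntegral.continuous_parametric_intervalIntegral_of_continuous hF continuous_id
  have hcs : Continuous fun u ↦ ∫ v in (0 : ℝ)..T, F u v :=
    intervalIntegral.continuous_parametric_intervalIntegral_of_continuous hF continuous_const
  have hsplit (u : ℝ) : ∫ v in u..T, F u v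
      = (∫ v in (0 : ℝ)..T, F u v) - ∫ v in (0 : ℝ)..u, F u v :=
    (intervalIntegral.integral_interval_sub_left ((hc u).intervalIntegrable _ _)
      ((hc u).intervalIntegrable _ _)).symm
  have hlow : ∫ u in (0 : ℝ)..T, ∫ v in (0 : ℝ)..u, F u v
      = ∫ u in (0 : ℝ)..T, ∫ v in u..T, F u v := by
    calc ∫ u in (0 : ℝ)..T, ∫ v in (0 : ℝ)..u, F u v
        = ∫ u in (0 : ℝ)..T, ∫ v in (0 : ℝ)..T, {v | v ≤ u}.indicator (F u) v := by
          refine intervalIntegral.integral_congr fun u hu ↦ ?_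
          rw [uIcc_of_le hT] at hu
          exact (intervalIntegral.integral_indicator hu).symm
      _ = ∫ v in (0 : ℝ)..T, ∫ u in (0 : ℝ)..T, {v | v ≤ u}.indicator (F u) v := by
          refine intervalIntegral_intervalIntegral_swap ?_
          have hi : Integrable (Function.uncurry F)
              ((volume.restrict (uIoc 0 T)).prod (volume.restrict (uIoc 0 T))) := by
            rw [Measure.prod_restrict, ← Measure.volume_eq_prod]
            refine (hF.continuousOn.integrableOn_compact (isCompact_uIcc.prod isCompact_uIcc)
              ).mono_set (prod_mono uIoc_subset_uIcc uIoc_subset_uIcc)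
          have hm : MeasurableSet {p : ℝ × ℝ | p.2 ≤ p.1} :=
            measurableSet_le measurable_snd measurable_fst
          have hi' := hi.indicator hm
          rw [Measure.prod_restrict, ← Measure.volume_eq_prod] at hi'
          exact hi'
      _ = ∫ v in (0 : ℝ)..T, ∫ u in v..T, F v u := by
          refine intervalIntegral.integral_congr_ae (ae_of_all _ fun v hv ↦ ?_)
          rw [uIoc_of_le hT] at hv
          have e : (fun u ↦ {v | v ≤ u}.indicator (F u) v)
              = (Ici v).indicator fun u ↦ F u v := by
            ext u; simp [indicator]
          rw [e, intervalIntegral.integral_of_le hT, setIntegral_indicator measurableSet_Ici,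
            intervalIntegral.integral_of_le hv.2, ← integral_Icc_eq_integral_Ioc]
          have e2 : Ioc 0 T ∩ Ici v = Icc v T := by
            ext x; simp only [mem_inter_iff, mem_Ioc, mem_Ici, mem_Icc]
            have := hv.1
            constructor
            · rintro ⟨⟨_, h2⟩, h3⟩; exact ⟨h3, h2⟩
            · rintro ⟨h1, h2⟩; exact ⟨⟨by linarith, h2⟩, h1⟩
          rw [e2]
          exact setIntegral_congr_fun measurableSet_Icc fun u hu ↦
            hs u v (hv.1.le.trans hu.1) hv.1.le
  have hd := intervalIntegral.integral_sub (μ := volume) (hcs.intervalIntegrable 0 T)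
    (hcl.intervalIntegrable 0 T)
  simp only [← hsplit] at hd
  linarith

/-- The double integral of the squared covariance grows at most linearly. -/
lemma integral_integral_sq_ouCov_le {H M T : ℝ} (hH : H ∈ Ioc (1 / 4 : ℝ) (1 / 2)) (hT : 0 ≤ T)
    (hs : ∀ u v, 0 ≤ u → 0 ≤ v → ouCov H u v = ouCov H v u)
    (hM : ∀ u, 0 ≤ u → ouCov H u u ^ 2 ≤ M) :
    ∫ u in (0 : ℝ)..T, ∫ v in (0 : ℝ)..T, ouCov H u v ^ 2
      ≤ 2 * (M + 4 / (4 * H - 1)) * T := by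
  have hF : Continuous (Function.uncurry fun u v ↦ ouCov H u v ^ 2) :=
    (continuous_ouCov (by linarith [hH.1])).pow 2
  rw [integral_square_eq_two_mul_triangle hF hT fun u v hu hv ↦ by rw [hs u v hu hv]]
  have hcont : Continuous fun u ↦ ∫ v in u..T, ouCov H u v ^ 2 := by
    simp_rw [intervalIntegral.integral_symm T]
    exact (intervalIntegral.continuous_parametric_intervalIntegral_of_continuous hF
      continuous_id).neg
  have : ∫ u in (0 : ℝ)..T, ∫ v in u..T, ouCov H u v ^ 2
      ≤ ∫ _u in (0 : ℝ)..T, (M + 4 / (4 * H - 1)) := by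
    refine intervalIntegral.integral_mono_on hT (hcont.intervalIntegrable _ _) (by simp)
      fun u hu ↦ ?_
    exact (integral_sq_ouCov_le hH hu.1 hu.2).trans (by linarith [hM u hu.1])
  rw [intervalIntegral.integral_const, smul_eq_mul, sub_zero] at this
  linarith

end FracOU

/-! ### Moments of the dyadic increments of fractional Brownian motion -/

namespace FracOU
open Real Set Filter Topology

variable {Ω : Type*}

/-- The dyadic increment of level `n` that starts at `j / 2ⁿ`. -/
noncomputable def dyadicIncr (b : ℝ → Ω → ℝ) (n j : ℕ) (ω : Ω) : ℝ :=
  b ((j + 1 : ℕ) / 2 ^ n) ω - b (j / 2 ^ n) ω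

/-- The average, over the dyadic intervals of level `n` in `[0, N]`, of the exponential of a
quarter of the squared normalised increments. -/
noncomputable def avgExpIncr (H : ℝ) (b : ℝ → Ω → ℝ) (N n : ℕ) (ω : Ω) : ℝ :=
  ∑ j ∈ Finset.range (N * 2 ^ n),
    exp (dyadicIncr b n j ω ^ 2 / (4 * ((2 : ℝ) ^ (-H)) ^ (2 * n))) / (N * 2 ^ n : ℕ)

/-- A bound for the squares of all increments of level `n` in `[0, N]`, divided by `2 ^ (-nH)`. -/
noncomputable def levelBound (H : ℝ) (b : ℝ → Ω → ℝ) (N n : ℕ) (ω : Ω) : ℝ :=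
  4 * ((2 : ℝ) ^ (-H)) ^ n * (log (N * 2 ^ n : ℕ) + avgExpIncr H b N n ω)

/-- The chaining envelope: up to a constant it bounds the squared increments of `b` in each unit
interval of `[0, N]`. -/
noncomputable def chainEnvelope (H : ℝ) (b : ℝ → Ω → ℝ) (N : ℕ) (ω : Ω) : ℝ≥0∞ :=
  ∑' n, ENNReal.ofReal (levelBound H b N n ω)

lemma avgExpIncr_nonneg (H : ℝ) (b : ℝ → Ω → ℝ) (N n : ℕ) (ω : Ω) :
    0 ≤ avgExpIncr H b N n ω := Finset.sum_nonneg fun _ _ ↦ by positivity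

lemma levelBound_nonneg (H : ℝ) (b : ℝ → Ω → ℝ) (N n : ℕ) (ω : Ω) :
    0 ≤ levelBound H b N n ω := by
  have := avgExpIncr_nonneg H b N n ω
  have := Real.log_natCast_nonneg (N * 2 ^ n)
  unfold levelBound; positivity

/-- Each increment of a level is bounded by the average over the level: this is the inequality
`x ≤ log M + e^x / M`. -/
lemma dyadicIncr_sq_le (H : ℝ) (b : ℝ → Ω → ℝ) {N n j : ℕ} (hj : j < N * 2 ^ n) (ω : Ω) :
    dyadicIncr b n j ω ^ 2 ≤ ((2 : ℝ) ^ (-H)) ^ n * levelBound H b N n ω := by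
  set M := N * 2 ^ n with hM
  have hM0 : (0 : ℝ) < M := by exact_mod_cast (Nat.zero_le j).trans_lt hj
  set s := ((2 : ℝ) ^ (-H)) ^ n with hs
  have hs0 : 0 < s := by positivity
  have hs2 : ((2 : ℝ) ^ (-H)) ^ (2 * n) = s ^ 2 := by rw [hs, ← pow_mul, mul_comm]
  set x := dyadicIncr b n j ω ^ 2 / (4 * s ^ 2) with hx
  have h1 : exp x / M ≤ avgExpIncr H b N n ω := by
    rw [avgExpIncr, hs2, hx]
    exact Finset.single_le_sum (f := fun j ↦ exp (dyadicIncr b n j ω ^ 2 / (4 * s ^ 2)) / (M : ℝ))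
      (fun _ _ ↦ by positivity) (Finset.mem_range.2 hj)
  have h2 : x - log M ≤ exp x / M := by
    have := Real.add_one_le_exp (x - log M)
    rw [exp_sub, exp_log hM0] at this
    linarith
  have h3 : dyadicIncr b n j ω ^ 2 = 4 * s ^ 2 * x := by rw [hx]; field_simp
  rw [h3, levelBound, ← hs, ← hM]
  have : x ≤ log M + avgExpIncr H b N n ω := by linarith
  calc 4 * s ^ 2 * x ≤ 4 * s ^ 2 * (log M + avgExpIncr H b N n ω) := by gcongr
    _ = _ := by ring

lemma two_rpow_neg_mem_Ioo {H : ℝ} (hH : 0 < H) : (2 : ℝ) ^ (-H) ∈ Ioo (0 : ℝ) 1 :=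
  ⟨by positivity, Real.rpow_lt_one_of_one_lt_of_neg one_lt_two (by linarith)⟩

variable [MeasurableSpace Ω] {P : Measure Ω}

/-- A fractional Brownian motion that is regular everywhere rather than almost surely: all
coordinates are measurable, and all paths are continuous and start at zero. Times are real so that
paths can be integrated and differentiated; the covariance is prescribed at nonnegative times
only. -/
structure IsRegularFBM (H : ℝ) (b : ℝ → Ω → ℝ) (P : Measure Ω) : Prop where
  gaussian : IsGaussianProcess b P
  centered : ∀ t, P[b t] = 0
  cov : ∀ s t, 0 ≤ s → 0 ≤ t → ∫ ω, b s ω * b t ω ∂P = fbmCov H s t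
  measurable : ∀ t, Measurable (b t)
  continuous : ∀ ω, Continuous fun t ↦ b t ω
  zero : ∀ ω, b 0 ω = 0

lemma integrable_exp_sq_gaussianReal {v : ℝ≥0} (hv : v ≠ 0) :
    Integrable (fun x ↦ exp (x ^ 2 / (4 * v))) (gaussianReal 0 v) ∧
      ∫ x, exp (x ^ 2 / (4 * v)) ∂gaussianReal 0 v = √2 := by
  have hv' : (0 : ℝ) < v := by positivity
  have e : (fun x ↦ gaussianPDFReal 0 v x • exp (x ^ 2 / (4 * v)))
      = fun x ↦ (√(2 * π * v))⁻¹ * exp (-(1 / (4 * v)) * x ^ 2) := by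
    ext x
    rw [gaussianPDFReal, smul_eq_mul, mul_assoc, ← exp_add]
    congr 2
    field_simp; ring
  constructor
  · rw [gaussianReal_of_var_ne_zero _ hv, integrable_withDensity_iff_integrable_smul₀'
      (measurable_gaussianPDF 0 v).aemeasurable (ae_of_all _ fun _ ↦ gaussianPDF_lt_top)]
    simp only [toReal_gaussianPDF]
    rw [e]
    exact (integrable_exp_neg_mul_sq (by positivity)).const_mul _
  · rw [integral_gaussianReal_eq_integral_smul hv, e, integral_const_mul, integral_gaussian,
      ← Real.sqrt_inv, ← Real.sqrt_mul (by positivity)]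
    congr 1
    field_simp; norm_num

lemma HasGaussianLaw.integrable_exp_sq {X : Ω → ℝ} (hX : HasGaussianLaw X P) (h0 : P[X] = 0)
    {v : ℝ} (hv : 0 < v) (hvar : ∫ ω, X ω ^ 2 ∂P = v) :
    Integrable (fun ω ↦ exp (X ω ^ 2 / (4 * v))) P ∧ ∫ ω, exp (X ω ^ 2 / (4 * v)) ∂P = √2 := by
  have hm := hX.map_eq_gaussianReal
  rw [h0, variance_of_integral_eq_zero hX.aemeasurable h0, hvar] at hm
  have hv' : v.toNNReal ≠ 0 := by simpa using hv
  have h := integrable_exp_sq_gaussianReal hv'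
  rw [Real.coe_toNNReal _ hv.le, ← hm] at h
  refine ⟨(integrable_map_measure (by fun_prop) hX.aemeasurable).1 h.1, ?_⟩
  rw [← h.2, integral_map hX.aemeasurable (by fun_prop)]

namespace IsRegularFBM

variable {H : ℝ} {b : ℝ → Ω → ℝ}

lemma memLp_two (hb : IsRegularFBM H b P) (t : ℝ) : MemLp (b t) 2 P :=
  (hb.gaussian.hasGaussianLaw_eval t).memLp_two

lemma integral_sq_sub (hb : IsRegularFBM H b P) {s t : ℝ} (hs : 0 ≤ s) (ht : 0 ≤ t)
    (hH : 0 < H) : ∫ ω, (b t ω - b s ω) ^ 2 ∂P = |t - s| ^ (2 * H) := by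
  have h1 : Integrable (fun ω ↦ b t ω * b t ω) P := (hb.memLp_two t).integrable_mul (hb.memLp_two t)
  have h2 : Integrable (fun ω ↦ b s ω * b t ω) P := (hb.memLp_two s).integrable_mul (hb.memLp_two t)
  have h3 : Integrable (fun ω ↦ b s ω * b s ω) P := (hb.memLp_two s).integrable_mul (hb.memLp_two s)
  have e : ∀ ω, (b t ω - b s ω) ^ 2
      = b t ω * b t ω - 2 * (b s ω * b t ω) + b s ω * b s ω := fun ω ↦ by ring
  simp_rw [e]
  rw [integral_add (by exact h1.sub (h2.const_mul 2)) h3, integral_sub h1 (h2.const_mul 2),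
    integral_const_mul]
  simp only [hb.cov _ _ hs ht, hb.cov _ _ hs hs, hb.cov _ _ ht ht, fbmCov, sub_self,
    abs_zero, zero_rpow (show 2 * H ≠ 0 by positivity)]
  ring

lemma integrable_levelBound (hb : IsRegularFBM H b P) (hH : 0 < H) {N : ℕ} (hN : 0 < N) (n : ℕ) :
    Integrable (levelBound H b N n) P ∧ ∫ ω, levelBound H b N n ω ∂P
      = 4 * ((2 : ℝ) ^ (-H)) ^ n * (log (N * 2 ^ n : ℕ) + √2) := by
  have := hb.gaussian.isProbabilityMeasure
  have hterm (j : ℕ) := HasGaussianLaw.integrable_exp_sq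
    (X := dyadicIncr b n j) (v := ((2 : ℝ) ^ (-H)) ^ (2 * n))
    (hb.gaussian.hasGaussianLaw_fun_sub (s := ((j + 1 : ℕ) / 2 ^ n : ℝ)) (t := (j / 2 ^ n : ℝ)))
    (by
      simp only [dyadicIncr]
      rw [integral_sub ((hb.memLp_two _).integrable (by norm_num))
        ((hb.memLp_two _).integrable (by norm_num)), hb.centered, hb.centered, sub_self])
    (by positivity)
    (by
      simp only [dyadicIncr]
      rw [hb.integral_sq_sub (by positivity) (by positivity) hH, ← sub_div]
      push_cast
      rw [add_sub_cancel_left, abs_of_pos (by positivity), one_div, Real.inv_rpow (by positivity),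
        ← Real.rpow_natCast, ← Real.rpow_mul (by norm_num), ← Real.rpow_neg (by norm_num),
        ← Real.rpow_natCast, ← Real.rpow_mul (by norm_num)]
      congr 1; push_cast; ring)
  have hM : ((N * 2 ^ n : ℕ) : ℝ) ≠ 0 := by positivity
  have hi : Integrable (avgExpIncr H b N n) P :=
    integrable_finsetSum _ fun j _ ↦ (hterm j).1.div_const _
  have he : ∫ ω, avgExpIncr H b N n ω ∂P = √2 := by
    simp only [avgExpIncr]
    rw [integral_finsetSum _ fun j _ ↦ (hterm j).1.div_const _]
    simp only [integral_div, (hterm _).2, Finset.sum_const, Finset.card_range, nsmul_eq_mul]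
    field_simp
  refine ⟨((integrable_const _).add hi).const_mul _, ?_⟩
  simp only [levelBound]
  rw [integral_const_mul, integral_add (integrable_const _) hi, he]
  simp

lemma lintegral_chainEnvelope_le (hb : IsRegularFBM H b P) (hH : 0 < H) {N : ℕ} (hN : 0 < N) :
    ∫⁻ ω, chainEnvelope H b N ω ∂P
      ≤ ENNReal.ofReal ((∑' n : ℕ, 4 * ((2 : ℝ) ^ (-H)) ^ n * (n + 2)) * (1 + log N)) := by
  obtain ⟨hρ0, hρ1⟩ := two_rpow_neg_mem_Ioo hH
  set ρ := (2 : ℝ) ^ (-H) with hρ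
  have hsum : Summable fun n : ℕ ↦ 4 * ρ ^ n * ((n : ℝ) + 2) := by
    have h1 := summable_pow_mul_geometric_of_norm_lt_one 1
      (r := ρ) (by rwa [Real.norm_of_nonneg hρ0.le])
    have h2 := summable_geometric_of_lt_one hρ0.le hρ1
    refine ((h1.mul_left 4).add (h2.mul_left 8)).congr fun n ↦ ?_
    ring
  have hlN : 0 ≤ log N := Real.log_natCast_nonneg N
  simp only [chainEnvelope]
  rw [lintegral_tsum fun n ↦ (hb.integrable_levelBound hH hN n).1.aemeasurable.ennreal_ofReal,
    ← tsum_mul_right, ENNReal.ofReal_tsum_of_nonneg (fun n ↦ ?_) (hsum.mul_right _)]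
  swap
  · have := add_nonneg zero_le_one hlN
    positivity
  refine ENNReal.tsum_le_tsum fun n ↦ ?_
  rw [← ofReal_integral_eq_lintegral_ofReal (hb.integrable_levelBound hH hN n).1
    (ae_of_all _ fun ω ↦ levelBound_nonneg H b N n ω), (hb.integrable_levelBound hH hN n).2, ← hρ]
  refine ENNReal.ofReal_le_ofReal ?_
  have h2 : √2 ≤ 2 := by
    rw [Real.sqrt_le_left (by norm_num)]; norm_num
  have hl2 : log 2 ≤ 1 := by linarith [Real.log_two_lt_d9]
  have : log (N * 2 ^ n : ℕ) ≤ log N + n := by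
    push_cast
    rw [Real.log_mul (x := (N : ℝ)) (y := 2 ^ n) (by positivity) (by positivity), Real.log_pow]
    have : (n : ℝ) * log 2 ≤ n * 1 := by gcongr
    linarith
  have hnl : 0 ≤ (n : ℝ) * log N := by positivity
  have key : log (N * 2 ^ n : ℕ) + √2 ≤ (n + 2) * (1 + log N) := by nlinarith
  have h4 : 0 ≤ 4 * ρ ^ n := by positivity
  linarith [mul_le_mul_of_nonneg_left key h4]

lemma measurable_chainEnvelope (hb : IsRegularFBM H b P) (N : ℕ) :
    Measurable (chainEnvelope H b N) := by
  have (t : ℝ) := hb.measurable t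
  unfold chainEnvelope levelBound avgExpIncr dyadicIncr
  fun_prop

end IsRegularFBM

end FracOU

/-! ### Chaining, and domination by one square-integrable variable -/

namespace FracOU
open Real Set Filter Topology

variable {Ω : Type*}

/-- A bound for the oscillation of `b` on each unit interval of `[0, N]`. -/
noncomputable def oscBound (H : ℝ) (b : ℝ → Ω → ℝ) (N : ℕ) (ω : Ω) : ℝ :=
  √((1 - (2 : ℝ) ^ (-H))⁻¹ * (chainEnvelope H b N ω).toReal)

section Pathwise

variable {H : ℝ} {b : ℝ → Ω → ℝ} {N : ℕ} {ω : Ω}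

lemma oscBound_nonneg : 0 ≤ oscBound H b N ω := Real.sqrt_nonneg _

lemma sum_sqrt_levelBound_le (hH : 0 < H) (hfin : chainEnvelope H b N ω ≠ ∞) (m : ℕ) :
    ∑ n ∈ Finset.range m, √(((2 : ℝ) ^ (-H)) ^ n * levelBound H b N n ω) ≤ oscBound H b N ω := by
  obtain ⟨hρ0, hρ1⟩ := two_rpow_neg_mem_Ioo hH
  set ρ := (2 : ℝ) ^ (-H) with hρ
  have hl (n : ℕ) := levelBound_nonneg H b N n ω
  have h1 : ∑ n ∈ Finset.range m, levelBound H b N n ω ≤ (chainEnvelope H b N ω).toReal := by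
    rw [← ENNReal.ofReal_le_iff_le_toReal hfin, ENNReal.ofReal_sum_of_nonneg fun n _ ↦ hl n]
    exact ENNReal.sum_le_tsum _
  have h2 : ∑ n ∈ Finset.range m, ρ ^ n ≤ (1 - ρ)⁻¹ := by
    rw [← tsum_geometric_of_lt_one hρ0.le hρ1]
    exact (summable_geometric_of_lt_one hρ0.le hρ1).sum_le_tsum _ fun n _ ↦ by positivity
  refine Real.le_sqrt_of_sq_le ?_
  calc _ ≤ (∑ n ∈ Finset.range m, ρ ^ n) * ∑ n ∈ Finset.range m, levelBound H b N n ω :=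
        Finset.sum_sq_le_sum_mul_sum_of_sq_le_mul _ (fun n _ ↦ by positivity) (fun n _ ↦ hl n)
          fun n _ ↦ (Real.sq_sqrt (mul_nonneg (by positivity) (hl n))).le
    _ ≤ _ := by
        have := Finset.sum_nonneg fun n (_ : n ∈ Finset.range m) ↦ hl n
        have : 0 < 1 - ρ := by linarith
        gcongr

lemma abs_dyadicIncr_le {n j : ℕ} (hj : j < N * 2 ^ n) :
    |dyadicIncr b n j ω| ≤ √(((2 : ℝ) ^ (-H)) ^ n * levelBound H b N n ω) :=
  Real.abs_le_sqrt (dyadicIncr_sq_le H b hj ω)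

/-- One step of the chaining: consecutive dyadic approximations of `u` from below agree or are the
ends of a dyadic interval. -/
lemma abs_sub_dyadic_floor_le {u : ℝ} (hu : 0 ≤ u) (huN : u < N) (n : ℕ) :
    |b (⌊2 ^ (n + 1) * u⌋₊ / 2 ^ (n + 1)) ω - b (⌊2 ^ n * u⌋₊ / 2 ^ n) ω|
      ≤ √(((2 : ℝ) ^ (-H)) ^ (n + 1) * levelBound H b N (n + 1) ω) := by
  set j := ⌊2 ^ n * u⌋₊ with hj
  set k := ⌊2 ^ (n + 1) * u⌋₊ with hk
  have hj1 : (j : ℝ) ≤ 2 ^ n * u := Nat.floor_le (by positivity)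
  have hj2 : 2 ^ n * u < j + 1 := Nat.lt_floor_add_one _
  have hk0 : (k : ℝ) ≤ 2 ^ (n + 1) * u := Nat.floor_le (by positivity)
  have hk1 : 2 * j ≤ k := by
    apply Nat.le_floor
    push_cast; rw [pow_succ]; linarith
  have hk2 : k < 2 * j + 2 := by
    have : (k : ℝ) < 2 * j + 2 := by rw [pow_succ] at hk0; linarith
    exact_mod_cast this
  have hjd : (j : ℝ) / 2 ^ n = (2 * j : ℕ) / 2 ^ (n + 1) := by
    push_cast; rw [pow_succ]; field_simp
  rcases (by omega : k = 2 * j ∨ k = 2 * j + 1) with h | h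
  · rw [h, hjd, sub_self, abs_zero]; positivity
  · rw [h, hjd]
    refine abs_dyadicIncr_le (n := n + 1) (j := 2 * j) ?_
    have : (k : ℝ) < N * 2 ^ (n + 1) := hk0.trans_lt (by rw [mul_comm]; gcongr)
    have : k < N * 2 ^ (n + 1) := by exact_mod_cast this
    omega

lemma abs_sub_floor_le (hH : 0 < H) (hc : Continuous fun t ↦ b t ω)
    (hfin : chainEnvelope H b N ω ≠ ∞) {u : ℝ} (hu : 0 ≤ u) (huN : u < N) :
    |b u ω - b ⌊u⌋₊ ω| ≤ oscBound H b N ω := by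
  have hchain (m : ℕ) : |b (⌊2 ^ m * u⌋₊ / 2 ^ m) ω - b ⌊u⌋₊ ω| ≤
      ∑ n ∈ Finset.range m, √(((2 : ℝ) ^ (-H)) ^ (n + 1) * levelBound H b N (n + 1) ω) := by
    induction m with
    | zero => simp
    | succ m ih =>
      rw [Finset.sum_range_succ]
      have := abs_sub_dyadic_floor_le (H := H) (b := b) (ω := ω) hu huN m
      have := abs_sub_le (b (⌊2 ^ (m + 1) * u⌋₊ / 2 ^ (m + 1)) ω) (b (⌊2 ^ m * u⌋₊ / 2 ^ m) ω)
        (b ⌊u⌋₊ ω)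
      linarith
  have hbound (m : ℕ) : |b (⌊2 ^ m * u⌋₊ / 2 ^ m) ω - b ⌊u⌋₊ ω| ≤ oscBound H b N ω := by
    have h1 := sum_sqrt_levelBound_le hH hfin (m + 1)
    rw [Finset.sum_range_succ'] at h1
    have h2 := Real.sqrt_nonneg (((2 : ℝ) ^ (-H)) ^ 0 * levelBound H b N 0 ω)
    linarith [hchain m]
  have hlim : Tendsto (fun m : ℕ ↦ (⌊2 ^ m * u⌋₊ : ℝ) / 2 ^ m) atTop (𝓝 u) := by
    have hp : Tendsto (fun m : ℕ ↦ (2 : ℝ) ^ m) atTop atTop :=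
      tendsto_pow_atTop_atTop_of_one_lt one_lt_two
    have := (tendsto_nat_floor_mul_div_atTop (R := ℝ) hu).comp hp
    refine this.congr fun m ↦ ?_
    simp [mul_comm]
  have h1 := (((hc.tendsto u).comp hlim).sub_const (b ⌊u⌋₊ ω)).abs
  exact le_of_tendsto' h1 hbound

lemma abs_sub_nat_le (hH : 0 < H) (hfin : chainEnvelope H b N ω ≠ ∞) {k l : ℕ} (hkl : k ≤ l)
    (hl : l ≤ N) : |b l ω - b k ω| ≤ oscBound H b N ω * (l - k) := by
  induction l, hkl using Nat.le_induction with
  | base => simp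
  | succ l hkl ih =>
    have h1 := ih (by omega)
    have h2 : |b (l + 1 : ℕ) ω - b l ω| ≤ oscBound H b N ω := by
      have h3 := abs_dyadicIncr_le (H := H) (N := N) (b := b) (ω := ω) (n := 0) (j := l)
        (by simp; omega)
      have h4 := sum_sqrt_levelBound_le hH hfin 1
      simp only [Finset.sum_range_one] at h4
      simpa [dyadicIncr] using h3.trans h4
    have h5 := abs_sub_le (b (l + 1 : ℕ) ω) (b l ω) (b k ω)
    push_cast at h2 h5 ⊢
    linarith

lemma abs_sub_le_oscBound (hH : 0 < H) (hc : Continuous fun t ↦ b t ω)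
    (hfin : chainEnvelope H b N ω ≠ ∞) {s t : ℝ} (hs : 0 ≤ s) (hst : s ≤ t) (ht : t < N) :
    |b t ω - b s ω| ≤ oscBound H b N ω * (3 + (t - s)) := by
  have h1 := abs_sub_floor_le hH hc hfin hs (hst.trans_lt ht)
  have h2 := abs_sub_floor_le hH hc hfin (hs.trans hst) ht
  have hfN : ⌊t⌋₊ ≤ N := ((Nat.floor_lt (hs.trans hst)).2 ht).le
  have h3 := abs_sub_nat_le hH hfin (Nat.floor_le_floor hst) hfN
  have h4 : (⌊t⌋₊ : ℝ) - ⌊s⌋₊ ≤ t - s + 1 := by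
    linarith [Nat.floor_le (hs.trans hst), Nat.lt_floor_add_one s]
  have h5 : |b t ω - b s ω| ≤ |b t ω - b ⌊t⌋₊ ω| + |b ⌊t⌋₊ ω - b ⌊s⌋₊ ω| + |b s ω - b ⌊s⌋₊ ω| := by
    have := abs_sub_le (b t ω) (b ⌊t⌋₊ ω) (b s ω)
    have := abs_sub_le (b ⌊t⌋₊ ω) (b ⌊s⌋₊ ω) (b s ω)
    rw [abs_sub_comm (b ⌊s⌋₊ ω)] at this
    linarith
  have h0 : 0 ≤ oscBound H b N ω := oscBound_nonneg
  nlinarith [mul_le_mul_of_nonneg_left h4 h0]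

end Pathwise

lemma ouMap_eq_add_integral {φ : ℝ → ℝ} (hφ : Continuous φ) (t : ℝ) :
    ouMap φ t = exp (-t) * φ t + ∫ s in (0 : ℝ)..t, exp (-(t - s)) * (φ t - φ s) := by
  simp only [mul_sub]
  rw [intervalIntegral.integral_sub (Continuous.intervalIntegrable (by fun_prop) _ _)
    (Continuous.intervalIntegrable (by fun_prop) _ _), intervalIntegral.integral_mul_const,
    integral_exp_neg_sub, ouMap]
  ring

/-- The Ornstein-Uhlenbeck map forgets the past exponentially fast, so that it is bounded by the
oscillation of the driving path, uniformly in time. -/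
lemma abs_ouMap_le {φ : ℝ → ℝ} (hφ : Continuous φ) (h0 : φ 0 = 0) {A t : ℝ} (ht : 0 ≤ t)
    (hA : ∀ s, 0 ≤ s → s ≤ t → |φ t - φ s| ≤ A * (3 + (t - s))) : |ouMap φ t| ≤ 4 * A := by
  have hA0 : 0 ≤ A := by
    have := (abs_nonneg _).trans (hA t ht le_rfl)
    linarith
  have h1 : |exp (-t) * φ t| ≤ A * (exp (-t) * (3 + t)) := by
    have := hA 0 le_rfl ht
    rw [h0, sub_zero, sub_zero] at this
    rw [abs_mul, abs_of_pos (exp_pos _)]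
    nlinarith [exp_pos (-t)]
  have h2 : |∫ s in (0 : ℝ)..t, exp (-(t - s)) * (φ t - φ s)|
      ≤ ∫ s in (0 : ℝ)..t, A * (exp (-(t - s)) * (3 + (t - s))) := by
    refine (intervalIntegral.abs_integral_le_integral_abs ht).trans ?_
    refine intervalIntegral.integral_mono_on ht (Continuous.intervalIntegrable (by fun_prop) _ _)
      (Continuous.intervalIntegrable (by fun_prop) _ _) fun s hs ↦ ?_
    rw [abs_mul, abs_of_pos (exp_pos _)]
    have := hA s hs.1 hs.2
    nlinarith [exp_pos (-(t - s))]
  have h3 : ∫ s in (0 : ℝ)..t, exp (-(t - s)) * (3 + (t - s)) = 4 - exp (-t) * (4 + t) := by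
    rw [intervalIntegral.integral_eq_sub_of_hasDerivAt
      (f := fun s ↦ exp (-(t - s)) * (4 + (t - s)))]
    · simp
    · intro s _
      have e := ((hasDerivAt_id s).const_sub t)
      refine (e.fun_neg.exp.mul (e.const_add 4)).congr_deriv ?_
      simp; ring
    · exact Continuous.intervalIntegrable (by fun_prop) _ _
  rw [intervalIntegral.integral_const_mul, h3] at h2
  rw [ouMap_eq_add_integral hφ]
  refine (abs_add_le _ _).trans ?_
  nlinarith [exp_pos (-t)]

variable [MeasurableSpace Ω] {P : Measure Ω} {H : ℝ} {b : ℝ → Ω → ℝ}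

/-- The solution of the normalised Langevin equation started at zero. -/
noncomputable def ouProc (b : ℝ → Ω → ℝ) (t : ℝ) (ω : Ω) : ℝ := ouMap (fun s ↦ b s ω) t

namespace IsRegularFBM

lemma abs_ouProc_le (hb : IsRegularFBM H b P) (hH : 0 < H) {N : ℕ} {ω : Ω}
    (hfin : chainEnvelope H b N ω ≠ ∞) {t : ℝ} (ht : 0 ≤ t) (htN : t < N) :
    |ouProc b t ω| ≤ 4 * oscBound H b N ω :=
  abs_ouMap_le (hb.continuous ω) (hb.zero ω) ht fun _ hs hst ↦
    abs_sub_le_oscBound hH (hb.continuous ω) hfin hs hst htN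

lemma ofReal_ouProc_sq_le (hb : IsRegularFBM H b P) (hH : 0 < H) {N : ℕ} (ω : Ω)
    {t : ℝ} (ht : 0 ≤ t) (htN : t < N) :
    ENNReal.ofReal (ouProc b t ω ^ 2)
      ≤ ENNReal.ofReal (16 * (1 - (2 : ℝ) ^ (-H))⁻¹) * chainEnvelope H b N ω := by
  obtain ⟨hρ0, hρ1⟩ := two_rpow_neg_mem_Ioo hH
  have hW : 0 < (1 - (2 : ℝ) ^ (-H))⁻¹ := by
    have : 0 < 1 - (2 : ℝ) ^ (-H) := by linarith
    positivity
  by_cases hfin : chainEnvelope H b N ω = ∞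
  · rw [hfin, ENNReal.mul_top (by simpa using hW)]
    exact le_top
  · have h := hb.abs_ouProc_le hH hfin ht htN
    rw [← ENNReal.ofReal_toReal hfin, ← ENNReal.ofReal_mul (by positivity)]
    refine ENNReal.ofReal_le_ofReal ?_
    have hs : oscBound H b N ω ^ 2 = (1 - (2 : ℝ) ^ (-H))⁻¹ * (chainEnvelope H b N ω).toReal :=
      Real.sq_sqrt (by positivity)
    rw [mul_assoc, ← hs, ← sq_abs]
    calc _ ≤ (4 * oscBound H b N ω) ^ 2 := by gcongr
      _ = _ := by ring

/-- On every bounded time interval the path and the process are dominated by one square-integrable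
variable. -/
lemma exists_dominating (hb : IsRegularFBM H b P) (hH : 0 < H) (T : ℝ) :
    ∃ G : Ω → ℝ, Measurable G ∧ MemLp G 2 P ∧ (∀ ω, 0 ≤ G ω) ∧
      ∀ᵐ ω ∂P, ∀ t, 0 ≤ t → t ≤ T → |b t ω| ≤ G ω ∧ |ouProc b t ω| ≤ G ω := by
  obtain ⟨N, hN⟩ := exists_nat_gt (max T 0)
  have hN0 : 0 < N := by exact_mod_cast (le_max_right T 0).trans_lt hN
  have hT : T < N := (le_max_left T 0).trans_lt hN
  have hm := hb.measurable_chainEnvelope N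
  have hfin := hb.lintegral_chainEnvelope_le hH hN0
  have hne : ∫⁻ ω, chainEnvelope H b N ω ∂P ≠ ∞ := ne_top_of_le_ne_top ENNReal.ofReal_ne_top hfin
  have hae : ∀ᵐ ω ∂P, chainEnvelope H b N ω ≠ ∞ := by
    filter_upwards [ae_lt_top hm hne] with ω hω using hω.ne
  have hmo : Measurable (oscBound H b N) := (hm.ennreal_toReal.const_mul _).sqrt
  have ho : MemLp (oscBound H b N) 2 P := by
    rw [memLp_two_iff_integrable_sq hmo.aestronglyMeasurable]
    refine ((integrable_toReal_of_lintegral_ne_top hm.aemeasurable hne).const_mul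
      (1 - (2 : ℝ) ^ (-H))⁻¹).congr (ae_of_all _ fun ω ↦ ?_)
    have : 0 ≤ (1 - (2 : ℝ) ^ (-H))⁻¹ := by
      have := (two_rpow_neg_mem_Ioo hH).2
      exact inv_nonneg.2 (by linarith)
    exact (Real.sq_sqrt (by positivity)).symm
  refine ⟨fun ω ↦ (4 + N) * oscBound H b N ω, hmo.const_mul _, ho.const_mul _,
    fun ω ↦ mul_nonneg (by positivity) oscBound_nonneg, ?_⟩
  filter_upwards [hae] with ω hω t ht htT
  have h0 : 0 ≤ oscBound H b N ω := oscBound_nonneg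
  constructor
  · have := abs_sub_le_oscBound hH (hb.continuous ω) hω le_rfl ht (htT.trans_lt hT)
    rw [hb.zero, sub_zero, sub_zero] at this
    nlinarith
  · have := hb.abs_ouProc_le hH hω ht (htT.trans_lt hT)
    have hN' : (0 : ℝ) ≤ N := by positivity
    nlinarith

end IsRegularFBM

end FracOU

/-! ### Gaussianity of the Ornstein-Uhlenbeck process -/

namespace FracOU
open Real Set Filter Topology

lemma integral_pow_four_gaussianReal (v : ℝ≥0) :
    ∫ x, x ^ 4 ∂gaussianReal 0 v = 3 * (v : ℝ) ^ 2 := by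
  have h0 : (0 : ℝ) ∈ interior (integrableExpSet id (gaussianReal 0 v)) := by
    rw [integrableExpSet_id_gaussianReal]; simp
  have h := iteratedDeriv_mgf_zero h0 4
  simp only [Pi.pow_apply, id] at h
  rw [← h, mgf_id_gaussianReal]
  simp only [zero_mul, zero_add]
  have hE (t : ℝ) :
      HasDerivAt (fun t : ℝ ↦ exp (v * t ^ 2 / 2)) (exp (v * t ^ 2 / 2) * (v * t)) t := by
    have := ((((hasDerivAt_id t).fun_pow 2).const_mul (v : ℝ)).div_const 2).exp
    refine this.congr_deriv ?_
    simp only [id]; ring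
  have hp (n : ℕ) (t : ℝ) : HasDerivAt (fun t : ℝ ↦ t ^ n) (n * t ^ (n - 1)) t :=
    hasDerivAt_pow n t
  have d1 : deriv (fun t : ℝ ↦ exp (v * t ^ 2 / 2)) = fun t ↦ exp (v * t ^ 2 / 2) * (v * t) :=
    funext fun t ↦ (hE t).deriv
  have d2 : deriv (fun t : ℝ ↦ exp (v * t ^ 2 / 2) * (v * t))
      = fun t ↦ exp (v * t ^ 2 / 2) * (v ^ 2 * t ^ 2 + v) := funext fun t ↦ by
    refine (((hE t).mul ((hasDerivAt_id t).const_mul (v : ℝ))).congr_deriv ?_).deriv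
    simp only [id]; ring
  have d3 : deriv (fun t : ℝ ↦ exp (v * t ^ 2 / 2) * (v ^ 2 * t ^ 2 + v))
      = fun t ↦ exp (v * t ^ 2 / 2) * (v ^ 3 * t ^ 3 + 3 * v ^ 2 * t) := funext fun t ↦ by
    refine (((hE t).mul
      (((hp 2 t).const_mul ((v : ℝ) ^ 2)).add_const (v : ℝ))).congr_deriv ?_).deriv
    push_cast; ring
  have d4 : deriv (fun t : ℝ ↦ exp (v * t ^ 2 / 2) * (v ^ 3 * t ^ 3 + 3 * v ^ 2 * t))
      = fun t ↦ exp (v * t ^ 2 / 2) * (v * t) * (v ^ 3 * t ^ 3 + 3 * v ^ 2 * t)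
        + exp (v * t ^ 2 / 2) * (3 * v ^ 3 * t ^ 2 + 3 * v ^ 2) := funext fun t ↦ by
    refine (((hE t).mul (((hp 3 t).const_mul ((v : ℝ) ^ 3)).add
      ((hasDerivAt_id t).const_mul (3 * (v : ℝ) ^ 2)))).congr_deriv ?_).deriv
    simp only [id, Pi.add_apply]; push_cast; ring
  rw [iteratedDeriv_succ, iteratedDeriv_succ, iteratedDeriv_succ, iteratedDeriv_one, d1, d2, d3, d4]
  simp

/-- Left Riemann sums of a continuous function converge to the integral. -/
lemma tendsto_riemannSum {f : ℝ → ℝ} (hf : Continuous f) :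
    Tendsto (fun n : ℕ ↦ ∑ j ∈ Finset.range (n + 1), f (j / (n + 1)) / (n + 1)) atTop
      (𝓝 (∫ x in (0 : ℝ)..1, f x)) := by
  have huc : UniformContinuousOn f (Icc 0 1) :=
    isCompact_Icc.uniformContinuousOn_of_continuous hf.continuousOn
  rw [Metric.tendsto_atTop]
  intro ε hε
  obtain ⟨δ, hδ, hfδ⟩ := Metric.uniformContinuousOn_iff.1 huc (ε / 2) (by positivity)
  obtain ⟨n₀, hn₀⟩ := exists_nat_one_div_lt hδ
  refine ⟨n₀, fun n hn ↦ ?_⟩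
  have hn1 : (0 : ℝ) < n + 1 := by positivity
  have hlt : 1 / ((n : ℝ) + 1) < δ := (one_div_le_one_div_of_le (by positivity)
    (by exact_mod_cast Nat.succ_le_succ hn)).trans_lt hn₀
  have hsplit : ∫ x in (0 : ℝ)..1, f x
      = ∑ j ∈ Finset.range (n + 1), ∫ x in (j : ℝ) / (n + 1)..((j + 1 : ℕ) : ℝ) / (n + 1), f x := by
    rw [intervalIntegral.sum_integral_adjacent_intervals (a := fun j : ℕ ↦ (j : ℝ) / (n + 1))
      fun j _ ↦ hf.intervalIntegrable _ _]
    congr 1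
    · simp
    · push_cast; field_simp
  rw [Real.dist_eq, hsplit, ← Finset.sum_sub_distrib]
  have hj : ∀ j ∈ Finset.range (n + 1), |f (j / (n + 1)) / (n + 1)
      - ∫ x in (j : ℝ) / (n + 1)..((j + 1 : ℕ) : ℝ) / (n + 1), f x| ≤ ε / 2 * (1 / (n + 1)) := by
    intro j hj
    have hj' : ((j + 1 : ℕ) : ℝ) ≤ n + 1 := by exact_mod_cast Finset.mem_range.1 hj
    have hlen : ((j + 1 : ℕ) : ℝ) / (n + 1) - j / (n + 1) = 1 / (n + 1) := by
      push_cast; field_simp; ring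
    have hle : (j : ℝ) / (n + 1) ≤ ((j + 1 : ℕ) : ℝ) / (n + 1) := by
      have : 0 < 1 / ((n : ℝ) + 1) := by positivity
      linarith
    have h1 : f (j / (n + 1)) / (n + 1)
        = ∫ x in (j : ℝ) / (n + 1)..((j + 1 : ℕ) : ℝ) / (n + 1), f (j / (n + 1)) := by
      rw [intervalIntegral.integral_const, hlen, smul_eq_mul]; ring
    rw [h1, ← intervalIntegral.integral_sub (by simp) (hf.intervalIntegrable _ _), ← hlen,
      ← abs_of_nonneg (sub_nonneg.2 hle), ← Real.norm_eq_abs]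
    refine intervalIntegral.norm_integral_le_of_norm_le_const fun x hx ↦ ?_
    rw [uIoc_of_le hle] at hx
    have hj0 : 0 ≤ (j : ℝ) / (n + 1) := by positivity
    have hj1 : ((j + 1 : ℕ) : ℝ) / (n + 1) ≤ 1 := by rw [div_le_one hn1]; exact hj'
    have := hfδ (j / (n + 1)) ⟨hj0, hle.trans hj1⟩ x ⟨hj0.trans hx.1.le, hx.2.trans hj1⟩ (by
      rw [dist_comm, Real.dist_eq, abs_of_nonneg (by linarith [hx.1])]
      linarith [hx.2])
    rw [Real.dist_eq] at this
    exact this.le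
  calc _ ≤ ∑ j ∈ Finset.range (n + 1), ε / 2 * (1 / ((n : ℝ) + 1)) :=
        (Finset.abs_sum_le_sum_abs _ _).trans (Finset.sum_le_sum hj)
    _ = ε / 2 := by
        rw [Finset.sum_const, Finset.card_range, nsmul_eq_mul]; push_cast; field_simp
    _ < ε := by linarith

variable {Ω : Type*} [MeasurableSpace Ω] {P : Measure Ω}

/-- A dominated limit of centred Gaussian variables is Gaussian. -/
lemma map_eq_gaussianReal_of_tendsto [IsProbabilityMeasure P] {Z : ℕ → Ω → ℝ} {Y G : Ω → ℝ}
    (hZ : ∀ n, HasGaussianLaw (Z n) P) (h0 : ∀ n, P[Z n] = 0)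
    (hlim : ∀ᵐ ω ∂P, Tendsto (fun n ↦ Z n ω) atTop (𝓝 (Y ω))) (hG : MemLp G 2 P)
    (hle : ∀ n, ∀ᵐ ω ∂P, |Z n ω| ≤ G ω) :
    P.map Y = gaussianReal 0 (∫ ω, Y ω ^ 2 ∂P).toNNReal := by
  have hYm : AEMeasurable Y P := aemeasurable_of_tendsto_metrizable_ae atTop
    (fun n ↦ (hZ n).aemeasurable) hlim
  have := Measure.isProbabilityMeasure_map hYm
  have hvar : Tendsto (fun n ↦ ∫ ω, Z n ω ^ 2 ∂P) atTop (𝓝 (∫ ω, Y ω ^ 2 ∂P)) := by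
    refine tendsto_integral_of_dominated_convergence (fun ω ↦ G ω ^ 2)
      (fun n ↦ ((hZ n).aemeasurable.pow_const 2).aestronglyMeasurable) hG.integrable_sq
      (fun n ↦ ?_) ?_
    · filter_upwards [hle n] with ω hω
      rw [Real.norm_of_nonneg (sq_nonneg _), ← sq_abs]
      gcongr
    · filter_upwards [hlim] with ω hω using hω.pow 2
  refine Measure.ext_of_charFun (funext fun θ ↦ ?_)
  rw [charFun_gaussianReal, Real.coe_toNNReal _ (integral_nonneg fun _ ↦ sq_nonneg _),
    charFun_apply_real, integral_map hYm (by fun_prop)]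
  have h1 : Tendsto (fun n ↦ ∫ ω, Complex.exp (θ * Z n ω * Complex.I) ∂P) atTop
      (𝓝 (∫ ω, Complex.exp (θ * Y ω * Complex.I) ∂P)) := by
    refine tendsto_integral_of_dominated_convergence (fun _ ↦ 1) (fun n ↦ ?_)
      (integrable_const _) (fun n ↦ ae_of_all _ fun ω ↦ ?_) ?_
    · have := (hZ n).aemeasurable
      exact AEMeasurable.aestronglyMeasurable (by fun_prop)
    · rw [← Complex.ofReal_mul, Complex.norm_exp_ofReal_mul_I]
    · filter_upwards [hlim] with ω hω
      have hc : Continuous fun x : ℝ ↦ Complex.exp (θ * x * Complex.I) := by fun_prop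
      exact (hc.tendsto _).comp hω
  have h2 (n : ℕ) : ∫ ω, Complex.exp (θ * Z n ω * Complex.I) ∂P
      = Complex.exp (θ * (0 : ℝ) * Complex.I - ((∫ ω, Z n ω ^ 2 ∂P : ℝ) : ℂ) * θ ^ 2 / 2) := by
    have hm := (hZ n).map_eq_gaussianReal
    rw [h0, variance_of_integral_eq_zero (hZ n).aemeasurable (h0 n)] at hm
    have hc := charFun_gaussianReal (μ := 0) (v := (∫ ω, Z n ω ^ 2 ∂P).toNNReal) θ
    rw [← hm, charFun_apply_real, integral_map (hZ n).aemeasurable (by fun_prop),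
      Real.coe_toNNReal _ (integral_nonneg fun _ ↦ sq_nonneg _)] at hc
    exact hc
  simp_rw [h2] at h1
  refine tendsto_nhds_unique h1 ?_
  have hc : Continuous fun s : ℝ ↦
      Complex.exp (θ * (0 : ℝ) * Complex.I - (s : ℂ) * θ ^ 2 / 2) := by fun_prop
  exact (hc.tendsto _).comp hvar

lemma integral_pow_four_of_map_eq {Z : Ω → ℝ} (hZ : AEMeasurable Z P)
    (h : P.map Z = gaussianReal 0 (∫ ω, Z ω ^ 2 ∂P).toNNReal) :
    MemLp Z 4 P ∧ ∫ ω, Z ω ^ 4 ∂P = 3 * (∫ ω, Z ω ^ 2 ∂P) ^ 2 := by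
  constructor
  · have := memLp_id_gaussianReal' (μ := 0) (v := (∫ ω, Z ω ^ 2 ∂P).toNNReal) 4 (by norm_num)
    rw [← h] at this
    exact (memLp_map_measure_iff (by fun_prop) hZ).1 this
  · have := integral_pow_four_gaussianReal (∫ ω, Z ω ^ 2 ∂P).toNNReal
    rwa [← h, integral_map hZ (by fun_prop),
      Real.coe_toNNReal _ (integral_nonneg fun _ ↦ sq_nonneg _)] at this

namespace IsRegularFBM

variable {H : ℝ} {b : ℝ → Ω → ℝ}

lemma hasGaussianLaw_sum_mul (hb : IsRegularFBM H b P) {ι : Type*} (s : Finset ι) (c t : ι → ℝ) :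
    HasGaussianLaw (fun ω ↦ ∑ i ∈ s, c i * b (t i) ω) P :=
  ((hb.gaussian.comp_right t).smul c).hasGaussianLaw_fun_sum (I := s)

lemma integral_sum_mul (hb : IsRegularFBM H b P) {ι : Type*} (s : Finset ι) (c t : ι → ℝ) :
    ∫ ω, ∑ i ∈ s, c i * b (t i) ω ∂P = 0 := by
  have := hb.gaussian.isProbabilityMeasure
  rw [integral_finsetSum _ fun i _ ↦ ((hb.memLp_two _).integrable (by norm_num)).const_mul _]
  simp [integral_const_mul, hb.centered]

lemma ouProc_eq_integral (hb : IsRegularFBM H b P) (u : ℝ) (ω : Ω) :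
    ouProc b u ω
      = ∫ x in (0 : ℝ)..1, (b u ω - u * exp (-(u - u * x)) * b (u * x) ω) := by
  have hc := hb.continuous ω
  have hc' : Continuous fun x ↦ b (u * x) ω := hc.comp (by fun_prop)
  rw [intervalIntegral.integral_sub (by simp) (Continuous.intervalIntegrable (by fun_prop) _ _),
    intervalIntegral.integral_const]
  have := intervalIntegral.mul_integral_comp_mul_left (a := 0) (b := 1) (c := u)
    (f := fun s ↦ exp (-(u - s)) * b s ω)
  rw [mul_zero, mul_one, ← intervalIntegral.integral_const_mul] at this
  rw [ouProc, ouMap, ← this]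
  simp [mul_assoc]

lemma measurable_uncurry (hb : IsRegularFBM H b P) : Measurable (Function.uncurry b) :=
  measurable_uncurry_of_continuous_of_measurable hb.continuous hb.measurable

lemma continuous_ouProc (hb : IsRegularFBM H b P) (ω : Ω) : Continuous fun t ↦ ouProc b t ω :=
  continuous_ouMap_param (φ := fun _ s ↦ b s ω) ((hb.continuous ω).comp continuous_snd)
    continuous_id

lemma measurable_ouProc (hb : IsRegularFBM H b P) (t : ℝ) : Measurable (ouProc b t) := by
  have h : StronglyMeasurable fun p : ℝ × Ω ↦ exp (-(t - p.1)) * b p.1 p.2 := by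
    have := hb.measurable_uncurry
    refine Measurable.stronglyMeasurable (Measurable.mul (by fun_prop) this)
  unfold ouProc ouMap
  simp only [intervalIntegral]
  exact (hb.measurable t).sub
    (h.integral_prod_left'.measurable.sub h.integral_prod_left'.measurable)

lemma measurable_uncurry_ouProc (hb : IsRegularFBM H b P) :
    Measurable (Function.uncurry (ouProc b)) :=
  measurable_uncurry_of_continuous_of_measurable hb.continuous_ouProc hb.measurable_ouProc

/-- The Ornstein-Uhlenbeck process is Gaussian: its linear combinations are limits of Riemann sums
of the driving noise. -/
lemma map_ouProc_combination (hb : IsRegularFBM H b P) (hH : 0 < H) {u v : ℝ} (hu : 0 ≤ u)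
    (hv : 0 ≤ v) (α β : ℝ) :
    P.map (fun ω ↦ α * ouProc b u ω + β * ouProc b v ω)
      = gaussianReal 0 (∫ ω, (α * ouProc b u ω + β * ouProc b v ω) ^ 2 ∂P).toNNReal := by
  have := hb.gaussian.isProbabilityMeasure
  obtain ⟨G, -, hG2, hG0, hG⟩ := hb.exists_dominating hH (max u v)
  set ψ : Ω → ℝ → ℝ := fun ω x ↦ α * (b u ω - u * exp (-(u - u * x)) * b (u * x) ω)
    + β * (b v ω - v * exp (-(v - v * x)) * b (v * x) ω) with hψ
  set c : ℕ → ℕ × Fin 4 → ℝ := fun n p ↦ ![α / (n + 1),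
    -(α * (u * exp (-(u - u * (p.1 / (n + 1)))))) / (n + 1), β / (n + 1),
    -(β * (v * exp (-(v - v * (p.1 / (n + 1)))))) / (n + 1)] p.2 with hc
  set τ : ℕ → ℕ × Fin 4 → ℝ := fun n p ↦
    ![u, u * (p.1 / (n + 1)), v, v * (p.1 / (n + 1))] p.2 with hτ
  have hsum (n : ℕ) (ω : Ω) : ∑ j ∈ Finset.range (n + 1), ψ ω (j / (n + 1)) / (n + 1)
      = ∑ p ∈ Finset.range (n + 1) ×ˢ Finset.univ, c n p * b (τ n p) ω := by
    rw [Finset.sum_product]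
    refine Finset.sum_congr rfl fun j _ ↦ ?_
    simp [Fin.sum_univ_four, hψ, hc, hτ]
    ring
  refine map_eq_gaussianReal_of_tendsto
    (Z := fun n ω ↦ ∑ j ∈ Finset.range (n + 1), ψ ω (j / (n + 1)) / (n + 1))
    (G := fun ω ↦ (|α| * (1 + u) + |β| * (1 + v)) * G ω) (fun n ↦ ?_) (fun n ↦ ?_)
    (ae_of_all _ fun ω ↦ ?_) (hG2.const_mul _) fun n ↦ ?_
  · simp_rw [hsum]
    exact hb.hasGaussianLaw_sum_mul _ _ _
  · simp_rw [hsum]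
    exact hb.integral_sum_mul _ _ _
  · have hcb := hb.continuous ω
    have hcu : Continuous fun x ↦ b (u * x) ω := hcb.comp (by fun_prop)
    have hcv : Continuous fun x ↦ b (v * x) ω := hcb.comp (by fun_prop)
    have h := tendsto_riemannSum (f := ψ ω) (by simp only [hψ]; fun_prop)
    rwa [hψ, intervalIntegral.integral_add (Continuous.intervalIntegrable (by fun_prop) _ _)
      (Continuous.intervalIntegrable (by fun_prop) _ _), intervalIntegral.integral_const_mul,
      intervalIntegral.integral_const_mul, ← hb.ouProc_eq_integral, ← hb.ouProc_eq_integral,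
      ← hψ] at h
  · filter_upwards [hG] with ω hω
    have hpt : ∀ w, 0 ≤ w → w ≤ max u v → ∀ x, 0 ≤ x → x ≤ 1 →
        |b w ω - w * exp (-(w - w * x)) * b (w * x) ω| ≤ (1 + w) * G ω := by
      intro w hw hwm x hx0 hx1
      have hwx : w * x ≤ w := mul_le_of_le_one_right hw hx1
      have h1 := (hω w hw hwm).1
      have h2 := (hω (w * x) (by positivity) (hwx.trans hwm)).1
      have h3 : exp (-(w - w * x)) ≤ 1 := Real.exp_le_one_iff.2 (by linarith)
      have h4 : |w * exp (-(w - w * x)) * b (w * x) ω| ≤ w * 1 * G ω := by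
        rw [abs_mul, abs_mul, abs_of_nonneg hw, abs_of_pos (exp_pos _)]
        gcongr
      calc _ ≤ |b w ω| + |w * exp (-(w - w * x)) * b (w * x) ω| := abs_sub _ _
        _ ≤ _ := by linarith
    calc _ ≤ ∑ j ∈ Finset.range (n + 1), |ψ ω (j / (n + 1)) / (n + 1)| :=
          Finset.abs_sum_le_sum_abs _ _
      _ ≤ ∑ j ∈ Finset.range (n + 1), (|α| * (1 + u) + |β| * (1 + v)) * G ω / (n + 1) := by
          refine Finset.sum_le_sum fun j hj ↦ ?_
          have hn : (0 : ℝ) < n + 1 := by positivity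
          have hj' : (j : ℝ) / (n + 1) ≤ 1 := by
            rw [div_le_one hn]
            exact_mod_cast (Finset.mem_range.1 hj).le
          have hj0 : 0 ≤ (j : ℝ) / (n + 1) := by positivity
          rw [abs_div, abs_of_pos hn]
          gcongr
          calc _ ≤ |α| * ((1 + u) * G ω) + |β| * ((1 + v) * G ω) := by
                refine (abs_add_le _ _).trans ?_
                rw [abs_mul, abs_mul]
                gcongr
                · exact hpt u hu (le_max_left _ _) _ hj0 hj'
                · exact hpt v hv (le_max_right _ _) _ hj0 hj'
            _ = _ := by ring
      _ = _ := by
          rw [Finset.sum_const, Finset.card_range, nsmul_eq_mul]; push_cast; field_simp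

end IsRegularFBM

end FracOU

/-! ### Covariances and Wick's formula -/

namespace FracOU
open Real Set Filter Topology

variable {Ω : Type*} [MeasurableSpace Ω] {P : Measure Ω}

lemma ouMap_congr {φ ψ : ℝ → ℝ} {t : ℝ} (ht : 0 ≤ t) (h : ∀ s, 0 ≤ s → s ≤ t → φ s = ψ s) :
    ouMap φ t = ouMap ψ t := by
  rw [ouMap, ouMap, h t ht le_rfl]
  congr 1
  refine intervalIntegral.integral_congr fun s hs ↦ ?_
  rw [uIcc_of_le ht] at hs
  simp only [h s hs.1 hs.2]

namespace IsRegularFBM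

variable {H : ℝ} {b : ℝ → Ω → ℝ}

lemma memLp_two_ouProc (hb : IsRegularFBM H b P) (hH : 0 < H) {t : ℝ} (ht : 0 ≤ t) :
    MemLp (ouProc b t) 2 P := by
  obtain ⟨G, -, hG2, -, hG⟩ := hb.exists_dominating hH t
  refine hG2.mono' (hb.measurable_ouProc t).aestronglyMeasurable ?_
  filter_upwards [hG] with ω hω using (hω t ht le_rfl).2

/-- The Ornstein-Uhlenbeck map commutes with taking covariances. -/
lemma integral_mul_ouProc (hb : IsRegularFBM H b P) (hH : 0 < H) {g : Ω → ℝ} (hg : MemLp g 2 P)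
    {t : ℝ} (ht : 0 ≤ t) :
    ∫ ω, g ω * ouProc b t ω ∂P = ouMap (fun s ↦ ∫ ω, g ω * b s ω ∂P) t := by
  have := hb.gaussian.isProbabilityMeasure
  obtain ⟨G, -, hG2, hG0, hG⟩ := hb.exists_dominating hH t
  have : IsFiniteMeasure (volume.restrict (uIoc 0 t)) :=
    isFiniteMeasure_restrict.2 (by rw [uIoc_of_le ht]; exact measure_Ioc_lt_top.ne)
  have hint : Integrable (Function.uncurry fun s ω ↦ exp (-(t - s)) * (g ω * b s ω))
      ((volume.restrict (uIoc 0 t)).prod P) := by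
    have hdom : Integrable (fun p : ℝ × Ω ↦ |g p.2| * G p.2)
        ((volume.restrict (uIoc 0 t)).prod P) :=
      (hg.abs.integrable_mul hG2).comp_snd _
    refine hdom.mono' ?_ ?_
    · refine AEStronglyMeasurable.mul (by fun_prop) (AEStronglyMeasurable.mul ?_ ?_)
      · exact hg.1.comp_snd
      · exact hb.measurable_uncurry.aestronglyMeasurable
    · have h1 : ∀ᵐ p ∂((volume.restrict (uIoc 0 t)).prod P), p.1 ∈ uIoc 0 t :=
        Measure.quasiMeasurePreserving_fst.ae (ae_restrict_mem measurableSet_uIoc)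
      have h2 : ∀ᵐ p ∂((volume.restrict (uIoc 0 t)).prod P), ∀ s, 0 ≤ s → s ≤ t →
          |b s p.2| ≤ G p.2 ∧ |ouProc b s p.2| ≤ G p.2 :=
        Measure.quasiMeasurePreserving_snd.ae hG
      filter_upwards [h1, h2] with p hp1 hp2
      rw [uIoc_of_le ht] at hp1
      have h3 : exp (-(t - p.1)) ≤ 1 := Real.exp_le_one_iff.2 (by linarith [hp1.2])
      simp only [Function.uncurry, Real.norm_eq_abs, abs_mul, abs_of_pos (exp_pos _)]
      calc exp (-(t - p.1)) * (|g p.2| * |b p.1 p.2|) ≤ 1 * (|g p.2| * G p.2) := by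
            have := (hp2 p.1 hp1.1.le hp1.2).1
            gcongr
        _ = _ := one_mul _
  have hswap := intervalIntegral_integral_swap hint
  have hgb : Integrable (fun ω ↦ g ω * b t ω) P := hg.integrable_mul (hb.memLp_two t)
  have hgi : Integrable (fun ω ↦ ∫ s in (0 : ℝ)..t, exp (-(t - s)) * (g ω * b s ω)) P := by
    have h := hint.integral_prod_right
    rw [uIoc_of_le ht] at h
    simpa only [intervalIntegral.integral_of_le ht, Function.uncurry] using h
  have e (ω : Ω) : g ω * ouProc b t ω
      = g ω * b t ω - ∫ s in (0 : ℝ)..t, exp (-(t - s)) * (g ω * b s ω) := by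
    rw [ouProc, ouMap, mul_sub, ← intervalIntegral.integral_const_mul]
    congr 2; ext s; ring
  simp_rw [e]
  rw [integral_sub hgb hgi, ← hswap, ouMap]
  simp only [integral_const_mul]

lemma integral_mul_ouProc_left (hb : IsRegularFBM H b P) (hH : 0 < H) {u v : ℝ} (hu : 0 ≤ u)
    (hv : 0 ≤ v) : ∫ ω, ouProc b u ω * b v ω ∂P = mixedCov H u v := by
  simp_rw [mul_comm (ouProc b u _)]
  rw [hb.integral_mul_ouProc hH (hb.memLp_two v) hu, mixedCov]
  refine ouMap_congr hu fun s hs _ ↦ ?_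
  simp_rw [mul_comm (b v _)]
  exact hb.cov s v hs hv

lemma integral_ouProc_mul_ouProc (hb : IsRegularFBM H b P) (hH : 0 < H) {u v : ℝ} (hu : 0 ≤ u)
    (hv : 0 ≤ v) : ∫ ω, ouProc b u ω * ouProc b v ω ∂P = ouCov H u v := by
  rw [hb.integral_mul_ouProc hH (hb.memLp_two_ouProc hH hu) hv, ouCov]
  exact ouMap_congr hv fun s hs _ ↦ hb.integral_mul_ouProc_left hH hu hs

lemma ouCov_comm (hb : IsRegularFBM H b P) (hH : 0 < H) {u v : ℝ} (hu : 0 ≤ u)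
    (hv : 0 ≤ v) : ouCov H u v = ouCov H v u := by
  rw [← hb.integral_ouProc_mul_ouProc hH hu hv, ← hb.integral_ouProc_mul_ouProc hH hv hu]
  simp_rw [mul_comm]

lemma integral_ouProc (hb : IsRegularFBM H b P) (hH : 0 < H) {u : ℝ} (hu : 0 ≤ u) :
    ∫ ω, ouProc b u ω ∂P = 0 := by
  have := hb.gaussian.isProbabilityMeasure
  have h := hb.integral_mul_ouProc hH (g := fun _ ↦ 1) (memLp_const 1) hu
  simp only [one_mul, hb.centered] at h
  rw [h, ouMap_const, mul_zero]

lemma integral_combination_sq (hb : IsRegularFBM H b P) (hH : 0 < H) {u v : ℝ} (hu : 0 ≤ u)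
    (hv : 0 ≤ v) (α β : ℝ) :
    ∫ ω, (α * ouProc b u ω + β * ouProc b v ω) ^ 2 ∂P
      = α ^ 2 * ouCov H u u + 2 * α * β * ouCov H u v + β ^ 2 * ouCov H v v := by
  have hU := hb.memLp_two_ouProc hH hu
  have hV := hb.memLp_two_ouProc hH hv
  have h1 : Integrable (fun ω ↦ ouProc b u ω * ouProc b u ω) P := hU.integrable_mul hU
  have h2 : Integrable (fun ω ↦ ouProc b u ω * ouProc b v ω) P := hU.integrable_mul hV
  have h3 : Integrable (fun ω ↦ ouProc b v ω * ouProc b v ω) P := hV.integrable_mul hV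
  have e (ω : Ω) : (α * ouProc b u ω + β * ouProc b v ω) ^ 2
      = α ^ 2 * (ouProc b u ω * ouProc b u ω) + 2 * α * β * (ouProc b u ω * ouProc b v ω)
        + β ^ 2 * (ouProc b v ω * ouProc b v ω) := by ring
  simp_rw [e]
  rw [integral_add (by exact (h1.const_mul _).add (h2.const_mul _)) (h3.const_mul _),
    integral_add (h1.const_mul _) (h2.const_mul _)]
  simp only [integral_const_mul, hb.integral_ouProc_mul_ouProc hH, hu, hv]

lemma integral_combination_pow_four (hb : IsRegularFBM H b P) (hH : 0 < H) {u v : ℝ} (hu : 0 ≤ u)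
    (hv : 0 ≤ v) (α β : ℝ) :
    MemLp (fun ω ↦ α * ouProc b u ω + β * ouProc b v ω) 4 P ∧
    ∫ ω, (α * ouProc b u ω + β * ouProc b v ω) ^ 4 ∂P
      = 3 * (α ^ 2 * ouCov H u u + 2 * α * β * ouCov H u v + β ^ 2 * ouCov H v v) ^ 2 := by
  rw [← hb.integral_combination_sq hH hu hv]
  exact integral_pow_four_of_map_eq
    (((hb.measurable_ouProc u).const_mul α).add ((hb.measurable_ouProc v).const_mul β)).aemeasurable
    (hb.map_ouProc_combination hH hu hv α β)

lemma memLp_four_ouProc (hb : IsRegularFBM H b P) (hH : 0 < H) {u : ℝ} (hu : 0 ≤ u) :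
    MemLp (ouProc b u) 4 P := by
  simpa using (hb.integral_combination_pow_four hH hu hu 1 0).1

lemma memLp_two_ouProc_sq (hb : IsRegularFBM H b P) (hH : 0 < H) {u : ℝ} (hu : 0 ≤ u) :
    MemLp (fun ω ↦ ouProc b u ω ^ 2) 2 P := by
  have h := (hb.memLp_four_ouProc hH hu).norm_rpow_div 2
  have e : (4 : ℝ≥0∞) / 2 = 2 :=
    ((ENNReal.eq_div_iff (by norm_num) (by norm_num)).2 (by norm_num)).symm
  rw [e] at h
  simpa using h

/-- Wick's formula, obtained from the fourth moments of `Y_u ± Y_v` by polarisation. -/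
lemma integral_sq_mul_sq (hb : IsRegularFBM H b P) (hH : 0 < H) {u v : ℝ} (hu : 0 ≤ u)
    (hv : 0 ≤ v) :
    ∫ ω, ouProc b u ω ^ 2 * ouProc b v ω ^ 2 ∂P
      = ouCov H u u * ouCov H v v + 2 * ouCov H u v ^ 2 := by
  have hi4 {w : ℝ} (α β : ℝ) (hw : 0 ≤ w) :
      Integrable (fun ω ↦ (α * ouProc b u ω + β * ouProc b w ω) ^ 4) P := by
    have h := (hb.integral_combination_pow_four hH hu hw α β).1.integrable_norm_pow (by norm_num)
    refine h.congr (ae_of_all _ fun ω ↦ ?_)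
    simp only [Real.norm_eq_abs]
    exact Even.pow_abs ⟨2, rfl⟩ _
  have i1 := hi4 1 1 hv
  have i2 := hi4 1 (-1) hv
  have i3 := hi4 1 0 hv
  have i4 := hi4 0 1 hv
  have m1 := (hb.integral_combination_pow_four hH hu hv 1 1).2
  have m2 := (hb.integral_combination_pow_four hH hu hv 1 (-1)).2
  have m3 := (hb.integral_combination_pow_four hH hu hv 1 0).2
  have m4 := (hb.integral_combination_pow_four hH hu hv 0 1).2
  have e (ω : Ω) : ouProc b u ω ^ 2 * ouProc b v ω ^ 2
      = ((1 * ouProc b u ω + 1 * ouProc b v ω) ^ 4 + (1 * ouProc b u ω + -1 * ouProc b v ω) ^ 4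
        - (2 * (1 * ouProc b u ω + 0 * ouProc b v ω) ^ 4
          + 2 * (0 * ouProc b u ω + 1 * ouProc b v ω) ^ 4)) / 12 := by ring
  simp_rw [e]
  rw [integral_div, integral_sub (by exact i1.add i2)
    (by exact (i3.const_mul 2).add (i4.const_mul 2)), integral_add i1 i2,
    integral_add (i3.const_mul 2) (i4.const_mul 2), integral_const_mul, integral_const_mul,
    m1, m2, m3, m4]
  ring

lemma integral_centered_sq_mul (hb : IsRegularFBM H b P) (hH : 0 < H) {u v : ℝ} (hu : 0 ≤ u)
    (hv : 0 ≤ v) :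
    ∫ ω, (ouProc b u ω ^ 2 - ouCov H u u) * (ouProc b v ω ^ 2 - ouCov H v v) ∂P
      = 2 * ouCov H u v ^ 2 := by
  have := hb.gaussian.isProbabilityMeasure
  have hU := hb.memLp_two_ouProc_sq hH hu
  have hV := hb.memLp_two_ouProc_sq hH hv
  have h1 : Integrable (fun ω ↦ ouProc b u ω ^ 2 * ouProc b v ω ^ 2) P := hU.integrable_mul hV
  have h2 : Integrable (fun ω ↦ ouProc b u ω ^ 2) P := hU.integrable (by norm_num)
  have h3 : Integrable (fun ω ↦ ouProc b v ω ^ 2) P := hV.integrable (by norm_num)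
  have hu2 : ∫ ω, ouProc b u ω ^ 2 ∂P = ouCov H u u := by
    simp_rw [sq]; exact hb.integral_ouProc_mul_ouProc hH hu hu
  have hv2 : ∫ ω, ouProc b v ω ^ 2 ∂P = ouCov H v v := by
    simp_rw [sq]; exact hb.integral_ouProc_mul_ouProc hH hv hv
  have e (ω : Ω) : (ouProc b u ω ^ 2 - ouCov H u u) * (ouProc b v ω ^ 2 - ouCov H v v)
      = ouProc b u ω ^ 2 * ouProc b v ω ^ 2 - ouCov H v v * ouProc b u ω ^ 2
        - ouCov H u u * (ouProc b v ω ^ 2 - ouCov H v v) := by ring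
  simp_rw [e]
  rw [integral_sub (by exact h1.sub (h2.const_mul _))
    (by exact (h3.sub (integrable_const _)).const_mul _), integral_sub h1 (h2.const_mul _),
    integral_const_mul, integral_const_mul, integral_sub h3 (integrable_const _), hu2, hv2,
    hb.integral_sq_mul_sq hH hu hv, integral_const, probReal_univ, one_smul]
  ring

end IsRegularFBM

/-- The second moment of a time integral, as a double integral of the covariances. -/
lemma integral_sq_intervalIntegral [IsProbabilityMeasure P] {φ : ℝ → Ω → ℝ}
    (hφ : Measurable (Function.uncurry φ)) {T K : ℝ} (hT : 0 ≤ T)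
    (hm : ∀ u ∈ Ioc 0 T, MemLp (φ u) 2 P) (hK : ∀ u ∈ Ioc 0 T, ∫ ω, φ u ω ^ 2 ∂P ≤ K) :
    MemLp (fun ω ↦ ∫ u in (0 : ℝ)..T, φ u ω) 2 P ∧
      ∫ ω, (∫ u in (0 : ℝ)..T, φ u ω) ^ 2 ∂P
        = ∫ u in (0 : ℝ)..T, ∫ v in (0 : ℝ)..T, ∫ ω, φ u ω * φ v ω ∂P := by
  set ν := volume.restrict (Ioc 0 T) with hν
  have hmf : Measurable fun p : (ℝ × ℝ) × Ω ↦ φ p.1.1 p.2 * φ p.1.2 p.2 :=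
    (hφ.comp (by fun_prop : Measurable fun p : (ℝ × ℝ) × Ω ↦ (p.1.1, p.2))).mul
      (hφ.comp (by fun_prop : Measurable fun p : (ℝ × ℝ) × Ω ↦ (p.1.2, p.2)))
  have hmem : ∀ᵐ p ∂(ν.prod ν), p ∈ Ioc 0 T ×ˢ Ioc 0 T := by
    rw [hν, Measure.prod_restrict]
    exact ae_restrict_mem (measurableSet_Ioc.prod measurableSet_Ioc)
  have hint : Integrable (fun p : (ℝ × ℝ) × Ω ↦ φ p.1.1 p.2 * φ p.1.2 p.2) ((ν.prod ν).prod P) := by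
    rw [integrable_prod_iff hmf.aestronglyMeasurable]
    constructor
    · filter_upwards [hmem] with p hp
      exact (hm p.1 hp.1).integrable_mul (hm p.2 hp.2)
    · refine Integrable.mono' (integrable_const (2 * K))
        (hmf.aestronglyMeasurable.norm.integral_prod_right') ?_
      filter_upwards [hmem] with p hp
      have i1 := (hm p.1 hp.1).integrable_sq
      have i2 := (hm p.2 hp.2).integrable_sq
      rw [Real.norm_of_nonneg (integral_nonneg fun _ ↦ norm_nonneg _)]
      calc _ ≤ ∫ ω, (φ p.1 ω ^ 2 + φ p.2 ω ^ 2) ∂P := by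
            refine integral_mono ((hm p.1 hp.1).integrable_mul (hm p.2 hp.2)).norm (i1.add i2)
              fun ω ↦ ?_
            simp only [Real.norm_eq_abs, abs_mul]
            nlinarith [sq_nonneg (|φ p.1 ω| - |φ p.2 ω|), sq_abs (φ p.1 ω), sq_abs (φ p.2 ω)]
        _ ≤ 2 * K := by
            rw [integral_add i1 i2]
            linarith [hK p.1 hp.1, hK p.2 hp.2]
  have hsq (ω : Ω) : (∫ u in (0 : ℝ)..T, φ u ω) ^ 2
      = ∫ p : ℝ × ℝ, φ p.1 ω * φ p.2 ω ∂(ν.prod ν) := by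
    rw [integral_prod_mul (fun u ↦ φ u ω) (fun u ↦ φ u ω), intervalIntegral.integral_of_le hT, sq]
  have hmeas : Measurable fun ω ↦ ∫ u in (0 : ℝ)..T, φ u ω := by
    simp only [intervalIntegral.integral_of_le hT]
    exact hφ.stronglyMeasurable.integral_prod_left'.measurable
  constructor
  · rw [memLp_two_iff_integrable_sq hmeas.aestronglyMeasurable]
    simp_rw [hsq]
    exact hint.integral_prod_right
  · simp_rw [hsq]
    rw [← integral_integral_swap (f := fun (p : ℝ × ℝ) ω ↦ φ p.1 ω * φ p.2 ω) hint]
    have h2 := hint.integral_prod_left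
    rw [integral_prod _ h2]
    simp only [intervalIntegral.integral_of_le hT, hν]

namespace IsRegularFBM

variable {H : ℝ} {b : ℝ → Ω → ℝ}

/-- The fluctuations of the time integral of the squared process grow at most linearly. -/
lemma integral_sq_centered_le (hb : IsRegularFBM H b P) (hH : H ∈ Ioc (1 / 4 : ℝ) (1 / 2))
    {M T : ℝ} (hT : 0 ≤ T) (hM : ∀ u, 0 ≤ u → ouCov H u u ≤ M) :
    MemLp (fun ω ↦ ∫ u in (0 : ℝ)..T, (ouProc b u ω ^ 2 - ouCov H u u)) 2 P ∧
      ∫ ω, (∫ u in (0 : ℝ)..T, (ouProc b u ω ^ 2 - ouCov H u u)) ^ 2 ∂P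
        ≤ 4 * (M ^ 2 + 4 / (4 * H - 1)) * T := by
  have hH0 : 0 < H := by linarith [hH.1]
  have := hb.gaussian.isProbabilityMeasure
  have hq0 (u : ℝ) (hu : 0 ≤ u) : 0 ≤ ouCov H u u := by
    rw [← hb.integral_ouProc_mul_ouProc hH0 hu hu]
    exact integral_nonneg fun ω ↦ mul_self_nonneg _
  have hq2 (u : ℝ) (hu : 0 ≤ u) : ouCov H u u ^ 2 ≤ M ^ 2 :=
    pow_le_pow_left₀ (hq0 u hu) (hM u hu) 2
  have hcq : Continuous fun u ↦ ouCov H u u :=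
    (continuous_ouCov hH0).comp (f := fun u ↦ (u, u)) (by fun_prop)
  have hmeas : Measurable (Function.uncurry fun u ω ↦ ouProc b u ω ^ 2 - ouCov H u u) :=
    (hb.measurable_uncurry_ouProc.pow_const 2).sub (hcq.measurable.comp measurable_fst)
  obtain ⟨h1, h2⟩ := integral_sq_intervalIntegral (P := P) hmeas (K := 2 * M ^ 2) hT
    (fun u hu ↦ (hb.memLp_two_ouProc_sq hH0 hu.1.le).sub (memLp_const _))
    (fun u hu ↦ by
      simp_rw [sq (ouProc b u _ ^ 2 - ouCov H u u)]
      rw [hb.integral_centered_sq_mul hH0 hu.1.le hu.1.le]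
      linarith [hq2 u hu.1.le])
  refine ⟨h1, ?_⟩
  rw [h2]
  have h3 : ∫ u in (0 : ℝ)..T, ∫ v in (0 : ℝ)..T,
      ∫ ω, (ouProc b u ω ^ 2 - ouCov H u u) * (ouProc b v ω ^ 2 - ouCov H v v) ∂P
      = 2 * ∫ u in (0 : ℝ)..T, ∫ v in (0 : ℝ)..T, ouCov H u v ^ 2 := by
    rw [← intervalIntegral.integral_const_mul]
    refine intervalIntegral.integral_congr fun u hu ↦ ?_
    simp only [← intervalIntegral.integral_const_mul]
    refine intervalIntegral.integral_congr fun v hv ↦ ?_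
    rw [uIcc_of_le hT] at hu hv
    exact hb.integral_centered_sq_mul hH0 hu.1 hv.1
  have h4 := integral_integral_sq_ouCov_le hH hT
    (fun u v hu hv ↦ hb.ouCov_comm hH0 hu hv) hq2
  rw [h3]
  linarith

/-- The bound on the variance carries over to the covariance, as `E (Y_u - Y_v)² ≥ 0`. -/
lemma ouCov_le (hb : IsRegularFBM H b P) (hH : 0 < H) {M u v : ℝ}
    (hM : ∀ u, 0 ≤ u → ouCov H u u ≤ M) (hu : 0 ≤ u) (hv : 0 ≤ v) : ouCov H u v ≤ M := by
  have h := hb.integral_combination_sq hH hu hv 1 (-1)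
  have h0 : 0 ≤ ∫ ω, (1 * ouProc b u ω + -1 * ouProc b v ω) ^ 2 ∂P :=
    integral_nonneg fun ω ↦ sq_nonneg _
  linarith [hM u hu, hM v hv]

/-- The cross term between the initial value and the noise. -/
lemma integral_sq_exp_mul_le (hb : IsRegularFBM H b P) (hH : 0 < H)
    {M T : ℝ} (hT : 0 ≤ T) (hM : ∀ u, 0 ≤ u → ouCov H u u ≤ M) :
    MemLp (fun ω ↦ ∫ u in (0 : ℝ)..T, exp (-u) * ouProc b u ω) 2 P ∧
      ∫ ω, (∫ u in (0 : ℝ)..T, exp (-u) * ouProc b u ω) ^ 2 ∂P ≤ M * T := by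
  have := hb.gaussian.isProbabilityMeasure
  have hq0 (u : ℝ) (hu : 0 ≤ u) : 0 ≤ ouCov H u u := by
    rw [← hb.integral_ouProc_mul_ouProc hH hu hu]
    exact integral_nonneg fun ω ↦ mul_self_nonneg _
  have hM0 : 0 ≤ M := (hq0 0 le_rfl).trans (hM 0 le_rfl)
  have hcov {u v : ℝ} (hu : 0 ≤ u) (hv : 0 ≤ v) :
      ∫ ω, (exp (-u) * ouProc b u ω) * (exp (-v) * ouProc b v ω) ∂P
        = exp (-u) * exp (-v) * ouCov H u v := by
    rw [← hb.integral_ouProc_mul_ouProc hH hu hv, ← integral_const_mul]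
    congr 1; ext ω; ring
  have hmeas : Measurable (Function.uncurry fun u ω ↦ exp (-u) * ouProc b u ω) := by
    have := hb.measurable_uncurry_ouProc
    exact Measurable.mul (by fun_prop) this
  have hcc : Continuous (Function.uncurry fun u v ↦ exp (-u) * exp (-v) * ouCov H u v) := by
    have := continuous_ouCov hH
    simp only [Function.uncurry_def]
    fun_prop
  obtain ⟨h1, h2⟩ := integral_sq_intervalIntegral (P := P) hmeas (K := M) hT
    (fun u hu ↦ (hb.memLp_two_ouProc hH hu.1.le).const_mul _)
    (fun u hu ↦ by
      simp_rw [sq (exp (-u) * ouProc b u _)]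
      rw [hcov hu.1.le hu.1.le]
      have e1 : exp (-u) ≤ 1 := Real.exp_le_one_iff.2 (by linarith [hu.1])
      calc _ ≤ 1 * 1 * M := by
            have := hq0 u hu.1.le
            have := hM u hu.1.le
            gcongr
        _ = M := by ring)
  refine ⟨h1, ?_⟩
  rw [h2]
  have hin (u : ℝ) (hu : 0 ≤ u) : ∫ v in (0 : ℝ)..T, exp (-u) * exp (-v) * ouCov H u v ≤ M := by
    have hle : ∫ v in (0 : ℝ)..T, exp (-u) * exp (-v) * ouCov H u v
        ≤ ∫ v in (0 : ℝ)..T, M * exp (-v) := by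
      refine intervalIntegral.integral_mono_on hT
        ((hcc.comp (f := fun v ↦ (u, v)) (by fun_prop)).intervalIntegrable _ _)
        (Continuous.intervalIntegrable (by fun_prop) _ _) fun v hv ↦ ?_
      have e1 : exp (-u) ≤ 1 := Real.exp_le_one_iff.2 (by linarith)
      have e2 := hb.ouCov_le hH hM hu hv.1
      calc exp (-u) * exp (-v) * ouCov H u v ≤ exp (-u) * exp (-v) * M := by gcongr
        _ ≤ 1 * exp (-v) * M := by gcongr
        _ = _ := by ring
    have hval : ∫ v in (0 : ℝ)..T, M * exp (-v) = M * (1 - exp (-T)) := by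
      rw [intervalIntegral.integral_const_mul, intervalIntegral.integral_comp_neg, integral_exp]
      simp
    rw [hval] at hle
    nlinarith [exp_pos (-T)]
  calc _ = ∫ u in (0 : ℝ)..T, ∫ v in (0 : ℝ)..T, exp (-u) * exp (-v) * ouCov H u v := by
        refine intervalIntegral.integral_congr fun u hu ↦ ?_
        refine intervalIntegral.integral_congr fun v hv ↦ ?_
        rw [uIcc_of_le hT] at hu hv
        exact hcov hu.1 hv.1
    _ ≤ ∫ u in (0 : ℝ)..T, M := by
        refine intervalIntegral.integral_mono_on hT ?_ (by simp) fun u hu ↦ hin u hu.1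
        exact (intervalIntegral.continuous_parametric_intervalIntegral_of_continuous hcc
          continuous_const).intervalIntegrable _ _
    _ = M * T := by rw [intervalIntegral.integral_const]; simp [mul_comm]

end IsRegularFBM

end FracOU

/-! ### Time averages, and reduction to the normalised process -/

namespace FracOU
open Real Set Filter Topology

section TimeAverage

variable {Ω : Type*} [MeasurableSpace Ω] {P : Measure Ω} {H : ℝ} {b : ℝ → Ω → ℝ}

lemma integral_exp_neg_mul {k : ℝ} (hk : k ≠ 0) (T : ℝ) :
    ∫ u in (0 : ℝ)..T, exp (-(k * u)) = (1 - exp (-(k * T))) / k := by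
  rw [intervalIntegral.integral_comp_mul_left (f := fun u ↦ exp (-u)) hk,
    intervalIntegral.integral_comp_neg, integral_exp]
  simp [div_eq_inv_mul]

/-- The decomposition of the time integral of the squared process, started at `x`, into the
contribution of the initial value, a cross term, the fluctuations and the bias of the variance. -/
lemma IsRegularFBM.integral_sq_eq (hb : IsRegularFBM H b P) (hH : 0 < H) (x a m T : ℝ) (ω : Ω) :
    (∫ u in (0 : ℝ)..T, (exp (-u) * x + a * ouProc b u ω) ^ 2) - T * (a ^ 2 * m)
      = x ^ 2 * (∫ u in (0 : ℝ)..T, exp (-(2 * u)))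
        + 2 * x * a * (∫ u in (0 : ℝ)..T, exp (-u) * ouProc b u ω)
        + a ^ 2 * (∫ u in (0 : ℝ)..T, (ouProc b u ω ^ 2 - ouCov H u u))
        + a ^ 2 * ∫ u in (0 : ℝ)..T, (ouCov H u u - m) := by
  have hY := hb.continuous_ouProc ω
  have hq : Continuous fun u ↦ ouCov H u u :=
    (continuous_ouCov hH).comp (f := fun u ↦ (u, u)) (by fun_prop)
  have hT : T * (a ^ 2 * m) = ∫ _u in (0 : ℝ)..T, a ^ 2 * m := by
    rw [intervalIntegral.integral_const, sub_zero, smul_eq_mul]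
  rw [hT]
  simp only [← intervalIntegral.integral_const_mul]
  rw [← intervalIntegral.integral_sub, ← intervalIntegral.integral_add,
    ← intervalIntegral.integral_add, ← intervalIntegral.integral_add]
  · congr 1; ext u
    have : exp (-(2 * u)) = exp (-u) * exp (-u) := by rw [← exp_add]; ring_nf
    rw [this]; ring
  all_goals exact Continuous.intervalIntegrable (by fun_prop) _ _

lemma integral_sq_add_four_le [IsProbabilityMeasure P] {S₁ S₂ : Ω → ℝ} (h₁ : MemLp S₁ 2 P)
    (h₂ : MemLp S₂ 2 P) (p α β r : ℝ) :
    MemLp (fun ω ↦ p + α * S₁ ω + β * S₂ ω + r) 2 P ∧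
    ∫ ω, (p + α * S₁ ω + β * S₂ ω + r) ^ 2 ∂P
      ≤ 4 * (p ^ 2 + α ^ 2 * (∫ ω, S₁ ω ^ 2 ∂P) + β ^ 2 * (∫ ω, S₂ ω ^ 2 ∂P) + r ^ 2) := by
  have hS : MemLp (fun ω ↦ p + α * S₁ ω + β * S₂ ω + r) 2 P :=
    (((memLp_const p).add (h₁.const_mul α)).add (h₂.const_mul β)).add (memLp_const r)
  refine ⟨hS, ?_⟩
  have i1 := h₁.integrable_sq.const_mul (4 * α ^ 2)
  have i2 := h₂.integrable_sq.const_mul (4 * β ^ 2)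
  have i0 : Integrable (fun _ : Ω ↦ 4 * (p ^ 2 + r ^ 2)) P := integrable_const _
  calc _ ≤ ∫ ω, (4 * (p ^ 2 + r ^ 2) + 4 * α ^ 2 * S₁ ω ^ 2 + 4 * β ^ 2 * S₂ ω ^ 2) ∂P := by
        refine integral_mono hS.integrable_sq ((i0.add i1).add i2) fun ω ↦ ?_
        have key (w y z r : ℝ) : (w + y + z + r) ^ 2 ≤ 4 * (w ^ 2 + y ^ 2 + z ^ 2 + r ^ 2) := by
          nlinarith [sq_nonneg (w - y), sq_nonneg (w - z), sq_nonneg (w - r), sq_nonneg (y - z),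
            sq_nonneg (y - r), sq_nonneg (z - r)]
        refine (key p (α * S₁ ω) (β * S₂ ω) r).trans_eq ?_
        ring
    _ = _ := by
        rw [integral_add (by exact i0.add i1) i2, integral_add i0 i1,
          integral_const_mul (4 * α ^ 2), integral_const_mul (4 * β ^ 2), integral_const,
          probReal_univ, one_smul]
        ring

/-- The mean square ergodic rate for the normalised equation with noise amplitude `a`, started
at `x`. -/
lemma IsRegularFBM.integral_sq_timeAvg_le (hb : IsRegularFBM H b P)
    (hH : H ∈ Ioc (1 / 4 : ℝ) (1 / 2)) {M m c : ℝ}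
    (hM : ∀ u, 0 ≤ u → ouCov H u u ≤ M)
    (hm : ∀ u, 0 ≤ u → |ouCov H u u - m| ≤ c * exp (-(u / 2))) (x a : ℝ) {T : ℝ} (hT : 0 < T) :
    MemLp (fun ω ↦ 1 / T * (∫ u in (0 : ℝ)..T, (exp (-u) * x + a * ouProc b u ω) ^ 2)
      - a ^ 2 * m) 2 P ∧
    ∫ ω, (1 / T * (∫ u in (0 : ℝ)..T, (exp (-u) * x + a * ouProc b u ω) ^ 2) - a ^ 2 * m) ^ 2 ∂P
      ≤ 4 * (x ^ 4 / T ^ 2 + 4 * M * (a ^ 2 * x ^ 2) / T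
        + (4 * (M ^ 2 + 4 / (4 * H - 1)) + 2 * c ^ 2) * a ^ 4 / T) := by
  have hH0 : 0 < H := by linarith [hH.1]
  have := hb.gaussian.isProbabilityMeasure
  obtain ⟨l1, s1⟩ := hb.integral_sq_exp_mul_le hH0 hT.le hM
  obtain ⟨l2, s2⟩ := hb.integral_sq_centered_le hH hT.le hM
  set S1 := fun ω ↦ ∫ u in (0 : ℝ)..T, exp (-u) * ouProc b u ω
  set S2 := fun ω ↦ ∫ u in (0 : ℝ)..T, (ouProc b u ω ^ 2 - ouCov H u u)
  set D1 := ∫ u in (0 : ℝ)..T, exp (-(2 * u)) with hD1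
  set D2 := ∫ u in (0 : ℝ)..T, (ouCov H u u - m) with hD2
  have e (ω : Ω) : 1 / T * (∫ u in (0 : ℝ)..T, (exp (-u) * x + a * ouProc b u ω) ^ 2) - a ^ 2 * m
      = x ^ 2 * D1 / T + 2 * x * a / T * S1 ω + a ^ 2 / T * S2 ω + a ^ 2 * D2 / T := by
    have h := hb.integral_sq_eq hH0 x a m T ω
    have hT' : 1 / T * T = 1 := one_div_mul_cancel hT.ne'
    linear_combination 1 / T * h + a ^ 2 * m * hT'
  have hD1le : D1 ^ 2 ≤ 1 := by
    rw [hD1, integral_exp_neg_mul two_ne_zero]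
    have h1 := exp_pos (-(2 * T))
    have h2 : exp (-(2 * T)) ≤ 1 := Real.exp_le_one_iff.2 (by linarith)
    nlinarith
  have hD2le : D2 ^ 2 ≤ 2 * c ^ 2 * T := by
    have hq : Continuous fun u ↦ ouCov H u u :=
      (continuous_ouCov hH0).comp (f := fun u ↦ (u, u)) (by fun_prop)
    have h1 : |D2| ≤ c * (2 * (1 - exp (-(T / 2)))) := by
      calc |D2| ≤ ∫ u in (0 : ℝ)..T, c * exp (-(1 / 2 * u)) := by
            refine (intervalIntegral.abs_integral_le_integral_abs hT.le).trans ?_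
            refine intervalIntegral.integral_mono_on hT.le
              (Continuous.intervalIntegrable (by fun_prop) _ _)
              (Continuous.intervalIntegrable (by fun_prop) _ _) fun u hu ↦ ?_
            have := hm u hu.1
            rwa [show u / 2 = 1 / 2 * u by ring] at this
        _ = _ := by
            rw [intervalIntegral.integral_const_mul, integral_exp_neg_mul (by norm_num)]
            rw [show 1 / 2 * T = T / 2 by ring]; ring
    have h2 : 1 - exp (-(T / 2)) ≤ T / 2 := by linarith [Real.add_one_le_exp (-(T / 2))]
    have h3 : exp (-(T / 2)) ≤ 1 := Real.exp_le_one_iff.2 (by linarith)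
    have h4 := exp_pos (-(T / 2))
    calc D2 ^ 2 = |D2| ^ 2 := (sq_abs _).symm
      _ ≤ (c * (2 * (1 - exp (-(T / 2))))) ^ 2 := by gcongr
      _ = 4 * c ^ 2 * ((1 - exp (-(T / 2))) * (1 - exp (-(T / 2)))) := by ring
      _ ≤ 4 * c ^ 2 * (1 * (T / 2)) := by gcongr; linarith
      _ = _ := by ring
  obtain ⟨hS, hle⟩ := integral_sq_add_four_le l1 l2 (x ^ 2 * D1 / T) (2 * x * a / T) (a ^ 2 / T)
    (a ^ 2 * D2 / T)
  simp_rw [e]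
  refine ⟨hS, hle.trans ?_⟩
  calc _ ≤ 4 * (x ^ 4 * 1 / T ^ 2 + (2 * x * a / T) ^ 2 * (M * T)
          + (a ^ 2 / T) ^ 2 * (4 * (M ^ 2 + 4 / (4 * H - 1)) * T)
          + a ^ 4 * (2 * c ^ 2 * T) / T ^ 2) := by
        have e1 : (x ^ 2 * D1 / T) ^ 2 = x ^ 4 * D1 ^ 2 / T ^ 2 := by ring
        have e2 : (a ^ 2 * D2 / T) ^ 2 = a ^ 4 * D2 ^ 2 / T ^ 2 := by ring
        rw [e1, e2]
        gcongr
    _ = _ := by field_simp; ring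

end TimeAverage

/-- A process with almost surely continuous paths started at zero agrees almost surely with one
that has measurable coordinates and only continuous paths started at zero. -/
lemma exists_measurable_continuous_version {Ω : Type*} [MeasurableSpace Ω] {P : Measure Ω}
    {Z : ℝ → Ω → ℝ} (hm : ∀ t, AEMeasurable (Z t) P) (hc : ∀ᵐ ω ∂P, Continuous fun t ↦ Z t ω)
    (h0 : ∀ᵐ ω ∂P, Z 0 ω = 0) :
    ∃ b : ℝ → Ω → ℝ, (∀ t, Measurable (b t)) ∧ (∀ ω, Continuous fun t ↦ b t ω) ∧
      (∀ ω, b 0 ω = 0) ∧ ∀ᵐ ω ∂P, ∀ t, b t ω = Z t ω := by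
  have hS : ∀ᵐ ω ∂P, (Continuous fun t ↦ Z t ω) ∧ Z 0 ω = 0 ∧
      ∀ q : ℚ, Z q ω = (hm q).mk (Z q) ω := by
    filter_upwards [hc, h0, ae_all_iff.2 fun q : ℚ ↦ (hm q).ae_eq_mk] with ω h1 h2 h3
      using ⟨h1, h2, h3⟩
  obtain ⟨S, hSae, hSm, hS⟩ := hS.exists_measurable_mem
  refine ⟨fun t ↦ S.indicator (Z t), fun t ↦ ?_, fun ω ↦ ?_, fun ω ↦ ?_, ?_⟩
  · obtain ⟨x, hx, hxt⟩ := mem_closure_iff_seq_limit.1 (Rat.denseRange_cast (𝕜 := ℝ) t)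
    choose q hq using hx
    refine measurable_of_tendsto_metrizable
      (f := fun n ↦ S.indicator ((hm (q n)).mk (Z (q n))))
      (fun n ↦ (hm (q n)).measurable_mk.indicator hSm) (tendsto_pi_nhds.2 fun ω ↦ ?_)
    by_cases hω : ω ∈ S
    · simp only [indicator_of_mem hω, ← (hS ω hω).2.2]
      refine (((hS ω hω).1.tendsto t).comp hxt).congr fun n ↦ ?_
      simp [hq]
    · simp [indicator_of_notMem hω]
  · by_cases hω : ω ∈ S
    · simpa only [indicator_of_mem hω] using (hS ω hω).1
    · simpa only [indicator_of_notMem hω] using continuous_const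
  · by_cases hω : ω ∈ S
    · simpa only [indicator_of_mem hω] using (hS ω hω).2.1
    · simp [indicator_of_notMem hω]
  · filter_upwards [hSae] with ω hω t
    simp [indicator_of_mem hω]

section Scaling

variable {Ω : Type*} [MeasurableSpace Ω] {P : Measure Ω} [IsProbabilityMeasure P]
  {H lam sig x₀ : ℝ} {B X : ℝ≥0 → Ω → ℝ}

lemma IsFractionalBrownian.integral_mul (hB : IsFractionalBrownian H B P) (s t : ℝ≥0) :
    ∫ ω, B s ω * B t ω ∂P = fbmCov H s t := by
  have hs : MemLp (B s) 2 P := (hB.gaussian.hasGaussianLaw_eval s).memLp_two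
  have ht : MemLp (B t) 2 P := (hB.gaussian.hasGaussianLaw_eval t).memLp_two
  have h := hB.covariance s t
  rw [covariance_eq_sub hs ht, hB.centered, zero_mul, sub_zero] at h
  simp only [Pi.mul_apply] at h
  rw [h, fbmCov, NNReal.abs_eq, NNReal.abs_eq]

lemma IsFractionalBrownian.ae_zero (hB : IsFractionalBrownian H B P) (hH : 0 < H) :
    ∀ᵐ ω ∂P, B 0 ω = 0 := by
  have h := hB.integral_mul 0 0
  have h2 : MemLp (B 0) 2 P := (hB.gaussian.hasGaussianLaw_eval 0).memLp_two
  rw [fbmCov, NNReal.coe_zero, sub_self, abs_zero, zero_rpow (by positivity)] at h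
  rw [add_zero, sub_zero, zero_div] at h
  have := (integral_eq_zero_iff_of_nonneg (fun ω ↦ mul_self_nonneg (B 0 ω))
    (h2.integrable_mul h2)).1 h
  filter_upwards [this] with ω hω
  simpa using hω

/-- Self-similarity: `u ↦ lam ^ H * B (u / lam)` is again a fractional Brownian motion. -/
lemma IsFractionalBrownian.exists_isRegularFBM (hB : IsFractionalBrownian H B P) (hH : 0 < H)
    (hlam : 0 < lam) :
    ∃ b, IsRegularFBM H b P ∧ ∀ᵐ ω ∂P, ∀ u, b u ω = lam ^ H * B (u / lam).toNNReal ω := by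
  have hg : IsGaussianProcess (fun u ω ↦ lam ^ H * B (u / lam).toNNReal ω) P :=
    (hB.gaussian.comp_right fun u : ℝ ↦ (u / lam).toNNReal).smul fun _ ↦ lam ^ H
  have hc : ∀ᵐ ω ∂P, Continuous fun u : ℝ ↦ lam ^ H * B (u / lam).toNNReal ω := by
    filter_upwards [hB.cont] with ω hω
    have : Continuous fun u : ℝ ↦ (u / lam).toNNReal :=
      continuous_real_toNNReal.comp (continuous_id.div_const _)
    exact (hω.comp this).const_mul _
  have h0 : ∀ᵐ ω ∂P, lam ^ H * B (0 / lam).toNNReal ω = 0 := by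
    filter_upwards [hB.ae_zero hH] with ω hω
    simp [hω]
  obtain ⟨b, hbm, hbc, hb0, hbB⟩ :=
    exists_measurable_continuous_version (fun t ↦ hg.aemeasurable t) hc h0
  refine ⟨b, ⟨hg.congr fun t ↦ ?_, fun t ↦ ?_, fun s t hs ht ↦ ?_, hbm, hbc, hb0⟩, hbB⟩
  · filter_upwards [hbB] with ω hω using (hω t).symm
  · rw [integral_congr_ae (g := fun ω ↦ lam ^ H * B (t / lam).toNNReal ω)
      (by filter_upwards [hbB] with ω hω using hω t), integral_const_mul, hB.centered, mul_zero]
  · have e : ∀ᵐ ω ∂P, b s ω * b t ω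
        = lam ^ (2 * H) * (B (s / lam).toNNReal ω * B (t / lam).toNNReal ω) := by
      filter_upwards [hbB] with ω hω
      rw [hω, hω, two_mul, Real.rpow_add hlam]; ring
    have hsl : 0 ≤ s / lam := by positivity
    have htl : 0 ≤ t / lam := by positivity
    rw [integral_congr_ae e, integral_const_mul, hB.integral_mul, fbmCov, fbmCov,
      Real.coe_toNNReal _ hsl, Real.coe_toNNReal _ htl, ← sub_div]
    simp only [abs_div, abs_of_pos hlam]
    rw [Real.div_rpow (abs_nonneg _) hlam.le, Real.div_rpow (abs_nonneg _) hlam.le,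
      Real.div_rpow (abs_nonneg _) hlam.le]
    have : lam ^ (2 * H) ≠ 0 := by positivity
    field_simp

lemma ouMap_const_mul (c : ℝ) (φ : ℝ → ℝ) (t : ℝ) :
    ouMap (fun s ↦ c * φ s) t = c * ouMap φ t := by
  rw [ouMap, ouMap, mul_sub, ← intervalIntegral.integral_const_mul]
  congr 2; ext s; ring

/-- Every solution is, after rescaling time by `lam` and space by `sig / lam ^ H`, the normalised
process plus the exponentially damped initial value. -/
lemma IsOUSolution.exists_eq_ouProc (hX : IsOUSolution lam sig x₀ B X P)
    (hB : IsFractionalBrownian H B P) (hH : 0 < H) (hlam : 0 < lam) :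
    ∃ b, IsRegularFBM H b P ∧ ∀ᵐ ω ∂P, ∀ t : ℝ≥0,
      X t ω = exp (-(lam * t)) * x₀ + sig / lam ^ H * ouProc b (lam * t) ω := by
  obtain ⟨b, hb, hbB⟩ := hB.exists_isRegularFBM hH hlam
  refine ⟨b, hb, ?_⟩
  filter_upwards [hbB, hB.ae_zero hH, hX.cont, hX.eqn] with ω h1 h2 h3 h4 t
  have hbc := hb.continuous ω
  have hfc : Continuous fun u : ℝ ↦ X (u / lam).toNNReal ω :=
    h3.comp (continuous_real_toNNReal.comp (continuous_id.div_const _))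
  have hpow : lam ^ H ≠ 0 := by positivity
  have key := eq_ouMap_of_integral_eq (f := fun u : ℝ ↦ X (u / lam).toNNReal ω)
    (φ := fun u ↦ x₀ + sig / lam ^ H * b u ω) hfc (by fun_prop) (fun u hu ↦ ?_)
    (t := lam * t) (by positivity)
  · rw [ouMap_add continuous_const (by fun_prop), ouMap_const, ouMap_const_mul] at key
    rw [mul_div_cancel_left₀ _ hlam.ne', Real.toNNReal_coe] at key
    exact key
  · have hul : 0 ≤ u / lam := by positivity
    have hint := intervalIntegral.integral_comp_div (a := 0) (b := u)
      (fun s : ℝ ↦ X s.toNNReal ω) hlam.ne'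
    rw [zero_div, smul_eq_mul] at hint
    rw [h4, h2, h1, hint, Real.coe_toNNReal _ hul]
    field_simp
    ring

end Scaling

end FracOU

/-! ### The maximal inequality, and comparison with the stated bounds -/

namespace FracOU
open Real Set Filter Topology

lemma limitVar_eq {H lam : ℝ} (sig : ℝ) (hH : 0 < H) (hlam : 0 < lam) :
    limitVar H lam sig = (sig / lam ^ H) ^ 2 * (Gamma (2 * H + 1) / 2) := by
  have h := Real.integral_rpow_mul_exp_neg_mul_Ioi (a := 2 * H + 1) (r := lam) (by positivity) hlam
  have e : ∫ s in Ioi (0 : ℝ), exp (-lam * s) * s ^ (2 * H)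
      = (1 / lam) ^ (2 * H + 1) * Gamma (2 * H + 1) := by
    rw [← h]
    congr 1; ext s
    rw [add_sub_cancel_right, mul_comm, neg_mul]
  rw [limitVar, e, Real.div_rpow zero_le_one hlam.le, Real.one_rpow, Real.rpow_add hlam,
    Real.rpow_one, div_pow, two_mul H, Real.rpow_add hlam]
  have : lam ^ H ≠ 0 := by positivity
  field_simp

lemma sq_div_rpow {H lam sig : ℝ} (hlam : 0 < lam) :
    sig ^ 2 / lam ^ (2 * H) = (sig / lam ^ H) ^ 2 := by
  rw [div_pow, two_mul, Real.rpow_add hlam, sq (lam ^ H)]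

/-- The variance formula in the original variables. -/
lemma sq_mul_ouCov_self {H lam t : ℝ} (sig : ℝ) (hH : 0 < H) (hlam : 0 < lam) (ht : 0 ≤ t) :
    (sig / lam ^ H) ^ 2 * ouCov H (lam * t) (lam * t) = sig ^ 2 * H *
      ((∫ z in (0 : ℝ)..t, exp (-lam * z) * |z| ^ (2 * H - 1))
        + exp (-lam * t) * ∫ z in (0 : ℝ)..t, exp (-lam * (t - z)) * |z| ^ (2 * H - 1)) := by
  have hp : lam ^ (2 * H - 1) * lam = lam ^ (2 * H) := by
    rw [Real.rpow_sub_one hlam.ne']; field_simp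
  have e1 : ∫ z in (0 : ℝ)..lam * t, exp (-z) * |z| ^ (2 * H - 1)
      = lam ^ (2 * H) * ∫ z in (0 : ℝ)..t, exp (-lam * z) * |z| ^ (2 * H - 1) := by
    have h := intervalIntegral.mul_integral_comp_mul_left (a := 0) (b := t) (c := lam)
      (f := fun z ↦ exp (-z) * |z| ^ (2 * H - 1))
    rw [mul_zero] at h
    rw [← h, ← hp, mul_comm _ lam, mul_assoc lam, ← intervalIntegral.integral_const_mul (lam ^ _)]
    congr 2; ext z
    rw [abs_mul, abs_of_pos hlam, Real.mul_rpow hlam.le (abs_nonneg _), neg_mul]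
    ring
  have e2 : ∫ z in (0 : ℝ)..lam * t, exp (-(lam * t - z)) * |z| ^ (2 * H - 1)
      = lam ^ (2 * H) * ∫ z in (0 : ℝ)..t, exp (-lam * (t - z)) * |z| ^ (2 * H - 1) := by
    have h := intervalIntegral.mul_integral_comp_mul_left (a := 0) (b := t) (c := lam)
      (f := fun z ↦ exp (-(lam * t - z)) * |z| ^ (2 * H - 1))
    rw [mul_zero] at h
    rw [← h, ← hp, mul_comm _ lam, mul_assoc lam, ← intervalIntegral.integral_const_mul (lam ^ _)]
    congr 2; ext z
    rw [abs_mul, abs_of_pos hlam, Real.mul_rpow hlam.le (abs_nonneg _),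
      show -(lam * t - lam * z) = -lam * (t - z) by ring]
    ring
  rw [ouCov_self_eq_integral hH (by positivity), e1, e2, ← sq_div_rpow hlam, neg_mul]
  have : lam ^ (2 * H) ≠ 0 := by positivity
  field_simp

lemma entropyInt_nonneg (H : ℝ) {a : ℝ} (ha : 0 ≤ a) : 0 ≤ entropyInt H a :=
  intervalIntegral.integral_nonneg ha fun x hx ↦ by
    have := Real.rpow_nonneg hx.1 (-(1 / H))
    exact Real.rpow_nonneg (Real.log_nonneg (by linarith)) _

/-- The bound for the supremum that chaining produces is dominated by `supBound`. The argument of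
the logarithm in `supBound` carries an additional factor `(sig / lam ^ H) ^ (1 / H)`; where this
factor is small, the term `sig / lam ^ H` compensates for it. -/
lemma sq_add_mul_log_le_supBound {H lam sig T : ℝ} (x₀ : ℝ) (hH : 1 / 4 < H) (hlam : 0 < lam)
    (hsig : 0 < sig) (hT : 0 ≤ T) :
    x₀ ^ 2 + (sig / lam ^ H) ^ 2 * (1 + log (1 + lam * T)) ≤ 8 * supBound H lam sig x₀ T := by
  have hH0 : 0 < H := by linarith
  set a := sig / lam ^ H with ha
  have ha0 : 0 < a := by positivity
  set L := log (exp 1 + T * sig ^ (1 / H) * max (lam ^ ((1 - H) / H)) 1) with hL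
  have haH : lam * a ^ (1 / H) = sig ^ (1 / H) := by
    rw [ha, Real.div_rpow hsig.le (by positivity), ← Real.rpow_mul hlam.le,
      mul_one_div_cancel hH0.ne', Real.rpow_one]
    field_simp
  have he : 2 ≤ exp 1 := by linarith [Real.exp_one_gt_d9]
  have hτ : 0 ≤ lam * T := by positivity
  have hLge : log (exp 1 + lam * T * a ^ (1 / H)) ≤ L := by
    refine Real.log_le_log (by positivity) ?_
    have e : lam * T * a ^ (1 / H) = T * sig ^ (1 / H) * 1 := by rw [← haH]; ring
    rw [e]
    gcongr
    exact le_max_right _ _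
  have hlog1 : 1 ≤ log (exp 1 + lam * T) := by
    rw [Real.le_log_iff_exp_le (by positivity)]; linarith
  have hlog2 : log (1 + lam * T) ≤ log (exp 1 + lam * T) :=
    Real.log_le_log (by positivity) (by linarith)
  have hmain : a ^ 2 * log (exp 1 + lam * T) ≤ a ^ 2 * L + 4 * a := by
    rcases le_total 1 a with h | h
    · have h1 : 1 ≤ a ^ (1 / H) := Real.one_le_rpow h (by positivity)
      have h2 : log (exp 1 + lam * T) ≤ L := by
        refine le_trans (Real.log_le_log (by positivity) ?_) hLge
        nlinarith
      have := mul_le_mul_of_nonneg_left h2 (sq_nonneg a)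
      linarith
    · have h1 : a ^ (1 / H) ≤ 1 := Real.rpow_le_one ha0.le h (by positivity)
      have h2 : log a + H * log (exp 1 + lam * T) ≤ H * L := by
        have h3 : (exp 1 + lam * T) * a ^ (1 / H) ≤ exp 1 + lam * T * a ^ (1 / H) := by
          nlinarith
        have h4 := (Real.log_le_log (by positivity) h3).trans hLge
        rw [Real.log_mul (by positivity) (by positivity), Real.log_rpow ha0] at h4
        have h5 := mul_le_mul_of_nonneg_left h4 hH0.le
        have h6 : H * (1 / H * log a) = log a := by field_simp
        linarith
      have h7 : -log a ≤ 1 / a := by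
        rw [← Real.log_inv, ← one_div]
        exact (Real.log_le_sub_one_of_pos (by positivity)).trans (by linarith)
      have h8 : H * (log (exp 1 + lam * T) - L) ≤ 1 / a := by linarith
      have h9 : a ^ 2 * (H * (log (exp 1 + lam * T) - L)) ≤ a := by
        calc _ ≤ a ^ 2 * (1 / a) := by gcongr
          _ = a := by field_simp
      by_contra! hcon
      have h10 : 4 * a < a ^ 2 * (log (exp 1 + lam * T) - L) := by linarith
      nlinarith
  have hI := entropyInt_nonneg H ha0.le
  have hL0 : 0 ≤ L := by
    refine Real.log_nonneg ?_
    have : 0 ≤ T * sig ^ (1 / H) * max (lam ^ ((1 - H) / H)) 1 := by positivity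
    linarith
  have hS : x₀ ^ 2 + a ^ 2 * L + a ≤ supBound H lam sig x₀ T := by
    rw [supBound, sq_div_rpow hlam, ← ha, ← hL]
    nlinarith [sq_nonneg (entropyInt H a), mul_nonneg ha0.le hI]
  have h1 : a ^ 2 * (1 + log (1 + lam * T)) ≤ 2 * (a ^ 2 * log (exp 1 + lam * T)) := by
    have := mul_le_mul_of_nonneg_left (add_le_add hlog1 hlog2) (sq_nonneg a)
    linarith
  have h2 : 0 ≤ a ^ 2 * L := by positivity
  nlinarith [sq_nonneg x₀]

section Supremum

variable {Ω : Type*} [MeasurableSpace Ω] {P : Measure Ω}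

/-- The supremum of a continuous random function over a compact interval is measurable. -/
lemma measurable_biSup_Icc {Z : ℝ≥0 → Ω → ℝ≥0∞} (hm : ∀ t, Measurable (Z t))
    (hc : ∀ ω, Continuous fun t ↦ Z t ω) (T : ℝ≥0) :
    Measurable fun ω ↦ ⨆ t ∈ Icc 0 T, Z t ω := by
  have : Nonempty (Icc 0 T) := ⟨⟨0, by simp⟩⟩
  have e : (fun ω ↦ ⨆ t ∈ Icc 0 T, Z t ω)
      = fun ω ↦ ⨆ n, Z (TopologicalSpace.denseSeq (Icc 0 T) n : Icc 0 T) ω := by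
    ext ω
    rw [iSup_subtype']
    refine le_antisymm (iSup_le fun t ↦ ?_) (iSup_le fun n ↦ le_iSup (fun t : Icc 0 T ↦ Z t ω) _)
    refine (TopologicalSpace.denseRange_denseSeq (Icc 0 T)).induction_on
      (p := fun t ↦ Z t ω ≤ ⨆ n, Z (TopologicalSpace.denseSeq (Icc 0 T) n : Icc 0 T) ω) t ?_
      fun n ↦ le_iSup (fun n ↦ Z (TopologicalSpace.denseSeq (Icc 0 T) n : Icc 0 T) ω) n
    exact isClosed_le ((hc ω).comp continuous_subtype_val) continuous_const
  rw [e]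
  exact Measurable.iSup fun n ↦ hm _

/-- The constant in the maximal inequality of the normalised process. -/
noncomputable def supConst (H : ℝ) : ℝ :=
  32 * (1 - (2 : ℝ) ^ (-H))⁻¹ * ∑' n : ℕ, 4 * ((2 : ℝ) ^ (-H)) ^ n * (n + 2)

lemma supConst_nonneg {H : ℝ} (hH : 0 < H) : 0 ≤ supConst H := by
  have : 0 < 1 - (2 : ℝ) ^ (-H) := by linarith [(two_rpow_neg_mem_Ioo hH).2]
  have h : 0 ≤ ∑' n : ℕ, 4 * ((2 : ℝ) ^ (-H)) ^ n * (n + 2) := tsum_nonneg fun n ↦ by positivity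
  unfold supConst
  positivity

lemma IsRegularFBM.lintegral_biSup_le {H : ℝ} {b : ℝ → Ω → ℝ} (hb : IsRegularFBM H b P)
    (hH : 0 < H) {lam : ℝ} (hlam : 0 < lam) (x a : ℝ) (T : ℝ≥0) :
    ∫⁻ ω, ⨆ t ∈ Icc 0 T, ENNReal.ofReal
        ((exp (-(lam * t)) * x + a * ouProc b (lam * t) ω) ^ 2) ∂P
      ≤ ENNReal.ofReal (2 * x ^ 2 + a ^ 2 * (supConst H * (1 + log (1 + lam * T)))) := by
  have := hb.gaussian.isProbabilityMeasure
  set N := ⌊lam * T⌋₊ + 1 with hN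
  have hτ : 0 ≤ lam * T := by positivity
  have hNle : log N ≤ log (1 + lam * T) := by
    refine Real.log_le_log (by positivity) ?_
    rw [hN]; push_cast
    linarith [Nat.floor_le hτ]
  set W := (1 - (2 : ℝ) ^ (-H))⁻¹ with hW
  have hW0 : 0 ≤ W := by
    have : 0 < 1 - (2 : ℝ) ^ (-H) := by linarith [(two_rpow_neg_mem_Ioo hH).2]
    positivity
  set c := ∑' n : ℕ, 4 * ((2 : ℝ) ^ (-H)) ^ n * (n + 2) with hc
  have hc0 : 0 ≤ c := tsum_nonneg fun n ↦ by positivity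
  have hpt (ω : Ω) : ⨆ t ∈ Icc 0 T, ENNReal.ofReal
        ((exp (-(lam * t)) * x + a * ouProc b (lam * t) ω) ^ 2)
      ≤ ENNReal.ofReal (2 * x ^ 2)
        + ENNReal.ofReal (2 * a ^ 2) * (ENNReal.ofReal (16 * W) * chainEnvelope H b N ω) := by
    refine iSup₂_le fun t ht ↦ ?_
    have ht0 : 0 ≤ lam * t := by positivity
    have htT : (lam * t : ℝ) ≤ lam * T := by
      have : (t : ℝ) ≤ T := ht.2
      gcongr
    have htN : (lam * t : ℝ) < N := by
      rw [hN]; push_cast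
      exact htT.trans_lt (Nat.lt_floor_add_one _)
    have h1 := hb.ofReal_ouProc_sq_le hH ω ht0 htN
    have h2 : (exp (-(lam * t)) * x + a * ouProc b (lam * t) ω) ^ 2
        ≤ 2 * x ^ 2 + 2 * a ^ 2 * ouProc b (lam * t) ω ^ 2 := by
      have e1 : exp (-(lam * t)) ≤ 1 := Real.exp_le_one_iff.2 (by linarith)
      have e0 := exp_pos (-(lam * t))
      have e2 : exp (-(lam * t)) ^ 2 ≤ 1 := pow_le_one₀ e0.le e1
      nlinarith [sq_nonneg (exp (-(lam * t)) * x - a * ouProc b (lam * t) ω), sq_nonneg x]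
    calc _ ≤ ENNReal.ofReal (2 * x ^ 2 + 2 * a ^ 2 * ouProc b (lam * t) ω ^ 2) :=
          ENNReal.ofReal_le_ofReal h2
      _ = ENNReal.ofReal (2 * x ^ 2)
          + ENNReal.ofReal (2 * a ^ 2) * ENNReal.ofReal (ouProc b (lam * t) ω ^ 2) := by
          rw [ENNReal.ofReal_add (by positivity) (by positivity), 
            ENNReal.ofReal_mul (show (0 : ℝ) ≤ 2 * a ^ 2 by positivity)]
      _ ≤ _ := by gcongr
  have hm := hb.measurable_chainEnvelope N
  calc _ ≤ ∫⁻ ω, (ENNReal.ofReal (2 * x ^ 2)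
        + ENNReal.ofReal (2 * a ^ 2) * (ENNReal.ofReal (16 * W) * chainEnvelope H b N ω)) ∂P :=
        lintegral_mono hpt
    _ = ENNReal.ofReal (2 * x ^ 2) + ENNReal.ofReal (2 * a ^ 2)
          * (ENNReal.ofReal (16 * W) * ∫⁻ ω, chainEnvelope H b N ω ∂P) := by
        rw [lintegral_add_left measurable_const, lintegral_const, measure_univ, mul_one,
          lintegral_const_mul _ (hm.const_mul _), lintegral_const_mul _ hm]
    _ ≤ ENNReal.ofReal (2 * x ^ 2) + ENNReal.ofReal (2 * a ^ 2)
          * (ENNReal.ofReal (16 * W) * ENNReal.ofReal (c * (1 + log N))) := by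
        gcongr
        exact hb.lintegral_chainEnvelope_le hH (Nat.succ_pos _)
    _ ≤ _ := by
        have hlN : 0 ≤ log N := Real.log_natCast_nonneg N
        rw [← ENNReal.ofReal_mul (by positivity), ← ENNReal.ofReal_mul (by positivity),
          ← ENNReal.ofReal_add (by positivity) (by positivity)]
        refine ENNReal.ofReal_le_ofReal ?_
        have h3 : c * (1 + log N) ≤ c * (1 + log (1 + lam * T)) := by gcongr
        have h4 := mul_le_mul_of_nonneg_left h3 (by positivity : 0 ≤ 2 * a ^ 2 * (16 * W))
        rw [supConst, ← hW, ← hc]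
        linarith

end Supremum

/-- The first two terms of `ergodicBound` alone. -/
lemma le_ergodicBound {H lam sig t : ℝ} (x₀ : ℝ) (hH : 0 < H) (hlam : 0 < lam) (ht : 0 < t) :
    x₀ ^ 4 / (lam * t) ^ 2 + (sig / lam ^ H) ^ 2 * (Gamma (2 * H + 1) / 2)
        * ((sig / lam ^ H) ^ 2 + x₀ ^ 2) / (lam * t)
      ≤ ergodicBound H lam sig x₀ t := by
  have hG : 0 < Gamma (2 * H + 1) := Real.Gamma_pos_of_pos (by linarith)
  have hv : 0 ≤ limitVar H lam sig := by rw [limitVar_eq sig hH hlam]; positivity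
  have h3 : 0 ≤ 1 / (lam * t ^ 2)
      * (limitVar H lam sig * t + sig ^ 2 + sig ^ 2 / lam ^ (2 * H + 1)) := by positivity
  have h4 : 0 ≤ 1 / (lam ^ 2 * t ^ 2) * (sig ^ 2 + sig ^ 2 / lam ^ (2 * H)) ^ 2 := by positivity
  have h5 : 0 ≤ limitVar H lam sig / (lam * t) * (sig ^ 2 + sig ^ 2 / lam ^ (2 * H)) := by
    positivity
  have h6 : 0 ≤ sig ^ 4 / (lam ^ (4 * H + 1) * t) := by positivity
  have h1 : limitVar H lam sig / (lam * t) * (sig ^ 2 / lam ^ (2 * H) + x₀ ^ 2)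
      = (sig / lam ^ H) ^ 2 * (Gamma (2 * H + 1) / 2)
        * ((sig / lam ^ H) ^ 2 + x₀ ^ 2) / (lam * t) := by
    rw [limitVar_eq sig hH hlam, sq_div_rpow hlam]; ring
  have h2 : 1 / (lam ^ 2 * t ^ 2) * x₀ ^ 4 = x₀ ^ 4 / (lam * t) ^ 2 := by
    rw [mul_pow]; ring
  rw [ergodicBound, h1, h2]
  linarith

lemma remainderBound_nonneg {H θ lam t : ℝ} (hlam : 0 < lam) (ht : 0 < t) :
    0 ≤ remainderBound H θ lam t := by
  unfold remainderBound; positivity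

end FracOU

/-! ### Estimates for the solution -/

namespace FracOU
open Real Set Filter Topology

section Moments

variable {Ω : Type*} [MeasurableSpace Ω] {P : Measure Ω} {H : ℝ} {b : ℝ → Ω → ℝ}

lemma IsRegularFBM.integral_sq_add_ouProc (hb : IsRegularFBM H b P) (hH : 0 < H) (y a : ℝ)
    {u : ℝ} (hu : 0 ≤ u) :
    MemLp (fun ω ↦ y + a * ouProc b u ω) 2 P ∧
      ∫ ω, (y + a * ouProc b u ω) ^ 2 ∂P = y ^ 2 + a ^ 2 * ouCov H u u := by
  have := hb.gaussian.isProbabilityMeasure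
  have hY := hb.memLp_two_ouProc hH hu
  refine ⟨(memLp_const y).add (hY.const_mul a), ?_⟩
  have e : (fun ω ↦ (y + a * ouProc b u ω) ^ 2)
      = fun ω ↦ y ^ 2 + 2 * y * a * ouProc b u ω + a ^ 2 * (ouProc b u ω * ouProc b u ω) := by
    ext ω; ring
  have h1 : Integrable (fun ω ↦ 2 * y * a * ouProc b u ω) P :=
    (hY.integrable one_le_two).const_mul _
  have h2 : Integrable (fun ω ↦ a ^ 2 * (ouProc b u ω * ouProc b u ω)) P :=
    (hY.integrable_mul hY).const_mul _
  have h3 : Integrable (fun ω ↦ y ^ 2 + 2 * y * a * ouProc b u ω) P := (integrable_const _).add h1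
  rw [e, integral_add h3 h2, integral_add (integrable_const _) h1,
    integral_const_mul, integral_const_mul, hb.integral_ouProc hH hu,
    hb.integral_ouProc_mul_ouProc hH hu hu]
  simp

end Moments

/-- A time average of a process that runs at speed `lam`, in the time scale of the process. -/
lemma timeAvgSq_eq_of_forall {Ω : Type*} {X : ℝ≥0 → Ω → ℝ} {lam t : ℝ} {ω : Ω} {f : ℝ → ℝ}
    (hlam : 0 < lam) (ht : 0 ≤ t) (hX : ∀ s : ℝ≥0, X s ω = f (lam * s)) :
    timeAvgSq X t ω = 1 / (lam * t) * ∫ u in (0 : ℝ)..lam * t, f u ^ 2 := by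
  have h := intervalIntegral.mul_integral_comp_mul_left (a := 0) (b := t) (c := lam)
    (f := fun u ↦ f u ^ 2)
  rw [mul_zero] at h
  have e : ∫ s in (0 : ℝ)..t, X s.toNNReal ω ^ 2 = ∫ s in (0 : ℝ)..t, f (lam * s) ^ 2 := by
    refine intervalIntegral.integral_congr fun s hs ↦ ?_
    rw [uIcc_of_le ht] at hs
    rw [hX, Real.coe_toNNReal s hs.1]
  rw [timeAvgSq, e, ← h]
  field_simp

section Solution

variable {Ω : Type*} [MeasurableSpace Ω] {P : Measure Ω} [IsProbabilityMeasure P]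
  {H lam sig x₀ : ℝ} {B X : ℝ≥0 → Ω → ℝ}

lemma IsOUSolution.integral_sq (hX : IsOUSolution lam sig x₀ B X P)
    (hB : IsFractionalBrownian H B P) (hH : 0 < H) (hlam : 0 < lam) (t : ℝ≥0) :
    MemLp (X t) 2 P ∧ ∫ ω, X t ω ^ 2 ∂P = exp (-2 * lam * t) * x₀ ^ 2
      + (sig / lam ^ H) ^ 2 * ouCov H (lam * t) (lam * t) := by
  obtain ⟨b, hb, h⟩ := hX.exists_eq_ouProc hB hH hlam
  obtain ⟨h1, h2⟩ := hb.integral_sq_add_ouProc hH (exp (-(lam * t)) * x₀) (sig / lam ^ H)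
    (u := lam * t) (by positivity)
  have ht : X t =ᵐ[P] fun ω ↦
      exp (-(lam * t)) * x₀ + sig / lam ^ H * ouProc b (lam * t) ω := h.mono fun ω hω ↦ hω t
  refine ⟨(memLp_congr_ae ht).2 h1, ?_⟩
  have hsq : (fun ω ↦ X t ω ^ 2) =ᵐ[P] _ := ht.fun_comp (· ^ 2)
  rw [integral_congr_ae hsq]
  refine h2.trans ?_
  rw [mul_pow, ← Real.exp_nat_mul]
  congr 3
  push_cast; ring

/-- Exponential convergence of the second moment to the limit variance. -/
lemma IsOUSolution.abs_integral_sq_sub_limitVar_le (hX : IsOUSolution lam sig x₀ B X P)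
    (hB : IsFractionalBrownian H B P) (hH : 0 < H) (hlam : 0 < lam) {c : ℝ}
    (hc : ∀ u, 0 ≤ u → |ouCov H u u - Gamma (2 * H + 1) / 2| ≤ c * exp (-(u / 2))) (t : ℝ≥0) :
    |(∫ ω, X t ω ^ 2 ∂P) - limitVar H lam sig| ≤ exp (-2 * lam * t) * x₀ ^ 2
      + c * (sig ^ 2 / lam ^ (2 * H) * exp (-(lam / 2) * t)) := by
  rw [(hX.integral_sq hB hH hlam t).2, limitVar_eq sig hH hlam, add_sub_assoc, ← mul_sub]
  refine (abs_add_le _ _).trans (add_le_add (abs_of_nonneg (by positivity)).le ?_)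
  rw [abs_mul, abs_of_nonneg (sq_nonneg _), sq_div_rpow hlam]
  calc _ ≤ (sig / lam ^ H) ^ 2 * (c * exp (-(lam * t / 2))) := by
        gcongr
        exact hc _ (by positivity)
    _ = _ := by rw [show -(lam / 2) * (t : ℝ) = -(lam * t / 2) by ring]; ring

/-- The maximal inequality. -/
lemma IsOUSolution.lintegral_biSup_sq_le (hX : IsOUSolution lam sig x₀ B X P)
    (hB : IsFractionalBrownian H B P) (hH : 1 / 4 < H) (hlam : 0 < lam) (hsig : 0 < sig)
    (T : ℝ≥0) :
    AEMeasurable (fun ω ↦ ⨆ t ∈ Icc 0 T, ENNReal.ofReal (X t ω ^ 2)) P ∧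
      ∫⁻ ω, ⨆ t ∈ Icc 0 T, ENNReal.ofReal (X t ω ^ 2) ∂P
        ≤ ENNReal.ofReal (8 * (2 + supConst H) * supBound H lam sig x₀ T) := by
  have hH0 : 0 < H := by linarith
  obtain ⟨b, hb, h⟩ := hX.exists_eq_ouProc hB hH0 hlam
  set a := sig / lam ^ H with ha
  have hsup : (fun ω ↦ ⨆ t ∈ Icc 0 T, ENNReal.ofReal (X t ω ^ 2)) =ᵐ[P] fun ω ↦
      ⨆ t ∈ Icc 0 T, ENNReal.ofReal
        ((exp (-(lam * t)) * x₀ + a * ouProc b (lam * t) ω) ^ 2) :=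
    h.mono fun ω hω ↦ by simp only [hω]
  refine ⟨⟨_, measurable_biSup_Icc (fun t ↦ ?_) (fun ω ↦ ?_) T, hsup⟩, ?_⟩
  · have := hb.measurable_ouProc (lam * t)
    fun_prop
  · have := hb.continuous_ouProc ω
    exact ENNReal.continuous_ofReal.comp (by fun_prop)
  · rw [lintegral_congr_ae hsup]
    refine (hb.lintegral_biSup_le hH0 hlam x₀ a T).trans (ENNReal.ofReal_le_ofReal ?_)
    have h1 := sq_add_mul_log_le_supBound x₀ hH hlam hsig T.2
    have h2 := supConst_nonneg hH0
    have h3 := mul_le_mul_of_nonneg_left h1 (by positivity : 0 ≤ 2 + supConst H)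
    have hL : 0 ≤ log (1 + lam * T) := Real.log_nonneg (by nlinarith [mul_nonneg hlam.le T.2])
    have h4 : 0 ≤ supConst H * x₀ ^ 2 := by positivity
    have h5 : 0 ≤ (sig / lam ^ H) ^ 2 * (1 + log (1 + lam * T)) := by positivity
    rw [NNReal.val_eq_coe, ← ha] at h3
    rw [← ha] at h5
    have h6 := mul_nonneg h2 h5
    nlinarith [sq_nonneg x₀, h3, h4, h5]

/-- The rate of mean square convergence of the time averages. The right-hand side of
`IsRegularFBM.integral_sq_timeAvg_le` is already dominated by `ergodicBound`. -/
lemma IsOUSolution.integral_sq_timeAvgSq_sub_le (hX : IsOUSolution lam sig x₀ B X P)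
    (hB : IsFractionalBrownian H B P) (hH : H ∈ Ioc (1 / 4 : ℝ) (1 / 2)) (hlam : 0 < lam)
    {M m c : ℝ} (hM : ∀ u, 0 ≤ u → ouCov H u u ≤ M) (hM0 : 0 ≤ M)
    (hm : m = Gamma (2 * H + 1) / 2)
    (hc : ∀ u, 0 ≤ u → |ouCov H u u - Gamma (2 * H + 1) / 2| ≤ c * exp (-(u / 2)))
    {t : ℝ} (ht : 0 < t) :
    MemLp (fun ω ↦ timeAvgSq X t ω - limitVar H lam sig) 2 P ∧
      ∫ ω, |timeAvgSq X t ω - limitVar H lam sig| ^ 2 ∂P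
        ≤ (4 + 16 * M / m + 4 * (4 * (M ^ 2 + 4 / (4 * H - 1)) + 2 * c ^ 2) / m)
          * ergodicBound H lam sig x₀ t := by
  have hH0 : 0 < H := by linarith [hH.1]
  have hm0 : 0 < m := by
    have := Real.Gamma_pos_of_pos (by linarith : 0 < 2 * H + 1)
    rw [hm]; positivity
  rw [← hm] at hc
  obtain ⟨b, hb, h⟩ := hX.exists_eq_ouProc hB hH0 hlam
  set a := sig / lam ^ H with ha
  have hτ : 0 < lam * t := by positivity
  obtain ⟨h1, h2⟩ := hb.integral_sq_timeAvg_le hH hM hc x₀ a hτ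
  have heq : (fun ω ↦ timeAvgSq X t ω - limitVar H lam sig) =ᵐ[P] fun ω ↦
      (1 / (lam * t) * ∫ u in (0 : ℝ)..lam * t, (exp (-u) * x₀ + a * ouProc b u ω) ^ 2)
        - a ^ 2 * m := h.mono fun ω hω ↦ by
    simp only
    rw [timeAvgSq_eq_of_forall (f := fun u ↦ exp (-u) * x₀ + a * ouProc b u ω) hlam ht.le hω,
      limitVar_eq sig hH0 hlam, ← hm]
  refine ⟨(memLp_congr_ae heq).2 h1, ?_⟩
  simp only [sq_abs]
  have hsq : (fun ω ↦ (timeAvgSq X t ω - limitVar H lam sig) ^ 2) =ᵐ[P] _ :=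
    heq.fun_comp (· ^ 2)
  refine (integral_congr_ae hsq).trans_le (h2.trans ?_)
  have h3 := le_ergodicBound (H := H) (sig := sig) x₀ hH0 hlam ht
  rw [← hm, ← ha] at h3
  have hq : 0 < 4 * H - 1 := by linarith [hH.1]
  set Q := 4 * (M ^ 2 + 4 / (4 * H - 1)) + 2 * c ^ 2 with hQ
  have hQ0 : 0 ≤ Q := by positivity
  refine le_trans ?_ (mul_le_mul_of_nonneg_left h3 (by positivity))
  set τ := lam * t
  have e : (4 + 16 * M / m + 4 * Q / m) * (x₀ ^ 4 / τ ^ 2 + a ^ 2 * m * (a ^ 2 + x₀ ^ 2) / τ)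
      - 4 * (x₀ ^ 4 / τ ^ 2 + 4 * M * (a ^ 2 * x₀ ^ 2) / τ + Q * a ^ 4 / τ)
      = (16 * M / m + 4 * Q / m) * (x₀ ^ 4 / τ ^ 2)
        + 4 * (a ^ 2 * m * (a ^ 2 + x₀ ^ 2) / τ)
        + 16 * M * a ^ 4 / τ + 4 * Q * (a ^ 2 * x₀ ^ 2) / τ := by
    field_simp
    ring
  have e0 : 0 ≤ (16 * M / m + 4 * Q / m) * (x₀ ^ 4 / τ ^ 2)
        + 4 * (a ^ 2 * m * (a ^ 2 + x₀ ^ 2) / τ)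
        + 16 * M * a ^ 4 / τ + 4 * Q * (a ^ 2 * x₀ ^ 2) / τ := by positivity
  linarith

end Solution

lemma supBound_nonneg {H lam sig T : ℝ} (x₀ : ℝ) (hH : 1 / 4 < H) (hlam : 0 < lam)
    (hsig : 0 < sig) (hT : 0 ≤ T) : 0 ≤ supBound H lam sig x₀ T := by
  have h := sq_add_mul_log_le_supBound x₀ hH hlam hsig hT
  have hL : 0 ≤ log (1 + lam * T) := Real.log_nonneg (by nlinarith [mul_nonneg hlam.le hT])
  have : 0 ≤ x₀ ^ 2 + (sig / lam ^ H) ^ 2 * (1 + log (1 + lam * T)) := by positivity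
  linarith

lemma ergodicBound_nonneg {H lam sig t : ℝ} (x₀ : ℝ) (hH : 0 < H) (hlam : 0 < lam) (ht : 0 < t) :
    0 ≤ ergodicBound H lam sig x₀ t := by
  have := Real.Gamma_pos_of_pos (by linarith : 0 < 2 * H + 1)
  exact le_trans (by positivity) (le_ergodicBound (sig := sig) x₀ hH hlam ht)

end FracOU

theorem lemma3p1 (H : ℝ) (hH : H ∈ Set.Ioo (1 / 4 : ℝ) 1) :
    -- the constant `C` and the remainder `R` (a function of `lam`, `sig`, `t`) depend only on `H`
    ∃ C : ℝ, 0 < C ∧ ∃ R : ℝ → ℝ → ℝ → ℝ,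
      (H < 1 / 2 → ∀ θ ∈ Set.Ioo (0 : ℝ) 1, ∃ Cθ : ℝ, 0 < Cθ ∧
        ∀ lam sig t : ℝ, 0 < lam → 0 < sig → 0 < t →
          0 ≤ R lam sig t ∧
          R lam sig t / sig ^ 4 ≤ Cθ * FracOU.remainderBound H θ lam t) ∧
      (H = 1 / 2 → ∀ lam sig t : ℝ, R lam sig t = 0) ∧
      ∀ (Ω : Type*) [MeasurableSpace Ω] (P : Measure Ω) [IsProbabilityMeasure P]
        (B X : ℝ≥0 → Ω → ℝ) (lam sig x₀ : ℝ), 0 < lam → 0 < sig →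
        FracOU.IsFractionalBrownian H B P → FracOU.IsOUSolution lam sig x₀ B X P →
        -- the second moment
        (∀ t : ℝ≥0, MemLp (X t) 2 P ∧
          ∫ ω, X t ω ^ 2 ∂P =
            Real.exp (-2 * lam * t) * |x₀| ^ 2
            + sig ^ 2 * H *
              ((∫ z in (0 : ℝ)..t, Real.exp (-lam * z) * |z| ^ (2 * H - 1))
                + Real.exp (-lam * t) *
                  ∫ z in (0 : ℝ)..t, Real.exp (-lam * (t - z)) * |z| ^ (2 * H - 1))) ∧
        -- exponential convergence of the second moment
        (∀ t : ℝ≥0,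
          |(∫ ω, X t ω ^ 2 ∂P) - FracOU.limitVar H lam sig| ≤
            C * (Real.exp (-2 * lam * t) * |x₀| ^ 2
              + sig ^ 2 * (1 / lam ^ (2 * H)) * Real.exp (-(lam / 2) * t))) ∧
        -- moment of the supremum
        (∀ T : ℝ≥0,
          AEMeasurable (fun ω ↦ ⨆ t ∈ Set.Icc 0 T, ENNReal.ofReal (X t ω ^ 2)) P ∧
          ∫⁻ ω, ⨆ t ∈ Set.Icc 0 T, ENNReal.ofReal (X t ω ^ 2) ∂P ≤
            ENNReal.ofReal (C * FracOU.supBound H lam sig x₀ T)) ∧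
        -- rate of the mean square ergodic convergence
        (H ≤ 1 / 2 → ∀ t : ℝ, 0 < t →
          MemLp (fun ω ↦ FracOU.timeAvgSq X t ω - FracOU.limitVar H lam sig) 2 P ∧
          ∫ ω, |FracOU.timeAvgSq X t ω - FracOU.limitVar H lam sig| ^ 2 ∂P ≤
            C * (FracOU.ergodicBound H lam sig x₀ t + R lam sig t)) := by
  have hH0 : 0 < H := by linarith [hH.1]
  have hH1 : H ∈ Set.Ioo (0 : ℝ) 1 := ⟨hH0, hH.2⟩
  obtain ⟨c, hc0, hc⟩ := FracOU.exists_abs_ouCov_self_sub_le hH1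
  obtain ⟨M, hM0, hM⟩ := FracOU.exists_ouCov_self_le hH1
  obtain ⟨m, hm⟩ : ∃ m, m = Real.Gamma (2 * H + 1) / 2 := ⟨_, rfl⟩
  have hm0 : 0 < m := by
    have := Real.Gamma_pos_of_pos (by linarith : 0 < 2 * H + 1)
    rw [hm]; positivity
  have hS := FracOU.supConst_nonneg hH0
  have hq : 0 < 4 * H - 1 := by linarith [hH.1]
  set C₃ := 8 * (2 + FracOU.supConst H) with hC₃
  set C₄ := 4 + 16 * M / m + 4 * (4 * (M ^ 2 + 4 / (4 * H - 1)) + 2 * c ^ 2) / m with hC₄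
  have hC₃0 : 0 ≤ C₃ := by positivity
  have hC₄0 : 0 ≤ C₄ := by positivity
  -- The squared covariance is integrable in the time lag for all `1/4 < H ≤ 1/2`. The fluctuations
  -- of the time average are then dominated by `ergodicBound`, which leaves a zero remainder.
  refine ⟨1 + c + C₃ + C₄, by positivity, fun _ _ _ ↦ 0, fun _ θ _ ↦ ⟨1, one_pos,
    fun lam sig t hlam _ ht ↦ ⟨le_rfl, ?_⟩⟩, fun _ _ _ _ ↦ rfl, ?_⟩
  · rw [zero_div, one_mul]
    exact FracOU.remainderBound_nonneg hlam ht
  intro Ω _ P _ B X lam sig x₀ hlam hsig hB hX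
  refine ⟨fun t ↦ ?_, fun t ↦ ?_, fun T ↦ ?_, fun hH2 t ht ↦ ?_⟩
  · obtain ⟨h1, h2⟩ := hX.integral_sq hB hH0 hlam t
    exact ⟨h1, by rw [h2, FracOU.sq_mul_ouCov_self sig hH0 hlam t.coe_nonneg, sq_abs]⟩
  · refine (hX.abs_integral_sq_sub_limitVar_le hB hH0 hlam hc t).trans ?_
    rw [sq_abs, mul_one_div, mul_add]
    gcongr ?_ + ?_
    · exact le_mul_of_one_le_left (by positivity) (by linarith)
    · exact mul_le_mul_of_nonneg_right (by linarith) (by positivity)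
  · obtain ⟨h1, h2⟩ := hX.lintegral_biSup_sq_le hB hH.1 hlam hsig T
    refine ⟨h1, h2.trans (ENNReal.ofReal_le_ofReal ?_)⟩
    exact mul_le_mul_of_nonneg_right (by linarith)
      (FracOU.supBound_nonneg x₀ hH.1 hlam hsig T.2)
  · obtain ⟨h1, h2⟩ := hX.integral_sq_timeAvgSq_sub_le hB ⟨hH.1, hH2⟩ hlam hM hM0.le hm hc ht
    refine ⟨h1, h2.trans ?_⟩
    rw [add_zero]
    exact mul_le_mul_of_nonneg_right (by linarith)
      (FracOU.ergodicBound_nonneg x₀ hH0 hlam ht)
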